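/- Let $n\ge 5$, let $[n]=\mathbb Z/n$ with its cyclic order, and call the $3$-subsets of $[n]$ triangles. Two triangles $A,B$ cross if there are $a,c\in A\setminus B$ and $b,d\in B\setminus A$ with $(a,b,c,d)$ cyclically ordered. A cluster is an inclusion-maximal family $\mathscr F$ of pairwise non-crossing triangles. If $z,a,b,c,d$ are distinct, $(a,b,c,d)$ is cyclically ordered and $\{z,a,b\},\{z,b,c\},\{z,c,d\},\{z,d,a\},\{z,a,c\}\in\mathscr F$, then replacing $\{z,a,c\}$ by $\{z,b,d\}$ is a mutation. Let $v:\mathbb C[\mathscr G(3,n)]\to\mathbb C$ be a $\mathbb C$-algebra homomorphism on the homogeneous coordinate ring of the Grassmannian (the polynomial ring in the Plücker coordinates modulo the Plücker relations), and let $v(\{a,b,c\})$ be its value on the Plücker coordinate with sorted indices $a,b,c$. For $x\in[n]$, $(\mathscr F,v)$ is unitary in $x$ if $v$ is a nonzero constant on $\mathscr F_x=\{t\in\mathscr F: x\in t\}$. Let $G(\mathscr F_x)$ be the graph with an edge $\{a,b\}$ for each $\{x,a,b\}\in\mathscr F$. Vertices of degree $\ge2$ are triangulation points; list them as $P_1=x+1,\dots,P_s=x-1$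 in the order $x+1<_x x+2<_x\dots<_x x-1$. A vertex of degree $1$ adjacent to $P_i$ is a leaf in $P_i$. The fan of $P_i$ is the list, in the order $<_x$, of $P_{i-1}$ (if $i>1$), the leaves in $P_i$, and $P_{i+1}$ (if $i<s$). The border triangles of $\mathscr F_x$ are the sets $\{P_i,Q,Q'\}$ with $Q,Q'$ consecutive in the fan of $P_i$. **(1) Removing leaves.** Let $(\mathscr F,v)$ be unitary in $x$ and let $Q_2\notin\{x-2,x+2\}$ be a leaf in a triangulation point $P$. Then $Q_2$ has a predecessor $Q_1$ and a successor $Q_3$ in the fan of $P$, and $\mathscr F'=(\mathscr F\cup\{\{P,Q_1,Q_3\}\})\setminus\{\{x,P,Q_2\}\}$ is a cluster obtained from $\mathscr F$ by a mutation. It is unitary in $x$ with the same constant, $G(\mathscr F'_x)$ is $G(\mathscr F_x)$ without the edge $\{P,Q_2\}$, and $v(\{P,Q_1,Q_3\})=v(\{P,Q_1,Q_2\})+v(\{P,Q_2,Q_3\})$. **(2) Removing degree-2 points.** Let $(\mathscr F,v)$ be unitary in $x$ and let $P_i\notin\{x-1,x+1\}$ be a triangulation point of degree $2$ in $G(\mathscr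 F_x)$. If $P_i\ne x+2$, let $Q_1$ be the predecessor of $P_i$ in the fan of $P_{i-1}$, where $P_i$ stands last; it exists. Then $\mathscr F'=(\mathscr F\cup\{\{Q_1,P_{i-1},P_{i+1}\}\})\setminus\{\{x,P_{i-1},P_i\}\}$ is a cluster obtained by a mutation. It is unitary in $x$ with the same constant, its graph at $x$ is $G(\mathscr F_x)$ without the edge $\{P_{i-1},P_i\}$, and $v(\{Q_1,P_{i-1},P_{i+1}\})=v(\{Q_1,P_{i-1},P_i\})+v(\{P_{i-1},P_i,P_{i+1}\})$. If $P_i\neq x-2$, let $Q_2$ be the successor of $P_i$ in the fan of $P_{i+1}$, where $P_i$ stands first; it exists. Then the same holds for $\mathscr F'=(\mathscr F\cup\{\{P_{i-1},P_{i+1},Q_2\}\})\setminus\{\{x,P_i,P_{i+1}\}\}$, with the edge $\{P_i,P_{i+1}\}$ removed and $v(\{P_{i-1},P_{i+1},Q_2\})=v(\{P_i,P_{i+1},Q_2\})+v(\{P_{i-1},P_i,P_{i+1}\})$. **(3) The algorithm.** Let $v(t)=1$ for all $t\in\mathscr F_x$. The input is $G=G(\mathscr F_x)$ and the values of $v$ on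 the border triangles. *Initialization.* Each triangulation point $P\neq x\pm1$ receives as label the sum of the values of the border triangles $\{P,Q,Q'\}$ with $Q,Q'$ consecutive in its fan, and its leaves are removed. If $x+2$ is a leaf in $x+1$, the same is done at $x+1$, except that the leaf $x+2$ is kept. If $x-2$ is a leaf in $x-1$, the same is done at $x-1$, except that the leaf $x-2$ is kept. All other points are unlabelled. *Loop.* While $G$ has more than $3$ edges, choose a point $P\notin\{x+1,x-1\}$ of degree $2$. * If $P=x+2$: put $\mathrm{label}(x+1):=\mathrm{label}(x+2)$; for the neighbour $P'\ne x+1$ of $x+2$ add $\mathrm{label}(x+2)$ to $\mathrm{label}(P')$; remove the edge $\{x+2,P'\}$ and the label of $x+2$. * If $P=x-2$: do the same with $x-2,x-1$ in place of $x+2,x+1$. * Otherwise: add $\mathrm{label}(P)$ to the labels of both neighbours of $P$, then remove $P$ with its edges and its label. *Claim.* Say that a cluster realizes a state of the algorithm if it takes the value $1$ on all its triangles containing $x$, its graph at $x$ is the current graph and has no leaves other than possibly $x\pm2$, and each triangulation point $P$ carries as label the sum of the values of the border triangles at $P$, except that $x+1$ (respectively $x-1$) is unlabelled when $x+2$ (respectively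 $x-2$) is not a leaf in it, and all other points are unlabelled. Then: * There is a sequence of mutations from $\mathscr F$, through clusters with value $1$ on the triangles containing $x$, each removing one leaf other than $x\pm 2$ from the graph, that ends in a cluster realizing the state after initialization. * Whenever a cluster realizes a state and a pass of the loop leads to another state, a sequence of mutations through such clusters, each removing one edge of the graph, leads to a cluster realizing the new state. * For all choices made, the loop never gets stuck and terminates. * When it terminates, the graph has exactly the edges $\{x-2,x-1\},\{x-1,x+1\},\{x+1,x+2\}$; every cluster realizing the final state contains $\{x-1,x+1,x+2\}$ and $\{x-2,x-1,x+1\}$; and $\mathrm{label}(x+1)=v(\{x-1,x+1,x+2\})$, $\mathrm{label}(x-1)=v(\{x-2,x-1,x+1\})$. **(4) Recursion.** Put $\Delta_k(i)=v(\{i,i+1,i+k+2\})$ and $\Delta^k(i)=v(\{i,i+k+1,i+k+2\})$. If $v(\{i,i+1,i+2\})=1$ for all $i\in[n]$, then for all $i$ and $3\le k<n-3$ $$\Delta_k(i)=\Delta_1(i)\Delta_{k-1}(i+1)-\Delta^1(i+1)\Delta_{k-2}(i+2)+\Delta_{k-3}(i+3),$$ $$\Delta^k(i)=\Delta^1(i+k-1)\Delta^{k-1}(i)-\Delta_1(i+k-2)\Delta^{k-2}(i)+\Delta^{k-3}(i),$$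 and $\Delta_2(i)=\Delta_1(i)\Delta_1(i+1)-\Delta^1(i+1)$, $\Delta^2(i)=\Delta^1(i+1)\Delta^1(i)-\Delta_1(i)$. **(5) Unitary friezes.** Let $v(t)=1$ for all $t\in\mathscr F$, and for $i,j\in\mathbb Z$ let $m_{i,j}=v(\{i,i+1,i+j+2\})$, indices modulo $n$, read as $0$ when two of the three indices coincide. Then $(m_{i,j})$ is a tame $\mathrm{SL}_3$-frieze pattern of width $n-4$: rows $j=-2,-1,n-2,n-1$ are $0$, rows $j=0,n-3$ are $1$, all $3\times3$ diamonds have determinant $1$ and all $4\times4$ diamonds have determinant $0$. For every $x$ run the algorithm on $G(\mathscr F_x)$ with all border triangles given the value $1$. There are $a,b:[n]\to\mathbb C$ such that, for every $x$, the output $\mathrm{label}(x+1)=b(x-1)$, $\mathrm{label}(x-1)=a(x-2)$ is obtained. For any such $a,b$, all nontrivial entries of the frieze are the values of the recursions in (4) started with $\Delta_0=\Delta^0=1$, $\Delta_1=a$, $\Delta^1=b$: for $1\le k\le n-4$ the recursion for $\Delta_k(i)$ gives $m_{i,k}$, and the one for $\Delta^k(i)$ gives $m_{i+k+1,\,n-3-k}$.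 -/

import Mathlib

noncomputable section

/-- The index set `[n]` with its cyclic order is modelled by `ZMod n`, where `sbtw a b c` says that
`a, b, c` are pairwise distinct and cyclically ordered. Two subsets cross if there are
`a, c` in `A \ B` and `b, d` in `B \ A` with `(a, b, c, d)` cyclically ordered. -/
def Crossing {n : ℕ} (A B : Finset (ZMod n)) : Prop :=
  ∃ a ∈ A \ B, ∃ c ∈ A \ B, ∃ b ∈ B \ A, ∃ d ∈ B \ A, sbtw a b c ∧ sbtw c d a

/-- Weakly separated families of triangles (three-element subsets). -/
def IsWeaklySeparated {n : ℕ} (F : Set (Finset (ZMod n))) : Prop :=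
  (∀ t ∈ F, t.card = 3) ∧ ∀ s ∈ F, ∀ t ∈ F, ¬ Crossing s t

/-- Clusters of Plücker variables, identified with the maximal weakly separated families. -/
def IsCluster {n : ℕ} (F : Set (Finset (ZMod n))) : Prop :=
  Maximal IsWeaklySeparated F

/-- Mutation of a family of triangles at `{z, a, c}`, which is replaced by `{z, b, d}`. -/
def IsMutation {n : ℕ} (F F' : Set (Finset (ZMod n))) : Prop :=
  ∃ z a b c d : ZMod n, [z, a, b, c, d].Nodup ∧ sbtw a b c ∧ sbtw c d a ∧
    {z, a, b} ∈ F ∧ {z, b, c} ∈ F ∧ {z, c, d} ∈ F ∧ {z, d, a} ∈ F ∧ {z, a, c} ∈ F ∧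
    F' = insert {z, b, d} (F \ {{z, a, c}})

/-! ### The homogeneous coordinate ring of the Grassmannian of 3-spaces -/

/-- Triangles, i.e. three-element subsets of `[n]`. -/
abbrev Triangle (n : ℕ) : Type := {t : Finset (ZMod n) // t.card = 3}

open scoped Classical in
/-- The homogeneous coordinate `x_{a,b,c}`, alternating in `a, b, c`. The variable attached to
`{a, b, c}` is the coordinate for the increasing order of the indices; cyclic rotations of three
indices are even, so the sign is `1` exactly when `(a, b, c)` is cyclically ordered. -/
def homCoord {n : ℕ} (a b c : ZMod n) : MvPolynomial (Triangle n) ℂ :=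
  if h : ({a, b, c} : Finset (ZMod n)).card = 3 then
    if sbtw a b c then MvPolynomial.X ⟨{a, b, c}, h⟩ else - MvPolynomial.X ⟨{a, b, c}, h⟩
  else 0

/-- The Plücker relations. For unsorted indices they agree up to sign with those for
sorted indices, and for repeated indices they are trivial. -/
def pluckerRelation {n : ℕ} (i₁ i₂ : ZMod n) (j : Fin 4 → ZMod n) :
    MvPolynomial (Triangle n) ℂ :=
  ∑ l : Fin 4, (-1) ^ (l : ℕ) * homCoord i₁ i₂ (j l) *
    homCoord (j (l.succAbove 0)) (j (l.succAbove 1)) (j (l.succAbove 2))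

/-- The ideal generated by the Plücker relations. -/
def pluckerIdeal (n : ℕ) : Ideal (MvPolynomial (Triangle n) ℂ) :=
  Ideal.span {f | ∃ i₁ i₂ j, f = pluckerRelation i₁ i₂ j}

/-- The homogeneous coordinate ring of the Grassmannian `G(3,n)` over the complex numbers. -/
abbrev GrassmannRing (n : ℕ) : Type := MvPolynomial (Triangle n) ℂ ⧸ pluckerIdeal n

/-- The Plücker coordinate with sorted indices attached to a triangle (`0` for other subsets). -/
def plucker {n : ℕ} (t : Finset (ZMod n)) : GrassmannRing n :=
  if h : t.card = 3 then Ideal.Quotient.mk (pluckerIdeal n) (MvPolynomial.X ⟨t, h⟩) else 0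

/-- The pair `(F, v)` is unitary in `x`, with common value `c` on the triangles containing `x`. -/
def HasValueAt {n : ℕ} (v : GrassmannRing n →ₐ[ℂ] ℂ) (F : Set (Finset (ZMod n))) (x : ZMod n)
    (c : ℂ) : Prop :=
  c ≠ 0 ∧ ∀ t ∈ F, x ∈ t → v (plucker t) = c

/-! ### The graph of a family at a point -/

/-- The graph `G(F_x)`: an edge `{a, b}` for each triangle `{x, a, b}` in `F`. Its vertices in the
sense of the mathematics are the non-isolated ones. -/
def linkGraph {n : ℕ} (F : Set (Finset (ZMod n))) (x : ZMod n) : SimpleGraph (ZMod n) where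
  Adj a b := a ≠ b ∧ a ≠ x ∧ b ≠ x ∧ {x, a, b} ∈ F
  symm := ⟨fun a b h => ⟨h.1.symm, h.2.2.1, h.2.1, by
    have h4 := h.2.2.2
    rwa [Finset.pair_comm a b] at h4⟩⟩
  loopless := ⟨fun _ h => h.1 rfl⟩

/-- The degree of a vertex. -/
def deg {n : ℕ} (G : SimpleGraph (ZMod n)) (p : ZMod n) : ℕ := (G.neighborSet p).ncard

/-- Triangulation points. -/
def IsTriPoint {n : ℕ} (G : SimpleGraph (ZMod n)) (p : ZMod n) : Prop := 2 ≤ deg G p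

/-- `q` is a leaf in the triangulation point `p`. -/
def IsLeafAt {n : ℕ} (G : SimpleGraph (ZMod n)) (p q : ZMod n) : Prop :=
  IsTriPoint G p ∧ G.Adj p q ∧ deg G q = 1

/-- `p` and `q` are triangulation points, and `q` is the next one after `p` in the linear order
`<_x` on `[n] \ {x}` in which `a <_x b` means that `(x, a, b)` is cyclically ordered. -/
def IsNextTri {n : ℕ} (x : ZMod n) (G : SimpleGraph (ZMod n)) (p q : ZMod n) : Prop :=
  IsTriPoint G p ∧ IsTriPoint G q ∧ sbtw x p q ∧
    ∀ r, IsTriPoint G r → ¬ (sbtw x p r ∧ sbtw x r q)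

/-- The elements `x + 1, x + 2, …, x + (n - 1)` of `[n] \ {x}` in the order `<_x`. -/
def around {n : ℕ} (x : ZMod n) : List (ZMod n) :=
  (List.range (n - 1)).map fun k => x + ((k + 1 : ℕ) : ZMod n)

open scoped Classical in
/-- The list, in the order `<_x`, of the previous triangulation point (if `p` is not the first
one), the leaves in `p`, and the next triangulation point (if `p` is not the last one). -/
def fan {n : ℕ} (x : ZMod n) (G : SimpleGraph (ZMod n)) (p : ZMod n) : List (ZMod n) :=
  (around x).filter fun q => decide (IsLeafAt G p q ∨ IsNextTri x G q p ∨ IsNextTri x G p q)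

/-- The border triangles `{p, q, r}`, for `p` a triangulation point and `q, r` consecutive
in the fan of `p`. -/
def borderTriangles {n : ℕ} (x : ZMod n) (G : SimpleGraph (ZMod n)) : Set (Finset (ZMod n)) :=
  {t | ∃ p q r, IsTriPoint G p ∧ [q, r] <:+: fan x G p ∧ t = {p, q, r}}

/-- The sum of the values of the border triangles at `p`. -/
def borderSum {n : ℕ} (x : ZMod n) (G : SimpleGraph (ZMod n)) (val : Finset (ZMod n) → ℂ)
    (p : ZMod n) : ℂ :=
  (((fan x G p).zip (fan x G p).tail).map fun e => val {p, e.1, e.2}).sum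

/-! ### The algorithm -/

/-- A state of the algorithm: the current graph and the current labels (`none` where there is
no label). -/
structure AlgState (n : ℕ) where
  graph : SimpleGraph (ZMod n)
  label : ZMod n → Option ℂ

open scoped Classical in
/-- The labels given by the initialization: triangulation points other than `x + 1` and `x - 1`
receive the sum of the values of their border triangles, and so do `x + 1` if `x + 2` is a leaf
and `x - 1` if `x - 2` is a leaf. -/
def borderLabel {n : ℕ} (x : ZMod n) (G : SimpleGraph (ZMod n)) (val : Finset (ZMod n) → ℂ) :
    ZMod n → Option ℂ := fun p =>
  if IsTriPoint G p ∧ (p = x + 1 → IsLeafAt G (x + 1) (x + 2)) ∧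
      (p = x - 1 → IsLeafAt G (x - 1) (x - 2)) then
    some (borderSum x G val p)
  else none

/-- The leaf `q` in `p` is removed by the initialization. -/
def IsRemovedLeaf {n : ℕ} (x : ZMod n) (G : SimpleGraph (ZMod n)) (p q : ZMod n) : Prop :=
  IsLeafAt G p q ∧ ((p ≠ x + 1 ∧ p ≠ x - 1) ∨
    (p = x + 1 ∧ IsLeafAt G (x + 1) (x + 2) ∧ q ≠ x + 2) ∨
    (p = x - 1 ∧ IsLeafAt G (x - 1) (x - 2) ∧ q ≠ x - 2))

/-- The state after the initialization, computed from the graph and the values `val`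
of the border triangles. -/
def initState {n : ℕ} (x : ZMod n) (G : SimpleGraph (ZMod n)) (val : Finset (ZMod n) → ℂ) :
    AlgState n where
  graph := G.deleteEdges {e | ∃ p q, IsRemovedLeaf x G p q ∧ e = s(p, q)}
  label := borderLabel x G val

/-- The assignment `label(j) := label(j) + label(p)`. -/
def addLabel {n : ℕ} (lab : ZMod n → Option ℂ) (j p : ZMod n) : ZMod n → Option ℂ :=
  Function.update lab j (Option.map₂ (fun a b => a + b) (lab j) (lab p))

/-- The condition of the while loop: there are more than three edges. -/
def Running {n : ℕ} (s : AlgState n) : Prop := 3 < s.graph.edgeSet.ncard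

/-- One pass through the body of the while loop. -/
inductive Step {n : ℕ} (x : ZMod n) : AlgState n → AlgState n → Prop
  | right (s : AlgState n) (q : ZMod n) (hs : Running s) (hp : deg s.graph (x + 2) = 2)
      (hq : s.graph.Adj (x + 2) q) (hne : q ≠ x + 1) :
      Step x s
        { graph := s.graph.deleteEdges {s(x + 2, q)}
          label := Function.update
            (addLabel (Function.update s.label (x + 1) (s.label (x + 2))) q (x + 2))
            (x + 2) none }
  | left (s : AlgState n) (q : ZMod n) (hs : Running s) (hp : deg s.graph (x - 2) = 2)
      (hq : s.graph.Adj (x - 2) q) (hne : q ≠ x - 1) :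
      Step x s
        { graph := s.graph.deleteEdges {s(x - 2, q)}
          label := Function.update
            (addLabel (Function.update s.label (x - 1) (s.label (x - 2))) q (x - 2))
            (x - 2) none }
  | inner (s : AlgState n) (p q r : ZMod n) (hs : Running s) (hp : deg s.graph p = 2)
      (h₁ : p ≠ x + 1) (h₂ : p ≠ x - 1) (h₃ : p ≠ x + 2) (h₄ : p ≠ x - 2)
      (hq : s.graph.Adj p q) (hr : s.graph.Adj p r) (hne : q ≠ r) :
      Step x s
        { graph := s.graph.deleteEdges {s(p, q), s(p, r)}
          label := Function.update (addLabel (addLabel s.label q p) r p) p none }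

/-- The states of the while loop that can occur, for some choices of the degree-2 points. -/
def Reachable {n : ℕ} (x : ZMod n) (G : SimpleGraph (ZMod n)) (val : Finset (ZMod n) → ℂ)
    (s : AlgState n) : Prop :=
  Relation.ReflTransGen (Step x) (initState x G val) s

/-- The algorithm can stop with output `b = label(x + 1)` and `a = label(x - 1)`. -/
def Outputs {n : ℕ} (x : ZMod n) (G : SimpleGraph (ZMod n)) (val : Finset (ZMod n) → ℂ)
    (b a : ℂ) : Prop :=
  ∃ s, Reachable x G val s ∧ ¬ Running s ∧ s.label (x + 1) = some b ∧ s.label (x - 1) = some a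

/-! ### The clusters behind the algorithm -/

/-- A mutation of clusters, unitary in `x` with value `1`, removing one edge from the graph
at `x`. -/
def EdgeMutation {n : ℕ} (v : GrassmannRing n →ₐ[ℂ] ℂ) (x : ZMod n)
    (F F' : Set (Finset (ZMod n))) : Prop :=
  IsMutation F F' ∧ IsCluster F' ∧ HasValueAt v F' x 1 ∧
    ∃ p q, (linkGraph F x).Adj p q ∧ linkGraph F' x = (linkGraph F x).deleteEdges {s(p, q)}

/-- As above, where the removed edge belongs to a leaf other than `x + 2` and `x - 2`. -/
def LeafMutation {n : ℕ} (v : GrassmannRing n →ₐ[ℂ] ℂ) (x : ZMod n)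
    (F F' : Set (Finset (ZMod n))) : Prop :=
  IsMutation F F' ∧ IsCluster F' ∧ HasValueAt v F' x 1 ∧
    ∃ p q, IsLeafAt (linkGraph F x) p q ∧ q ≠ x + 2 ∧ q ≠ x - 2 ∧
      linkGraph F' x = (linkGraph F x).deleteEdges {s(p, q)}

/-- The cluster `F` is unitary in `x` with value `1`, its graph at `x` is the graph of the state
and has no leaves except possibly `x + 2` and `x - 2`, and the labels of the state are the values
of `v` on the border triangles of `F` at `x`. -/
def Realizes {n : ℕ} (v : GrassmannRing n →ₐ[ℂ] ℂ) (x : ZMod n) (F : Set (Finset (ZMod n)))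
    (s : AlgState n) : Prop :=
  IsCluster F ∧ HasValueAt v F x 1 ∧ s.graph = linkGraph F x ∧
    (∀ p q, IsLeafAt s.graph p q → q = x + 2 ∨ q = x - 2) ∧
    s.label = borderLabel x s.graph fun t => v (plucker t)

/-! ### Almost continuous Plücker coordinates and friezes -/

/-- The value of `v` at `{i, i + 1, i + k + 2}`. -/
def lowerDelta {n : ℕ} (v : GrassmannRing n →ₐ[ℂ] ℂ) (k : ℕ) (i : ZMod n) : ℂ :=
  v (plucker {i, i + 1, i + k + 2})

/-- The value of `v` at `{i, i + k + 1, i + k + 2}`. -/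
def upperDelta {n : ℕ} (v : GrassmannRing n →ₐ[ℂ] ℂ) (k : ℕ) (i : ZMod n) : ℂ :=
  v (plucker {i, i + k + 1, i + k + 2})

/-- The recursion computing the values at `{i, i + 1, i + k + 2}` from the values `a i` at
`{i, i + 1, i + 3}` and `b i` at `{i, i + 2, i + 3}`. -/
def lowerRec {n : ℕ} (a b : ZMod n → ℂ) : ℕ → ZMod n → ℂ
  | 0, _ => 1
  | 1, i => a i
  | 2, i => a i * a (i + 1) - b (i + 1)
  | k + 3, i => a i * lowerRec a b (k + 2) (i + 1) - b (i + 1) * lowerRec a b (k + 1) (i + 2)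
      + lowerRec a b k (i + 3)

/-- The recursion computing the values at `{i, i + k + 1, i + k + 2}` from the same data. -/
def upperRec {n : ℕ} (a b : ZMod n → ℂ) : ℕ → ZMod n → ℂ
  | 0, _ => 1
  | 1, i => b i
  | 2, i => b (i + 1) * b i - a i
  | k + 3, i => b (i + k + 2) * upperRec a b (k + 2) i - a (i + k + 1) * upperRec a b (k + 1) i
      + upperRec a b k i

/-- Tame `SL₃`-frieze patterns of width `w`. The entry `m i j` stands in row `j`, the rows
`-2, -1` and `w + 2, w + 3` being zero and the rows `0` and `w + 1` being one; `m i (j + 1)` is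
the upper right neighbour of `m i j`, and `m (i + 1) j` is its right neighbour. -/
def IsTameSL3Frieze (w : ℕ) (m : ℤ → ℤ → ℂ) : Prop :=
  (∀ i, m i (-2) = 0 ∧ m i (-1) = 0 ∧ m i 0 = 1 ∧
    m i (w + 1) = 1 ∧ m i (w + 2) = 0 ∧ m i (w + 3) = 0) ∧
  (∀ i j : ℤ, 0 ≤ j → j ≤ w + 1 →
    (Matrix.of fun a b : Fin 3 => m (i + (a : ℕ)) (j + (b : ℕ) - (a : ℕ))).det = 1) ∧
  (∀ i j : ℤ, 1 ≤ j → j ≤ w →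
    (Matrix.of fun a b : Fin 4 => m (i + (a : ℕ)) (j + (b : ℕ) - (a : ℕ))).det = 0)

/-- The image under `v` of the Plücker frieze of type `(3, n)`. -/
def pluckerFrieze {n : ℕ} (v : GrassmannRing n →ₐ[ℂ] ℂ) (i j : ℤ) : ℂ :=
  v (plucker {(i : ZMod n), (i : ZMod n) + 1, (i : ZMod n) + (j : ZMod n) + 2})

/-- An array is a unitary `SL₃`-frieze (of width `n - 4`) obtained from the cluster `F` if it is
the image of the Plücker frieze under a specialization of `F` to `1`. -/
def IsUnitaryFriezeOf {n : ℕ} (F : Set (Finset (ZMod n))) (m : ℤ → ℤ → ℂ) : Prop :=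
  IsCluster F ∧ ∃ v : GrassmannRing n →ₐ[ℂ] ℂ, (∀ t ∈ F, v (plucker t) = 1) ∧ m = pluckerFrieze v

end

/-!
All arguments take place in the link of a point `x`: the graph `linkGraph F x`, with the circle cut
open at `x`. Positions along the circle are natural numbers (`pos e x`), read in either direction
`e = ±1`, so that a statement and its mirror image are one lemma.

**Structure of the link.** For a cluster the link is a noncrossing graph. What makes it rigid is
maximality: an edge can be missing only if another edge crosses it or a triangle avoiding `x`
straddles one of its ends (`IsCluster.exists_of_not_adj`). Since a triangle `{x, p, q}` is an edge
both in the link of `x` and in that of `p`, facts about links can be moved from one point to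
another. In this way one finds that the first and last neighbours of a triangulation point other
than `x ± 1` are adjacent (`IsCluster.adj_first_last`), and that consecutive neighbours of `p` on
one side form a triangle of the cluster with `p` or with `x`
(`IsCluster.adj_or_mem_of_consecutive`). Consequently consecutive triangulation points are adjacent
(`NextTri.adj`) and the border triangles belong to the cluster (`InFan.mem_of_consecutive`).

**Mutations.** Three neighbours `q₁, q₂, q₃` of `p` with `{p, q₁, q₂}` and `{p, q₂, q₃}` in the
cluster span a square with the diagonal `{x, p, q₂}`, and exchanging it removes the edge `{p, q₂}`
from the link (`IsCluster.mutation_at_edge`). As the three triangles at `x` have equal values, the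
three-term Plücker relation becomes additive. If `q₂` is a leaf in `p`, its neighbours in the fan
of `p` give such a square; if `q₂` has degree two, with neighbours `p` and `q₃`, the square is
completed by the element `q₁` next to `q₂` in the fan of `p`. The additive relation says
precisely that the border sums are unchanged in the first case, and that the border sum of the
removed point is added to those of its neighbours in the second (`IsLeafAt.borderSum_deleteEdges`,
`borderSum_deleteEdges_of_deg_two`). This is what the algorithm does with its labels
(`Realizes.step`).

**The loop.** Every edge has an end that is a triangulation point, so with more than three edges
left there is a triangulation point other than `x ± 1`; the one whose neighbours span the shortest
interval has degree two (`exists_deg_two`). The number of edges decreases in each pass, and with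
three edges left, each of `x ± 1` has a single border triangle, whose value is the label
(`Realizes.output`).

**Friezes.** If all intervals `{i, i + 1, i + 2}` have value one, the Plücker relations for the
indices `m, m + 1, m + 2, m + 3` express the last index of a coordinate by the three preceding
ones. Used twice, this is a linear recurrence of order three between the coordinates with indices
`j, j + 1, y` for a fixed `y` (`coord_recurrence`). Both recursions are instances of it, the
`4 × 4` diamonds are singular because of it, and the determinants of the `3 × 3` diamonds do not
change along it.
-/

set_option linter.unusedSectionVars false

noncomputable section

/-! ### Positions on the circle -/

/-- The position of `a` when the circle is cut at `x` and read in the direction of `e = ±1`: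
the number of steps from `x` to `a`. Working with both directions makes reflected arguments
instances of one another. -/
def pos {n : ℕ} (e : ℤˣ) (x a : ZMod n) : ℕ := (((e : ℤ) : ZMod n) * (a - x)).val

variable {n : ℕ}

theorem unit_mul_unit (e : ℤˣ) : ((e : ℤ) : ZMod n) * ((e : ℤ) : ZMod n) = 1 := by
  rcases Int.units_eq_one_or e with rfl | rfl <;> simp

@[simp] theorem pos_self (e : ℤˣ) (x : ZMod n) : pos e x x = 0 := by simp [pos]

/-- The element in position `k`. -/
def pt {n : ℕ} (e : ℤˣ) (x : ZMod n) (k : ℕ) : ZMod n := x + ((e : ℤ) : ZMod n) * k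

theorem pos_pt {e : ℤˣ} {x : ZMod n} {k : ℕ} (hk : k < n) : pos e x (pt e x k) = k := by
  simp [pos, pt, ← mul_assoc, unit_mul_unit, ZMod.val_cast_of_lt hk]

theorem pos_lt [NeZero n] (e : ℤˣ) (x a : ZMod n) : pos e x a < n := ZMod.val_lt _

theorem pos_inj [NeZero n] {e : ℤˣ} {x a b : ZMod n} : pos e x a = pos e x b ↔ a = b := by
  constructor
  · intro h
    have h1 := ZMod.val_injective n h
    have h2 := congrArg (((e : ℤ) : ZMod n) * ·) h1
    simpa [← mul_assoc, unit_mul_unit] using h2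
  · rintro rfl; rfl

theorem pos_eq_zero [NeZero n] {e : ℤˣ} {x a : ZMod n} : pos e x a = 0 ↔ a = x := by
  rw [← pos_self e x, pos_inj]

theorem pos_pos [NeZero n] {e : ℤˣ} {x a : ZMod n} : 0 < pos e x a ↔ a ≠ x := by
  rw [Nat.pos_iff_ne_zero, Ne, pos_eq_zero]

theorem pos_neg [NeZero n] (e : ℤˣ) {x a : ZMod n} (h : a ≠ x) :
    pos (-e) x a = n - pos e x a := by
  have h1 : ((e : ℤ) : ZMod n) * (a - x) ≠ 0 := by
    intro h0
    exact (pos_pos.2 h).ne' (by simp [pos, h0] : pos e x a = 0)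
  have : NeZero (((e : ℤ) : ZMod n) * (a - x)) := ⟨h1⟩
  simp only [pos, Units.val_neg, Int.cast_neg, neg_mul]
  rw [ZMod.val_neg_of_ne_zero]

/-- Cutting the circle at another point. -/
theorem pos_rebase [NeZero n] (e : ℤˣ) (x p a : ZMod n) :
    pos e p a = if pos e x p ≤ pos e x a then pos e x a - pos e x p
      else pos e x a + n - pos e x p := by
  have h0 : ((e : ℤ) : ZMod n) * (a - p) =
      ((e : ℤ) : ZMod n) * (a - x) - ((e : ℤ) : ZMod n) * (p - x) := by
    ring
  have h1 : pos e p a = (((e : ℤ) : ZMod n) * (a - x) - ((e : ℤ) : ZMod n) * (p - x)).val := by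
    rw [pos, h0]
  have hp := pos_lt e x p
  have ha := pos_lt e x a
  rw [h1]
  split_ifs with h
  · exact ZMod.val_sub h
  · push Not at h
    have e1 : ((pos e x a + n - pos e x p : ℕ) : ZMod n)
        = ((e : ℤ) : ZMod n) * (a - x) - ((e : ℤ) : ZMod n) * (p - x) := by
      rw [Nat.cast_sub (by omega)]
      simp [pos]
    rw [← e1, ZMod.val_cast_of_lt (by omega)]

/-- The cyclic order of `ZMod n` is the one of `Fin n`. -/
theorem sbtw_iff_val [NeZero n] (a b c : ZMod n) :
    sbtw a b c ↔ a.val < b.val ∧ b.val < c.val ∨ b.val < c.val ∧ c.val < a.val ∨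
      c.val < a.val ∧ a.val < b.val := by
  obtain ⟨m, rfl⟩ := Nat.exists_eq_succ_of_ne_zero (NeZero.ne n)
  exact Iff.rfl

theorem sbtw_iff_pos [NeZero n] (x a b c : ZMod n) :
    sbtw a b c ↔ pos 1 x a < pos 1 x b ∧ pos 1 x b < pos 1 x c ∨
      pos 1 x b < pos 1 x c ∧ pos 1 x c < pos 1 x a ∨
      pos 1 x c < pos 1 x a ∧ pos 1 x a < pos 1 x b := by
  have h (y : ZMod n) : y.val = pos 1 0 y := by simp [pos]
  rw [sbtw_iff_val, h, h, h, pos_rebase 1 x 0 a, pos_rebase 1 x 0 b, pos_rebase 1 x 0 c]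
  have := pos_lt 1 x a
  have := pos_lt 1 x b
  have := pos_lt 1 x c
  have := pos_lt 1 x 0
  split_ifs <;> omega

theorem sbtw_iff_pos_neg [NeZero n] (x a b c : ZMod n) :
    sbtw a b c ↔ pos (-1) x c < pos (-1) x b ∧ pos (-1) x b < pos (-1) x a ∨
      pos (-1) x b < pos (-1) x a ∧ pos (-1) x a < pos (-1) x c ∨
      pos (-1) x a < pos (-1) x c ∧ pos (-1) x c < pos (-1) x b := by
  rw [sbtw_iff_pos x]
  have h (y : ZMod n) : y = x ∧ pos 1 x y = 0 ∧ pos (-1) x y = 0 ∨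
      y ≠ x ∧ 0 < pos 1 x y ∧ pos 1 x y < n ∧ pos (-1) x y = n - pos 1 x y := by
    by_cases hy : y = x
    · subst hy; simp
    · exact Or.inr ⟨hy, pos_pos.2 hy, pos_lt _ _ _, pos_neg 1 hy⟩
  have ha := h a
  have hb := h b
  have hc := h c
  omega

/-! ### Crossing -/

theorem Crossing.symm {s t : Finset (ZMod n)} (h : Crossing s t) : Crossing t s := by
  obtain ⟨a, ha, c, hc, b, hb, d, hd, h1, h2⟩ := h
  refine ⟨b, hb, d, hd, c, hc, a, ha, ?_, ?_⟩
  · exact (sbtw_trans_right h2 h1.cyclic_right).cyclic_right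
  · exact (sbtw_trans_right h1 h2.cyclic_right).cyclic_right

/-- Four alternating elements witness a crossing, wherever the circle is cut and in whichever
direction it is read. -/
theorem crossing_of_pos_lt [NeZero n] {s t : Finset (ZMod n)} (e : ℤˣ) (x : ZMod n)
    {a b c d : ZMod n} (ha : a ∈ s) (ha' : a ∉ t) (hb : b ∈ t) (hb' : b ∉ s) (hc : c ∈ s)
    (hc' : c ∉ t) (hd : d ∈ t) (hd' : d ∉ s) (h1 : pos e x a < pos e x b)
    (h2 : pos e x b < pos e x c) (h3 : pos e x c < pos e x d) : Crossing s t := by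
  rcases Int.units_eq_one_or e with rfl | rfl
  · refine ⟨a, by simp [*], c, by simp [*], b, by simp [*], d, by simp [*], ?_, ?_⟩ <;>
      rw [sbtw_iff_pos x] <;> omega
  · refine ⟨a, by simp [*], c, by simp [*], d, by simp [*], b, by simp [*], ?_, ?_⟩ <;>
      rw [sbtw_iff_pos_neg x] <;> omega

/-- A crossing is witnessed by alternating elements in increasing positions, beginning in one of
the two sets. -/
theorem Crossing.exists_pos_lt [NeZero n] {s t : Finset (ZMod n)} (h : Crossing s t) (e : ℤˣ)
    (x : ZMod n) :
    (∃ a b c d, a ∈ s ∧ a ∉ t ∧ b ∈ t ∧ b ∉ s ∧ c ∈ s ∧ c ∉ t ∧ d ∈ t ∧ d ∉ s ∧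
      pos e x a < pos e x b ∧ pos e x b < pos e x c ∧ pos e x c < pos e x d) ∨
    ∃ a b c d, a ∈ t ∧ a ∉ s ∧ b ∈ s ∧ b ∉ t ∧ c ∈ t ∧ c ∉ s ∧ d ∈ s ∧ d ∉ t ∧
      pos e x a < pos e x b ∧ pos e x b < pos e x c ∧ pos e x c < pos e x d := by
  obtain ⟨a, ha, c, hc, b, hb, d, hd, h1, h2⟩ := h
  simp only [Finset.mem_sdiff] at ha hb hc hd
  obtain ⟨ha, ha'⟩ := ha
  obtain ⟨hb, hb'⟩ := hb
  obtain ⟨hc, hc'⟩ := hc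
  obtain ⟨hd, hd'⟩ := hd
  rcases Int.units_eq_one_or e with rfl | rfl
  · rw [sbtw_iff_pos x] at h1 h2
    have : (pos 1 x a < pos 1 x b ∧ pos 1 x b < pos 1 x c ∧ pos 1 x c < pos 1 x d) ∨
      (pos 1 x b < pos 1 x c ∧ pos 1 x c < pos 1 x d ∧ pos 1 x d < pos 1 x a) ∨
      (pos 1 x c < pos 1 x d ∧ pos 1 x d < pos 1 x a ∧ pos 1 x a < pos 1 x b) ∨
      (pos 1 x d < pos 1 x a ∧ pos 1 x a < pos 1 x b ∧ pos 1 x b < pos 1 x c) := by omega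
    rcases this with h | h | h | h
    · exact Or.inl ⟨a, b, c, d, by tauto⟩
    · exact Or.inr ⟨b, c, d, a, by tauto⟩
    · exact Or.inl ⟨c, d, a, b, by tauto⟩
    · exact Or.inr ⟨d, a, b, c, by tauto⟩
  · rw [sbtw_iff_pos_neg x] at h1 h2
    have :
      (pos (-1) x d < pos (-1) x c ∧ pos (-1) x c < pos (-1) x b ∧ pos (-1) x b < pos (-1) x a) ∨
      (pos (-1) x c < pos (-1) x b ∧ pos (-1) x b < pos (-1) x a ∧ pos (-1) x a < pos (-1) x d) ∨
      (pos (-1) x b < pos (-1) x a ∧ pos (-1) x a < pos (-1) x d ∧ pos (-1) x d < pos (-1) x c) ∨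
      (pos (-1) x a < pos (-1) x d ∧ pos (-1) x d < pos (-1) x c ∧
        pos (-1) x c < pos (-1) x b) := by
      omega
    rcases this with h | h | h | h
    · exact Or.inr ⟨d, c, b, a, by tauto⟩
    · exact Or.inl ⟨c, b, a, d, by tauto⟩
    · exact Or.inr ⟨b, a, d, c, by tauto⟩
    · exact Or.inl ⟨a, d, c, b, by tauto⟩

variable {F F' : Set (Finset (ZMod n))} {e : ℤˣ} {x : ZMod n}

theorem ne_of_pos_lt {a b : ZMod n} (h : pos e x a < pos e x b) : a ≠ b := by
  rintro rfl; omega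

theorem eq_triple_of_mem {t : Finset (ZMod n)} (ht : t.card = 3) {a b c : ZMod n} (ha : a ∈ t)
    (hb : b ∈ t) (hc : c ∈ t) (hab : a ≠ b) (hac : a ≠ c) (hbc : b ≠ c) : t = {a, b, c} := by
  symm
  apply Finset.eq_of_subset_of_card_le
  · intro y hy
    simp only [Finset.mem_insert, Finset.mem_singleton] at hy
    rcases hy with rfl | rfl | rfl <;> assumption
  · rw [ht, Finset.card_eq_three.2 ⟨a, b, c, hab, hac, hbc, rfl⟩]

theorem card_triple_eq_three {a b c : ZMod n} :
    ({a, b, c} : Finset (ZMod n)).card = 3 ↔ a ≠ b ∧ a ≠ c ∧ b ≠ c := by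
  constructor
  · intro h
    refine ⟨?_, ?_, ?_⟩ <;> rintro rfl
    · have := Finset.card_le_two (a := a) (b := c); simp at h; omega
    · have := Finset.card_le_two (a := a) (b := b)
      rw [Finset.insert_eq_of_mem (by simp)] at h
      have := Finset.card_le_two (a := b) (b := a); omega
    · have := Finset.card_le_two (a := a) (b := b); simp at h; omega
  · rintro ⟨h1, h2, h3⟩
    exact Finset.card_eq_three.2 ⟨a, b, c, h1, h2, h3, rfl⟩

theorem IsCluster.card_eq (hF : IsCluster F) {t : Finset (ZMod n)} (ht : t ∈ F) : t.card = 3 :=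
  hF.1.1 t ht

theorem not_crossing_self (s : Finset (ZMod n)) : ¬ Crossing s s := by
  rintro ⟨a, ha, -⟩
  simp at ha

/-- A triangle that crosses no member of a cluster belongs to it. -/
theorem IsCluster.mem_of_not_crossing (hF : IsCluster F) {t : Finset (ZMod n)} (ht : t.card = 3)
    (h : ∀ s ∈ F, ¬ Crossing s t) : t ∈ F := by
  refine hF.2 (y := insert t F) ⟨?_, ?_⟩ (Set.subset_insert _ _) (Set.mem_insert _ _)
  · rintro s (rfl | hs)
    exacts [ht, hF.card_eq hs]
  · rintro s (rfl | hs) r (rfl | hr)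
    · exact not_crossing_self _
    · exact fun hc => h r hr hc.symm
    · exact h s hs
    · exact hF.1.2 s hs r hr

theorem IsCluster.linkGraph_adj (hF : IsCluster F) {a b : ZMod n} :
    (linkGraph F x).Adj a b ↔ {x, a, b} ∈ F := by
  refine ⟨fun h => h.2.2.2, fun h => ?_⟩
  obtain ⟨h1, h2, h3⟩ := card_triple_eq_three.1 (hF.card_eq h)
  exact ⟨h3, h1.symm, h2.symm, h⟩

/-- A triangle `{x, a, b}` can be seen in the link of `x` and in the link of `a`. -/
theorem linkGraph_adj_swap {a b : ZMod n} (h : (linkGraph F x).Adj a b) :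
    (linkGraph F a).Adj x b :=
  ⟨h.2.2.1.symm, h.2.1.symm, h.1.symm, by rw [Finset.insert_comm]; exact h.2.2.2⟩

variable [NeZero n]

/-! ### The link of a point is a noncrossing graph -/

theorem crossing_of_edges {p q a b : ZMod n} (hp : p ≠ x) (ha : a ≠ x)
    (h1 : pos e x p < pos e x a) (h2 : pos e x a < pos e x q) (h3 : pos e x q < pos e x b) :
    Crossing {x, p, q} {x, a, b} := by
  have hqx : q ≠ x := by rintro rfl; simp at h2
  have hbx : b ≠ x := by rintro rfl; simp at h3
  have hap := ne_of_pos_lt h1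
  have haq := ne_of_pos_lt h2
  have hbq := ne_of_pos_lt h3
  have hpb := ne_of_pos_lt (h1.trans (h2.trans h3))
  refine crossing_of_pos_lt e x (a := p) (b := a) (c := q) (d := b)
    ?_ ?_ ?_ ?_ ?_ ?_ ?_ ?_ h1 h2 h3 <;> simp <;> tauto

/-- Besides `p`, the witness of the crossing in the first triangle is `x` itself, which precedes all
other elements. -/
theorem crossing_of_straddle {p q u v : ZMod n} {t : Finset (ZMod n)}
    (hpx : p ≠ x) (hqx : q ≠ x) (hx : x ∉ t) (hu : u ∈ t) (hv : v ∈ t)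
    (hp : p ∉ t) (huq : u ≠ q) (hvq : v ≠ q)
    (h1 : pos e x u < pos e x p) (h2 : pos e x p < pos e x v) : Crossing {x, p, q} t := by
  have hux : u ≠ x := by rintro rfl; exact hx hu
  have hvx : v ≠ x := by rintro rfl; exact hx hv
  have h0 : pos e x x < pos e x u := by rw [pos_self]; exact pos_pos.2 hux
  have := ne_of_pos_lt h1
  have := ne_of_pos_lt h2
  refine crossing_of_pos_lt e x (a := x) (b := u) (c := p) (d := v)
    (by simp) hx hu ?_ (by simp) hp hv ?_ h0 h1 h2 <;> simp <;> tauto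

/-- The two ways in which a triangle can cross `{x, p, q}`, according to whether it contains
`x`. -/
theorem crossing_cases {p q : ZMod n} {t : Finset (ZMod n)} (h3 : t.card = 3)
    (hx : p ≠ x) (h : pos e x p < pos e x q) (hcr : Crossing t {x, p, q}) :
    (∃ a b, t = {x, a, b} ∧ a ≠ x ∧ b ≠ x ∧
      (pos e x a < pos e x p ∧ pos e x p < pos e x b ∧ pos e x b < pos e x q ∨
      pos e x p < pos e x a ∧ pos e x a < pos e x q ∧ pos e x q < pos e x b)) ∨
    x ∉ t ∧ ∃ u ∈ t, ∃ v ∈ t,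
      (p ∉ t ∧ u ≠ q ∧ v ≠ q ∧ pos e x u < pos e x p ∧ pos e x p < pos e x v ∨
      q ∉ t ∧ u ≠ p ∧ v ≠ p ∧ pos e x u < pos e x q ∧ pos e x q < pos e x v) := by
  have hp0 := pos_pos (e := e).2 hx
  have hsub (y : ZMod n) : y ∈ ({x, p, q} : Finset (ZMod n)) ↔ y = x ∨ y = p ∨ y = q := by simp
  by_cases hxt : x ∈ t
  · left
    have key {a c : ZMod n} (ha : a ∈ t) (hc : c ∈ t) (hax : a ≠ x) (hcx : c ≠ x) (hac : a ≠ c) :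
        t = {x, a, c} := eq_triple_of_mem h3 hxt ha hc hax.symm hcx.symm hac
    rcases hcr.exists_pos_lt e x with ⟨a, b, c, d, ha, ha', hb, hb', hc, hc', hd, hd', h4, h5, h6⟩ |
      ⟨a, b, c, d, ha, ha', hb, hb', hc, hc', hd, hd', h4, h5, h6⟩
    · rw [hsub] at ha' hc' hb hd
      refine ⟨a, c, key ha hc (by tauto) (by tauto) (ne_of_pos_lt (h4.trans h5)), by tauto,
        by tauto, Or.inl ?_⟩
      rcases hb with rfl | rfl | rfl <;> rcases hd with rfl | rfl | rfl <;> first | tauto | omega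
    · rw [hsub] at ha hc hb' hd'
      refine ⟨b, d, key hb hd (by tauto) (by tauto) (ne_of_pos_lt (h5.trans h6)), by tauto,
        by tauto, Or.inr ?_⟩
      rcases ha with rfl | rfl | rfl <;> rcases hc with rfl | rfl | rfl <;> first | tauto | omega
  · right
    refine ⟨hxt, ?_⟩
    rcases hcr.exists_pos_lt e x with ⟨a, b, c, d, ha, ha', hb, hb', hc, hc', hd, hd', h4, h5, h6⟩ |
      ⟨a, b, c, d, ha, ha', hb, hb', hc, hc', hd, hd', h4, h5, h6⟩
    · rw [hsub] at ha' hc' hb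
      refine ⟨a, ha, c, hc, ?_⟩
      rcases hb with rfl | rfl | rfl
      · simp at h4
      · left; tauto
      · right; tauto
    · rw [hsub] at hb' hd' hc
      refine ⟨b, hb, d, hd, ?_⟩
      rcases hc with rfl | rfl | rfl
      · simp at h5
      · left; tauto
      · right; tauto

theorem IsCluster.adj_noncrossing (hF : IsCluster F) {p q a b : ZMod n}
    (hpq : (linkGraph F x).Adj p q) (hab : (linkGraph F x).Adj a b)
    (h1 : pos e x p < pos e x a) (h2 : pos e x a < pos e x q) (h3 : pos e x q < pos e x b) :
    False :=
  hF.1.2 _ hpq.2.2.2 _ hab.2.2.2 (crossing_of_edges hpq.2.1 hab.2.1 h1 h2 h3)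

/-- A triangle avoiding `x` has no two vertices on different sides of the end `p` of an edge
`{p, q}` of the link, apart from the obvious exceptions. -/
theorem IsCluster.not_straddle (hF : IsCluster F) {p q u v : ZMod n} {t : Finset (ZMod n)}
    (hpq : (linkGraph F x).Adj p q) (ht : t ∈ F) (hx : x ∉ t) (hu : u ∈ t) (hv : v ∈ t)
    (hp : p ∉ t) (huq : u ≠ q) (hvq : v ≠ q)
    (h1 : pos e x u < pos e x p) (h2 : pos e x p < pos e x v) : False :=
  hF.1.2 _ hpq.2.2.2 _ ht
    (crossing_of_straddle hpq.2.1 hpq.2.2.1 hx hu hv hp huq hvq h1 h2)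

/-- A missing edge of the link is crossed by another edge of the link or by a triangle
avoiding `x`. -/
theorem IsCluster.exists_of_not_adj (hF : IsCluster F) {p q : ZMod n}
    (hx : p ≠ x) (h : pos e x p < pos e x q) (hpq : ¬ (linkGraph F x).Adj p q) :
    (∃ a b, (linkGraph F x).Adj a b ∧
      (pos e x a < pos e x p ∧ pos e x p < pos e x b ∧ pos e x b < pos e x q ∨
      pos e x p < pos e x a ∧ pos e x a < pos e x q ∧ pos e x q < pos e x b)) ∨
    ∃ t ∈ F, x ∉ t ∧ ∃ u ∈ t, ∃ v ∈ t,
      (p ∉ t ∧ u ≠ q ∧ v ≠ q ∧ pos e x u < pos e x p ∧ pos e x p < pos e x v ∨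
      q ∉ t ∧ u ≠ p ∧ v ≠ p ∧ pos e x u < pos e x q ∧ pos e x q < pos e x v) := by
  rw [hF.linkGraph_adj] at hpq
  have hqx : q ≠ x := by rintro rfl; simp at h
  have hc : ({x, p, q} : Finset (ZMod n)).card = 3 :=
    card_triple_eq_three.2 ⟨hx.symm, hqx.symm, ne_of_pos_lt h⟩
  have : ∃ t ∈ F, Crossing t {x, p, q} := by
    by_contra! hcon
    exact hpq (hF.mem_of_not_crossing hc hcon)
  obtain ⟨t, ht, hcr⟩ := this
  rcases crossing_cases (hF.card_eq ht) hx h hcr with ⟨a, b, rfl, ha, hb, hab⟩ | ⟨hxt, hr⟩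
  · exact Or.inl ⟨a, b, hF.linkGraph_adj.2 ht, hab⟩
  · exact Or.inr ⟨t, ht, hxt, hr⟩

/-- If the edge `{p, q}` lies below the edge `{u, w}`, then `u` is adjacent to `p` or to `q`,
unless some edge of the link prevents it. -/
theorem IsCluster.adj_of_nested (hF : IsCluster F) {u p q w : ZMod n}
    (huw : (linkGraph F x).Adj u w) (hpq : (linkGraph F x).Adj p q)
    (h1 : pos e x u < pos e x p) (h2 : pos e x p < pos e x q) (h3 : pos e x q < pos e x w)
    (hp : ∀ a b, (linkGraph F x).Adj a b → pos e x u < pos e x a → pos e x a < pos e x p →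
      pos e x p < pos e x b → False)
    (hq : ∀ a b, (linkGraph F x).Adj a b → pos e x u < pos e x a → pos e x a < pos e x q →
      pos e x q < pos e x b → False) :
    (linkGraph F x).Adj u p ∨ (linkGraph F x).Adj u q := by
  by_contra! hcon
  obtain ⟨t, ht, hxt, a, hat, hqt, hpt, hau, hap⟩ : ∃ t ∈ F, x ∉ t ∧ ∃ a ∈ t, q ∈ t ∧ p ∉ t ∧
      a ≠ u ∧ pos e x a < pos e x p := by
    rcases hF.exists_of_not_adj huw.2.1 h1 hcon.1 with
        ⟨a, b, hab, h | h⟩ | ⟨t, ht, hxt, a, ha, b, hb, h⟩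
    · exact (hF.adj_noncrossing hab huw h.1 h.2.1 (by omega)).elim
    · exact (hp a b hab h.1 h.2.1 h.2.2).elim
    · refine ⟨t, ht, hxt, a, ha, ?_⟩
      rcases h with ⟨h4, h5, h6, h7, h8⟩ | ⟨h4, h5, h6, h7, h8⟩
      · exfalso
        have hbw : b = w := by
          by_contra hbw
          exact hF.not_straddle huw ht hxt ha hb h4
            (ne_of_pos_lt (by omega : _ < pos e x w)) hbw h7 h8
        subst hbw
        by_cases hpt : p ∈ t
        · exact hF.not_straddle huw ht hxt ha hpt h4
            (ne_of_pos_lt (e := e) (x := x) (by omega : _ < pos e x b))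
            (ne_of_pos_lt (h2.trans h3)) h7 h1
        · exact hF.not_straddle hpq ht hxt ha hb hpt (ne_of_pos_lt (e := e) (x := x) (by omega))
            (ne_of_pos_lt h3).symm (h7.trans h1) (h2.trans h3)
      · have hbq : b = q := by
          by_contra hbq
          exact hF.not_straddle hpq ht hxt ha hb h4
            (ne_of_pos_lt (e := e) (x := x) (by omega)) hbq h7 h8
        subst hbq
        exact ⟨hb, h4, h5, h7⟩
  obtain ⟨t', ht', hxt', b, hbt', hpt', hqt', hbu, hqb⟩ : ∃ t ∈ F, x ∉ t ∧ ∃ b ∈ t, p ∈ t ∧ q ∉ t ∧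
      b ≠ u ∧ pos e x q < pos e x b := by
    rcases hF.exists_of_not_adj huw.2.1 (h1.trans h2) hcon.2 with
      ⟨a, b, hab, h | h⟩ | ⟨t, ht, hxt, a, ha, b, hb, h⟩
    · exact (hF.adj_noncrossing hab huw h.1 h.2.1 (by omega)).elim
    · exact (hq a b hab h.1 h.2.1 h.2.2).elim
    · refine ⟨t, ht, hxt, b, hb, ?_⟩
      rcases h with ⟨h4, h5, h6, h7, h8⟩ | ⟨h4, h5, h6, h7, h8⟩
      · exfalso
        have hbw : b = w := by
          by_contra hbw
          exact hF.not_straddle huw ht hxt ha hb h4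
            (ne_of_pos_lt (by omega : _ < pos e x w)) hbw h7 h8
        subst hbw
        by_cases hpt : p ∈ t
        · exact hF.not_straddle huw ht hxt ha hpt h4
            (ne_of_pos_lt (e := e) (x := x) (by omega : _ < pos e x b))
            (ne_of_pos_lt (h2.trans h3)) h7 h1
        · exact hF.not_straddle hpq ht hxt ha hb hpt (ne_of_pos_lt (e := e) (x := x) (by omega))
            (ne_of_pos_lt h3).symm (h7.trans h1) (h2.trans h3)
      · have hap : a = p := by
          by_contra hap
          exact hF.not_straddle hpq.symm ht hxt ha hb h4 hap
            (ne_of_pos_lt (by omega : pos e x p < pos e x b)).symm h7 h8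
        subst hap
        exact ⟨ha, h4, h6, h8⟩
  have hat' : a ∉ t' := fun h => hF.not_straddle hpq.symm ht' hxt' h hbt' hqt'
    (ne_of_pos_lt hap) (ne_of_pos_lt (by omega : pos e x p < pos e x b)).symm (by omega) hqb
  have hbt : b ∉ t := fun h => hF.not_straddle hpq ht hxt hat h hpt
    (ne_of_pos_lt (e := e) (x := x) (by omega)) (ne_of_pos_lt hqb).symm hap (by omega)
  exact hF.1.2 _ ht _ ht' (crossing_of_pos_lt e x hat hat' hpt' hpt hqt hqt' hbt' hbt hap h2 hqb)

/-- The version of `IsCluster.adj_of_nested` for an edge `{p, w}` with the same end `w`. -/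
theorem IsCluster.adj_of_nested_of_adj (hF : IsCluster F) {u p q w : ZMod n}
    (huw : (linkGraph F x).Adj u w) (hpq : (linkGraph F x).Adj p q) (hpw : (linkGraph F x).Adj p w)
    (h1 : pos e x u < pos e x p) (h2 : pos e x p < pos e x q) (h3 : pos e x q < pos e x w)
    (hp : ∀ a b, (linkGraph F x).Adj a b → pos e x u < pos e x a → pos e x a < pos e x p →
      pos e x p < pos e x b → False) :
    (linkGraph F x).Adj u p := by
  by_contra hcon
  rcases hF.exists_of_not_adj huw.2.1 h1 hcon with
      ⟨a, b, hab, h | h⟩ | ⟨t, ht, hxt, a, ha, b, hb, h⟩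
  · exact hF.adj_noncrossing hab huw h.1 h.2.1 (by omega)
  · exact hp a b hab h.1 h.2.1 h.2.2
  · rcases h with ⟨h4, h5, h6, h7, h8⟩ | ⟨h4, h5, h6, h7, h8⟩
    · have hbw : b = w := by
        by_contra hbw
        exact hF.not_straddle huw ht hxt ha hb h4
          (ne_of_pos_lt (by omega : _ < pos e x w)) hbw h7 h8
      subst hbw
      by_cases hpt : p ∈ t
      · exact hF.not_straddle huw ht hxt ha hpt h4
          (ne_of_pos_lt (e := e) (x := x) (by omega : _ < pos e x b))
          (ne_of_pos_lt (h2.trans h3)) h7 h1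
      · exact hF.not_straddle hpq ht hxt ha hb hpt (ne_of_pos_lt (e := e) (x := x) (by omega))
          (ne_of_pos_lt h3).symm (h7.trans h1) (h2.trans h3)
    · have hbq : b = q := by
        by_contra hbq
        exact hF.not_straddle hpq ht hxt ha hb h4
          (ne_of_pos_lt (e := e) (x := x) (by omega)) hbq h7 h8
      subst hbq
      exact hF.not_straddle hpw ht hxt ha hb h4 (ne_of_pos_lt (by omega : _ < pos e x w))
        (ne_of_pos_lt h3) h7 h8

/-! ### Neighbours of a point in the link -/

theorem exists_minimizer {α : Type*} {S : α → Prop} (f : α → ℕ) (h : ∃ a, S a) :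
    ∃ a, S a ∧ ∀ b, S b → f a ≤ f b := by
  classical
  have h' : ∃ k, ∃ a, S a ∧ f a = k := by
    obtain ⟨a, ha⟩ := h
    exact ⟨f a, a, ha, rfl⟩
  obtain ⟨a, ha, hk⟩ := Nat.find_spec h'
  exact ⟨a, ha, fun b hb => hk ▸ Nat.find_min' h' ⟨b, hb, rfl⟩⟩

theorem exists_mem_ne_ne {t : Finset (ZMod n)} (ht : t.card = 3) (u v : ZMod n) :
    ∃ c ∈ t, c ≠ u ∧ c ≠ v := by
  by_contra! hcon
  have : t ⊆ {u, v} := fun y hy => by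
    by_cases hyu : y = u
    · simp [hyu]
    · simp [hcon y hy hyu]
  have h1 := Finset.card_le_card this
  have h2 := Finset.card_le_two (a := u) (b := v)
  omega

theorem exists_pos_max (e : ℤˣ) (x : ZMod n) {S : ZMod n → Prop} (h : ∃ a, S a) :
    ∃ a, S a ∧ ∀ b, S b → pos e x b ≤ pos e x a := by
  obtain ⟨a, ha, hm⟩ := exists_minimizer (fun a => n - pos e x a) h
  refine ⟨a, ha, fun b hb => ?_⟩
  have := hm b hb
  have := pos_lt e x b
  omega

theorem pos_neg_lt_iff {a b : ZMod n} (ha : a ≠ x) (hb : b ≠ x) :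
    pos (-e) x a < pos (-e) x b ↔ pos e x b < pos e x a := by
  rw [pos_neg e ha, pos_neg e hb]
  have := pos_lt e x a
  have := pos_lt e x b
  omega

/-- The version of `IsCluster.adj_of_nested` that only excludes edges crossing `{u, p}`. -/
theorem IsCluster.exists_adj_of_nested (hF : IsCluster F) {u p q w : ZMod n}
    (huw : (linkGraph F x).Adj u w) (hpq : (linkGraph F x).Adj p q)
    (h1 : pos e x u < pos e x p) (h2 : pos e x p < pos e x q) (h3 : pos e x q < pos e x w)
    (hp : ∀ a b, (linkGraph F x).Adj a b → pos e x u < pos e x a → pos e x a < pos e x p →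
      pos e x p < pos e x b → False) :
    (linkGraph F x).Adj u p ∨
      ∃ r, pos e x p < pos e x r ∧ pos e x r < pos e x w ∧ (linkGraph F x).Adj u r := by
  by_cases hpw : (linkGraph F x).Adj p w
  · exact Or.inl (hF.adj_of_nested_of_adj huw hpq hpw h1 h2 h3 hp)
  obtain ⟨r, ⟨hr1, hr2, hr3⟩, hmax⟩ := exists_pos_max e x
    (S := fun r => pos e x p < pos e x r ∧ pos e x r < pos e x w ∧ (linkGraph F x).Adj p r)
    ⟨q, h2, h3, hpq⟩
  refine (hF.adj_of_nested huw hr3 h1 hr1 hr2 hp ?_).imp id fun h => ⟨r, hr1, hr2, h⟩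
  intro a b hab h4 h5 h6
  rcases lt_trichotomy (pos e x a) (pos e x p) with h7 | h7 | h7
  · exact hp a b hab h4 h7 (by omega)
  · obtain rfl := pos_inj.1 h7
    rcases lt_trichotomy (pos e x b) (pos e x w) with h8 | h8 | h8
    · have := hmax b ⟨by omega, h8, hab⟩
      omega
    · obtain rfl := pos_inj.1 h8
      exact hpw hab
    · exact hF.adj_noncrossing huw hab h4 (by omega) h8
  · exact hF.adj_noncrossing hr3 hab h7 h5 h6

/-- Connectedness of the link below an edge `{u, w}`: if there is an edge strictly between `u` and
`w`, then `u` has a neighbour there. More generally only the part beyond a neighbour `q` of `u`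
may be considered, if no edge leads from `q` into it. -/
theorem IsCluster.exists_adj_below (hF : IsCluster F) {u q w a b : ZMod n}
    (huw : (linkGraph F x).Adj u w)
    (hq : q = u ∨ (linkGraph F x).Adj u q ∧ pos e x u < pos e x q ∧
      ∀ d, (linkGraph F x).Adj q d → pos e x q < pos e x d → False)
    (hab : (linkGraph F x).Adj a b) (h1 : pos e x q < pos e x a) (h2 : pos e x a < pos e x b)
    (h3 : pos e x b < pos e x w) :
    ∃ r, pos e x q < pos e x r ∧ pos e x r < pos e x w ∧ (linkGraph F x).Adj u r := by
  have huq : pos e x u ≤ pos e x q := by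
    rcases hq with rfl | ⟨-, h, -⟩
    exacts [le_rfl, h.le]
  obtain ⟨p, ⟨hqp, z, hpz, hpz', hzw⟩, hmin⟩ := exists_minimizer (pos e x)
    (S := fun p => pos e x q < pos e x p ∧ ∃ z, (linkGraph F x).Adj p z ∧ pos e x p < pos e x z ∧
      pos e x z < pos e x w) ⟨a, h1, b, hab, h2, h3⟩
  -- the edges crossing `{u, p}` all end in `w`
  have key : ∀ c d, (linkGraph F x).Adj c d → pos e x u < pos e x c → pos e x c < pos e x p →
      pos e x p < pos e x d → pos e x q < pos e x c ∧ d = w := by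
    intro c d hcd h4 h5 h6
    have hqc : pos e x q < pos e x c := by
      rcases hq with rfl | ⟨huq, h7, h8⟩
      · exact h4
      · rcases lt_trichotomy (pos e x c) (pos e x q) with h9 | h9 | h9
        · exact (hF.adj_noncrossing huq hcd h4 h9 (by omega)).elim
        · obtain rfl := pos_inj.1 h9
          exact (h8 d hcd (by omega)).elim
        · exact h9
    refine ⟨hqc, ?_⟩
    rcases lt_trichotomy (pos e x d) (pos e x w) with h7 | h7 | h7
    · have := hmin c ⟨hqc, d, hcd, by omega, h7⟩
      omega
    · exact pos_inj.1 h7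
    · exact (hF.adj_noncrossing huw hcd h4 (by omega) h7).elim
  obtain ⟨c, ⟨hc, hcp, hcw⟩, hmax⟩ := exists_pos_max e x
    (S := fun c => (c = u ∨ pos e x q < pos e x c) ∧ pos e x c < pos e x p ∧
      (linkGraph F x).Adj c w) ⟨u, Or.inl rfl, by omega, huw⟩
  have huc : pos e x u ≤ pos e x c := by
    rcases hc with rfl | hc
    exacts [le_rfl, by omega]
  have : ∃ r, pos e x q < pos e x r ∧ pos e x c < pos e x r ∧ pos e x r < pos e x w ∧
      (linkGraph F x).Adj c r := by
    rcases hF.exists_adj_of_nested hcw hpz hcp hpz' hzw (by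
      intro a' b' h4 h5 h6 h7
      obtain ⟨h8, rfl⟩ := key a' b' h4 (by omega) h6 h7
      have := hmax a' ⟨Or.inr h8, h6, h4⟩
      omega) with h | ⟨r, h4, h5, h6⟩
    · exact ⟨p, hqp, hcp, by omega, h⟩
    · exact ⟨r, by omega, by omega, h5, h6⟩
  obtain ⟨r, hr1, hr2, hr3, hr4⟩ := this
  rcases hc with rfl | hc
  · exact ⟨r, hr1, hr3, hr4⟩
  · have := hmin c ⟨hc, r, hr4, hr2, hr3⟩
    omega

/-- If `q₁` is the first neighbour of `p`, no triangle avoiding `x` straddles `q₁`: such a triangle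
would contain `p`, and its other two vertices would be an edge in the link of `p` below the edge
`{x, q₁}`. By connectedness that link then has an edge at `x` before `q₁`. -/
theorem IsCluster.not_straddle_first (hF : IsCluster F) {p q₁ u v : ZMod n}
    {t : Finset (ZMod n)} (h₁ : (linkGraph F x).Adj p q₁) (hlt : pos e x q₁ < pos e x p)
    (hmin : ∀ b, (linkGraph F x).Adj p b → pos e x q₁ ≤ pos e x b)
    (ht : t ∈ F) (hxt : x ∉ t) (hut : u ∈ t) (hvt : v ∈ t) (hq : q₁ ∉ t)
    (hu : pos e x u < pos e x q₁) (hv : pos e x q₁ < pos e x v) : False := by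
  have hvp : v = p := by
    by_contra hvp
    exact hF.not_straddle h₁.symm ht hxt hut hvt hq (ne_of_pos_lt (hu.trans hlt)) hvp hu hv
  subst hvp
  obtain ⟨c, hct, hcu, hcv⟩ : ∃ c ∈ t, c ≠ u ∧ c ≠ v :=
    exists_mem_ne_ne (hF.card_eq ht) _ _
  have hcq : pos e x c < pos e x q₁ := by
    rcases lt_trichotomy (pos e x c) (pos e x q₁) with h | h | h
    · exact h
    · obtain rfl := pos_inj.1 h
      exact (hq hct).elim
    · exact (hF.not_straddle h₁.symm ht hxt hut hct hq (ne_of_pos_lt (hu.trans hlt)) hcv hu h).elim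
  -- the third vertex lies on the same side, and the link of `p` has an edge between `x` and `q₁`
  have huv : u ≠ v := ne_of_pos_lt (hu.trans hlt)
  have huc : (linkGraph F v).Adj u c := by
    rw [hF.linkGraph_adj, ← eq_triple_of_mem (hF.card_eq ht) hvt hut hct huv.symm hcv.symm hcu.symm]
    exact ht
  have hxq : (linkGraph F v).Adj x q₁ := linkGraph_adj_swap h₁
  have key (a b : ZMod n) (ha : a ∈ t) (hab : (linkGraph F v).Adj a b)
      (h1 : pos e x a < pos e x b) (h2 : pos e x b < pos e x q₁) : False := by
    have hax : 0 < pos e x a := pos_pos.2 (by rintro rfl; exact hxt ha)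
    have r1 := pos_rebase e x v x
    have r2 := pos_rebase e x v q₁
    have r3 := pos_rebase e x v a
    have r4 := pos_rebase e x v b
    rw [if_neg (by omega)] at r2 r3 r4
    rw [pos_self, if_neg (by omega)] at r1
    have := pos_lt e x v
    obtain ⟨r, h3, h4, h5⟩ := hF.exists_adj_below (e := e) hxq (Or.inl rfl) hab (by omega)
      (by omega) (by omega)
    have h6 := hmin r (linkGraph_adj_swap h5)
    have r5 := pos_rebase e x v r
    have := pos_lt e x r
    split_ifs at r5 <;> omega
  rcases lt_trichotomy (pos e x u) (pos e x c) with h | h | h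
  · exact key u c hut huc h hcq
  · exact hcu (pos_inj.1 h).symm
  · exact key c u hct huc.symm h hu

/-- The first and the last neighbour of `p` are adjacent if `p` lies between them. -/
theorem IsCluster.adj_first_last (hF : IsCluster F) {p q₁ q₂ : ZMod n}
    (h₁ : (linkGraph F x).Adj p q₁) (h₂ : (linkGraph F x).Adj p q₂)
    (hlt₁ : pos e x q₁ < pos e x p) (hlt₂ : pos e x p < pos e x q₂)
    (hmin : ∀ b, (linkGraph F x).Adj p b → pos e x q₁ ≤ pos e x b)
    (hmax : ∀ b, (linkGraph F x).Adj p b → pos e x b ≤ pos e x q₂) :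
    (linkGraph F x).Adj q₁ q₂ := by
  by_contra hcon
  rcases hF.exists_of_not_adj h₁.2.2.1 (hlt₁.trans hlt₂) hcon with
    ⟨a, b, hab, ⟨h3, h4, h5⟩ | ⟨h3, h4, h5⟩⟩ | ⟨t, ht, hxt, u, hut, v, hvt, h⟩
  · rcases lt_trichotomy (pos e x b) (pos e x p) with h | h | h
    · exact hF.adj_noncrossing hab h₁.symm h3 h4 h
    · obtain rfl := pos_inj.1 h
      have := hmin a hab.symm
      omega
    · exact hF.adj_noncrossing hab h₂ (by omega) h h5
  · rcases lt_trichotomy (pos e x a) (pos e x p) with h | h | h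
    · exact hF.adj_noncrossing h₁.symm hab h3 h (by omega)
    · obtain rfl := pos_inj.1 h
      have := hmax b hab
      omega
    · exact hF.adj_noncrossing h₂ hab h h4 h5
  · rcases h with ⟨h3, -, -, h4, h5⟩ | ⟨h3, -, -, h4, h5⟩
    · exact hF.not_straddle_first h₁ hlt₁ hmin ht hxt hut hvt h3 h4 h5
    · have hux : u ≠ x := by rintro rfl; exact hxt hut
      have hvx : v ≠ x := by rintro rfl; exact hxt hvt
      refine hF.not_straddle_first (e := -e) h₂ ((pos_neg_lt_iff h₂.2.2.1 h₂.2.1).2 hlt₂)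
        (fun b hb => ?_) ht hxt hvt hut h3 ((pos_neg_lt_iff hvx h₂.2.2.1).2 h5)
        ((pos_neg_lt_iff h₂.2.2.1 hux).2 h4)
      have := hmax b hb
      by_contra! h6
      have := (pos_neg_lt_iff hb.2.2.1 h₂.2.2.1).1 h6
      omega

/-- The nearest neighbours of `p` on its two sides form a triangle with `p`. -/
theorem IsCluster.adj_pred_succ (hF : IsCluster F) {p q₁ q₂ : ZMod n}
    (h₁ : (linkGraph F x).Adj p q₁) (h₂ : (linkGraph F x).Adj p q₂)
    (hlt₁ : pos e x q₁ < pos e x p) (hlt₂ : pos e x p < pos e x q₂)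
    (hnone : ∀ b, (linkGraph F x).Adj p b → pos e x q₁ < pos e x b → pos e x b < pos e x q₂ →
      False) :
    {p, q₁, q₂} ∈ F := by
  have r0 := pos_rebase e x p x
  have r1 := pos_rebase e x p q₁
  have r2 := pos_rebase e x p q₂
  rw [if_neg (by omega)] at r1
  rw [if_pos (by omega)] at r2
  have hp := pos_pos (e := e).2 h₁.2.1
  have hp1 := pos_pos (e := e).2 h₁.2.2.1
  have := pos_lt e x p
  have := pos_lt e x q₂
  rw [pos_self, if_neg (by omega)] at r0
  rw [← hF.linkGraph_adj]
  refine (hF.adj_first_last (e := e) (x := p) (p := x) (linkGraph_adj_swap h₂)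
    (linkGraph_adj_swap h₁) (by omega) (by omega) ?_ ?_).symm
  · intro b hb
    have hb' := linkGraph_adj_swap hb
    have r3 := pos_rebase e x p b
    have := pos_lt e x b
    have : pos e x b ≠ pos e x p := by
      intro h; exact hb'.1 (pos_inj.1 h).symm
    by_contra h3
    refine hnone b hb' ?_ ?_ <;> split_ifs at r3 <;> omega
  · intro b hb
    have hb' := linkGraph_adj_swap hb
    have r3 := pos_rebase e x p b
    have := pos_lt e x b
    have : pos e x b ≠ pos e x p := by
      intro h; exact hb'.1 (pos_inj.1 h).symm
    by_contra h3
    refine hnone b hb' ?_ ?_ <;> split_ifs at r3 <;> omega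

/-- If consecutive neighbours `q₁, q₂` of `p` on the same side are not adjacent, the obstruction is
a triangle at `p`. -/
theorem IsCluster.exists_of_not_adj_consecutive (hF : IsCluster F) {p q₁ q₂ : ZMod n}
    (h₁ : (linkGraph F x).Adj p q₁) (h₂ : (linkGraph F x).Adj p q₂)
    (hlt₁ : pos e x p < pos e x q₁) (hlt₂ : pos e x q₁ < pos e x q₂)
    (hnone : ∀ b, (linkGraph F x).Adj p b → pos e x q₁ < pos e x b → pos e x b < pos e x q₂ →
      False) (hcon : ¬ (linkGraph F x).Adj q₁ q₂) :
    ∃ t ∈ F, x ∉ t ∧ p ∈ t ∧ q₁ ∉ t ∧ ∃ v ∈ t, pos e x q₁ < pos e x v ∧ v ≠ q₂ := by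
  rcases hF.exists_of_not_adj h₁.2.2.1 hlt₂ hcon with
    ⟨a, b, hab, ⟨h3, h4, h5⟩ | ⟨h3, h4, h5⟩⟩ | ⟨t, ht, hxt, u, hut, v, hvt, h⟩
  · rcases lt_trichotomy (pos e x a) (pos e x p) with h | h | h
    · exact (hF.adj_noncrossing hab h₂ h (by omega) (by omega)).elim
    · obtain rfl := pos_inj.1 h
      exact (hnone b hab h4 h5).elim
    · exact (hF.adj_noncrossing h₁ hab h h3 h4).elim
  · exact (hF.adj_noncrossing h₂ hab (by omega) h4 h5).elim
  · refine ⟨t, ht, hxt, ?_⟩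
    rcases h with ⟨h3, h4, h5, h6, h7⟩ | ⟨h3, h4, h5, h6, h7⟩
    · have hup : u = p := by
        by_contra hup
        exact hF.not_straddle h₁.symm ht hxt hut hvt h3 hup
          (ne_of_pos_lt (hlt₁.trans h7)).symm h6 h7
      subst hup
      exact ⟨hut, h3, v, hvt, h7, h5⟩
    · have hup : u = p := by
        by_contra hup
        exact hF.not_straddle h₂.symm ht hxt hut hvt h3 hup
          (ne_of_pos_lt (hlt₁.trans (hlt₂.trans h7))).symm h6 h7
      subst hup
      refine ⟨hut, fun hq => ?_, v, hvt, hlt₂.trans h7, (ne_of_pos_lt h7).symm⟩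
      exact hF.not_straddle h₂.symm ht hxt hq hvt h3 (ne_of_pos_lt hlt₁).symm
          (ne_of_pos_lt (hlt₁.trans (hlt₂.trans h7))).symm hlt₂ h7

/-- Consecutive neighbours `q₁, q₂` of `p` on the same side form a triangle with `p` or
with `x`. -/
theorem IsCluster.adj_or_mem_of_consecutive (hF : IsCluster F) {p q₁ q₂ : ZMod n}
    (h₁ : (linkGraph F x).Adj p q₁) (h₂ : (linkGraph F x).Adj p q₂)
    (hlt₁ : pos e x p < pos e x q₁) (hlt₂ : pos e x q₁ < pos e x q₂)
    (hnone : ∀ b, (linkGraph F x).Adj p b → pos e x q₁ < pos e x b → pos e x b < pos e x q₂ →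
      False) :
    (linkGraph F x).Adj q₁ q₂ ∨ {p, q₁, q₂} ∈ F := by
  by_contra! hcon
  obtain ⟨hcon, hcon'⟩ := hcon
  rw [← hF.linkGraph_adj] at hcon'
  obtain ⟨t, ht, hxt, hpt, hq₁t, v, hvt, hv, -⟩ :=
    hF.exists_of_not_adj_consecutive h₁ h₂ hlt₁ hlt₂ hnone hcon
  have hp := pos_pos (e := e).2 h₁.2.1
  have := pos_lt e x q₂
  have rb (y : ZMod n) := pos_rebase e x p y
  -- the same statement in the link of `p`, read in the other direction
  obtain ⟨t', ht', hpt', hxt', hq₂t', v', hvt', hv', hvq⟩ :=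
    hF.exists_of_not_adj_consecutive (e := -e) (x := p) (p := x) (q₁ := q₂) (q₂ := q₁)
      (linkGraph_adj_swap h₂) (linkGraph_adj_swap h₁)
      ((pos_neg_lt_iff (e := e) h₁.2.1.symm h₂.1.symm).2 (by
        have r0 := rb x
        have r2 := rb q₂
        rw [if_pos (by omega)] at r2
        rw [pos_self, if_neg (by omega)] at r0
        omega))
      ((pos_neg_lt_iff (e := e) h₂.1.symm h₁.1.symm).2 (by
        have r1 := rb q₁
        have r2 := rb q₂
        rw [if_pos (by omega)] at r1 r2
        omega))
      (fun b hb h3 h4 => by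
        rw [pos_neg_lt_iff h₂.1.symm hb.2.2.1] at h3
        rw [pos_neg_lt_iff hb.2.2.1 h₁.1.symm] at h4
        refine hnone b (linkGraph_adj_swap hb) ?_ ?_ <;>
        · have r1 := rb q₁
          have r2 := rb q₂
          have r3 := rb b
          rw [if_pos (by omega)] at r1 r2
          have : pos e x b ≠ pos e x p := fun h => hb.2.2.1 (pos_inj.1 h)
          split_ifs at r3 <;> omega)
      (fun h => hcon' h.symm)
  have hv'p : v' ≠ p := by rintro rfl; exact hpt' hvt'
  rw [pos_neg_lt_iff h₂.1.symm hv'p] at hv'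
  have hv'x : v' ≠ x := by
    rintro rfl
    have r0 := rb v'
    have r2 := rb q₂
    rw [if_pos (by omega)] at r2
    rw [pos_self, if_neg (by omega)] at r0
    omega
  have hv1 : pos e x p < pos e x v' ∧ pos e x v' < pos e x q₂ := by
    have r2 := rb q₂
    have r3 := rb v'
    rw [if_pos (by omega)] at r2
    have : pos e x v' ≠ pos e x p := fun h => hv'p (pos_inj.1 h)
    split_ifs at r3 <;> omega
  obtain ⟨hv1, hv2⟩ := hv1
  -- the other two vertices of `t'` form an edge in the link of `x`
  obtain ⟨w', hwt', hw'x, hw'v⟩ : ∃ c ∈ t', c ≠ x ∧ c ≠ v' :=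
    exists_mem_ne_ne (hF.card_eq ht') _ _
  have hedge : (linkGraph F x).Adj v' w' := by
    rw [hF.linkGraph_adj, ← eq_triple_of_mem (hF.card_eq ht') hxt' hvt' hwt' hv'x.symm hw'x.symm
      hw'v.symm]
    exact ht'
  have hw'p : pos e x w' ≠ pos e x p := by
    intro h; obtain rfl := pos_inj.1 h; exact hpt' hwt'
  have hw'q : pos e x w' ≠ pos e x q₂ := by
    intro h; obtain rfl := pos_inj.1 h; exact hq₂t' hwt'
  have hv'q : pos e x v' ≠ pos e x q₁ := fun h => hvq (pos_inj.1 h)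
  -- `t` confines the rest: all its vertices other than `p` lie beyond `q₁`
  have hT : ∀ y ∈ t, y ≠ p → pos e x q₁ < pos e x y := by
    intro y hy hyp
    by_contra! hle
    have : pos e x y ≠ pos e x q₁ := by
      intro h; obtain rfl := pos_inj.1 h; exact hq₁t hy
    exact hF.not_straddle h₁.symm ht hxt hy hvt hq₁t hyp (ne_of_pos_lt (hlt₁.trans hv)).symm
      (by omega) hv
  have hq₁d : ∀ d, (linkGraph F x).Adj q₁ d → pos e x q₁ < pos e x d → False := by
    intro d hd hlt
    obtain ⟨y, hyt, hyp, hyd⟩ : ∃ c ∈ t, c ≠ p ∧ c ≠ d :=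
      exists_mem_ne_ne (hF.card_eq ht) _ _
    exact hF.not_straddle hd ht hxt hpt hyt hq₁t (ne_of_pos_lt (hlt₁.trans hlt)) hyd hlt₁
      (hT y hyt hyp)
  have hsmall (a b : ZMod n) (hab : (linkGraph F x).Adj a b) (h3 : pos e x p < pos e x a)
      (h4 : pos e x a < pos e x b) (h5 : pos e x b ≤ pos e x q₁) : False := by
    refine hF.not_straddle hab ht hxt hpt hvt (fun hat => ?_) (ne_of_pos_lt (h3.trans h4))
      (ne_of_pos_lt (by omega : _ < pos e x v)).symm h3 (by omega)
    have := hT a hat (ne_of_pos_lt h3).symm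
    omega
  rcases lt_or_gt_of_ne hv'q with h3 | h3
  · have h4 : pos e x p < pos e x w' := by
      by_contra h
      exact hF.adj_noncrossing hedge.symm h₁ (by omega) hv1 h3
    have h5 : pos e x w' ≤ pos e x q₁ := by
      by_contra h
      exact hF.adj_noncrossing h₁ hedge hv1 h3 (by omega)
    rcases lt_trichotomy (pos e x v') (pos e x w') with h | h | h
    · exact hsmall _ _ hedge hv1 h h5
    · exact hw'v (pos_inj.1 h).symm
    · exact hsmall _ _ hedge.symm h4 h h3.le
  · have h4 : pos e x p < pos e x w' := by
      by_contra h
      exact hF.adj_noncrossing hedge.symm h₂ (by omega) hv1 hv2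
    have h5 : pos e x w' < pos e x q₂ := by
      by_contra h
      exact hF.adj_noncrossing h₂ hedge hv1 hv2 (by omega)
    have h6 : pos e x q₁ < pos e x w' := by
      rcases lt_trichotomy (pos e x w') (pos e x q₁) with h | h | h
      · exact (hF.adj_noncrossing h₁ hedge.symm h4 h h3).elim
      · obtain rfl := pos_inj.1 h
        exact (hq₁d v' hedge.symm h3).elim
      · exact h
    -- that edge lies between `q₁` and `q₂`, hence so does a neighbour of `p`
    have : ∃ r, pos e x q₁ < pos e x r ∧ pos e x r < pos e x q₂ ∧ (linkGraph F x).Adj p r := by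
      rcases lt_trichotomy (pos e x v') (pos e x w') with h | h | h
      · exact hF.exists_adj_below h₂ (Or.inr ⟨h₁, hlt₁, hq₁d⟩) hedge h3 h h5
      · exact (hw'v (pos_inj.1 h).symm).elim
      · exact hF.exists_adj_below h₂ (Or.inr ⟨h₁, hlt₁, hq₁d⟩) hedge.symm h6 h hv2
    obtain ⟨r, hr1, hr2, hr3⟩ := this
    exact hnone r hr3 hr1 hr2

/-! ### Mutations preserve clusters -/

/-- The local reason why mutations are possible: a triangle that crosses the diagonal `{z, a, c}`
of a quadrilateral without crossing its sides is the other diagonal `{z, b, d}`. -/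
theorem eq_of_crossing_diagonal_of_pos {z a b c d : ZMod n} {t : Finset (ZMod n)} (ht : t.card = 3)
    (hz : a ≠ z) (h1 : pos e z a < pos e z b) (h2 : pos e z b < pos e z c)
    (h3 : pos e z c < pos e z d) (hab : ¬ Crossing {z, a, b} t) (hbc : ¬ Crossing {z, b, c} t)
    (hcd : ¬ Crossing {z, c, d} t) (had : ¬ Crossing {z, a, d} t) (hac : Crossing t {z, a, c}) :
    t = {z, b, d} := by
  have hz0 := pos_pos (e := e).2 hz
  have hbz : b ≠ z := by rintro rfl; simp at h1
  have hcz : c ≠ z := by rintro rfl; simp at h2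
  have hdz : d ≠ z := by rintro rfl; simp at h3
  -- for a triangle at `z` the positions decide; any other one straddles an end of the diagonal,
  -- which leaves no place for its third vertex
  rcases crossing_cases (e := e) ht hz (h1.trans h2) hac with
    ⟨u, v, rfl, huz, hvz, huv⟩ | ⟨hzt, u, hut, v, hvt, h⟩
  · have huv' : pos e z u < pos e z v := by omega
    have nc {p q : ZMod n} (hpz : p ≠ z) (hqz : q ≠ z) (hpq : ¬ Crossing {z, p, q} {z, u, v}) :
        ¬ (pos e z p < pos e z u ∧ pos e z u < pos e z q ∧ pos e z q < pos e z v) ∧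
        ¬ (pos e z u < pos e z p ∧ pos e z p < pos e z v ∧ pos e z v < pos e z q) :=
      ⟨fun h => hpq (crossing_of_edges hpz huz h.1 h.2.1 h.2.2),
        fun h => hpq (crossing_of_edges huz hpz h.1 h.2.1 h.2.2).symm⟩
    have n1 := nc hz hbz hab
    have n2 := nc hbz hcz hbc
    have n3 := nc hcz hdz hcd
    have n4 := nc hz hdz had
    have : pos e z u = pos e z b ∧ pos e z v = pos e z d := by omega
    rw [pos_inj, pos_inj] at this
    rw [this.1, this.2]
  · rcases h with ⟨h4, h5, h6, h7, h8⟩ | ⟨h4, h5, h6, h7, h8⟩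
    · exfalso
      have hub : u ≠ b := ne_of_pos_lt (h7.trans h1)
      have hud : u ≠ d := ne_of_pos_lt (h7.trans (h1.trans (h2.trans h3)))
      by_cases hvb : v = b
      · subst hvb
        exact had (crossing_of_straddle hz hdz hzt hut hvt h4
          hud (ne_of_pos_lt (h2.trans h3)) h7 h8)
      · exact hab (crossing_of_straddle hz hbz hzt hut hvt h4 hub hvb h7 h8)
    · exfalso
      have hub : u = b := by
        by_contra hub
        refine hbc ?_
        rw [Finset.pair_comm]
        exact crossing_of_straddle hcz hbz hzt hut hvt h4 hub
          (ne_of_pos_lt (h2.trans h8)).symm h7 h8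
      have hvd : v = d := by
        by_contra hvd
        exact hcd (crossing_of_straddle hcz hdz hzt hut hvt h4
          (ne_of_pos_lt (h7.trans h3)) hvd h7 h8)
      subst hub hvd
      obtain ⟨w, hwt, hwu, hwv⟩ := exists_mem_ne_ne ht u v
      have hwz : w ≠ z := by rintro rfl; exact hzt hwt
      have hwu' : pos e z w ≠ pos e z u := fun h => hwu (pos_inj.1 h)
      have hwv' : pos e z w ≠ pos e z v := fun h => hwv (pos_inj.1 h)
      have hwc : pos e z w ≠ pos e z c := fun h => h4 (pos_inj.1 h ▸ hwt)
      rcases lt_or_gt_of_ne hwc with h9 | h9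
      · by_cases hat : a ∈ t
        · have := crossing_of_straddle hcz hbz hzt hat hvt h4 h5.symm
            (ne_of_pos_lt (h7.trans h8)).symm (h1.trans h7) h8
          rw [Finset.pair_comm] at this
          exact hbc this
        · refine hbc ?_
          rw [Finset.pair_comm]
          exact crossing_of_straddle hcz hbz hzt hwt hvt h4 hwu
            (ne_of_pos_lt (h7.trans h8)).symm h9 h8
      · exact hcd (crossing_of_straddle hcz hdz hzt hut hwt h4
          (ne_of_pos_lt (h7.trans h8)) hwv h7 h9)

/-- The version of `eq_of_crossing_diagonal_of_pos` in terms of the cyclic order alone; it depends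
on the place of `z` among `a, b, c, d`, and reflections reduce the four cases to one. -/
theorem eq_of_crossing_diagonal {z a b c d : ZMod n} {t : Finset (ZMod n)} (ht : t.card = 3)
    (hz : [z, a, b, c, d].Nodup) (h1 : sbtw a b c) (h2 : sbtw c d a)
    (hab : ¬ Crossing {z, a, b} t) (hbc : ¬ Crossing {z, b, c} t) (hcd : ¬ Crossing {z, c, d} t)
    (hda : ¬ Crossing {z, d, a} t) (hac : Crossing t {z, a, c}) : t = {z, b, d} := by
  simp only [List.nodup_cons, List.mem_cons, List.not_mem_nil, or_false, not_or] at hz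
  obtain ⟨⟨ha, hb, hc, hd⟩, -⟩ := hz
  rw [sbtw_iff_pos z] at h1 h2
  have : (pos 1 z a < pos 1 z b ∧ pos 1 z b < pos 1 z c ∧ pos 1 z c < pos 1 z d) ∨
      (pos 1 z b < pos 1 z c ∧ pos 1 z c < pos 1 z d ∧ pos 1 z d < pos 1 z a) ∨
      (pos 1 z c < pos 1 z d ∧ pos 1 z d < pos 1 z a ∧ pos 1 z a < pos 1 z b) ∨
      (pos 1 z d < pos 1 z a ∧ pos 1 z a < pos 1 z b ∧ pos 1 z b < pos 1 z c) := by omega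
  have hneg {y w : ZMod n} (hy : z ≠ y) (hw : z ≠ w) (h : pos 1 z y < pos 1 z w) :
      pos (-1) z w < pos (-1) z y := (pos_neg_lt_iff hw.symm hy.symm).2 h
  rcases this with ⟨h3, h4, h5⟩ | ⟨h3, h4, h5⟩ | ⟨h3, h4, h5⟩ | ⟨h3, h4, h5⟩
  · rw [Finset.pair_comm d a] at hda
    exact eq_of_crossing_diagonal_of_pos ht (Ne.symm ha) h3 h4 h5 hab hbc hcd hda hac
  · rw [Finset.pair_comm d a] at hda
    rw [Finset.pair_comm c d] at hcd
    rw [Finset.pair_comm b c] at hbc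
    rw [Finset.pair_comm b d]
    exact eq_of_crossing_diagonal_of_pos ht (Ne.symm ha) (hneg hd ha h5) (hneg hc hd h4)
      (hneg hb hc h3) hda hcd hbc hab hac
  · rw [Finset.pair_comm b c] at hbc
    rw [Finset.pair_comm a c] at hac
    rw [Finset.pair_comm b d]
    exact eq_of_crossing_diagonal_of_pos ht (Ne.symm hc) h3 h4 h5 hcd hda hab hbc hac
  · rw [Finset.pair_comm d a] at hda
    rw [Finset.pair_comm c d] at hcd
    rw [Finset.pair_comm b c] at hbc
    rw [Finset.pair_comm a b] at hab
    rw [Finset.pair_comm a c] at hac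
    rw [Finset.pair_comm d c] at hcd
    exact eq_of_crossing_diagonal_of_pos ht (Ne.symm hc) (hneg hb hc h5) (hneg ha hb h4)
      (hneg hd ha h3) hbc hab hda hcd hac

/-- A mutation of a cluster is a cluster. -/
theorem IsMutation.isCluster (hF : IsCluster F) (h : IsMutation F F') : IsCluster F' := by
  obtain ⟨z, a, b, c, d, hz, h1, h2, hab, hbc, hcd, hda, hac, rfl⟩ := h
  have hne := hz
  simp only [List.nodup_cons, List.mem_cons, List.not_mem_nil, or_false, not_or] at hne
  obtain ⟨⟨hza, hzb, hzc, hzd⟩, ⟨hab', hac', had'⟩, ⟨hbc', hbd'⟩, hcd', -⟩ := hne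
  have hz' : [z, b, c, d, a].Nodup := by
    simp only [List.nodup_cons, List.mem_cons, List.not_mem_nil, or_false, not_or]
    tauto
  have h3 : sbtw b c d := (sbtw_trans_right h2 h1.cyclic_right).cyclic_right
  have h4 : sbtw d a b := (sbtw_trans_right h1 h2.cyclic_right).cyclic_right
  have hcard : ({z, b, d} : Finset (ZMod n)).card = 3 := card_triple_eq_three.2 ⟨hzb, hzd, hbd'⟩
  have hcross : Crossing {z, a, c} {z, b, d} :=
    ⟨a, by simp; tauto, c, by simp; tauto, b, by simp; tauto, d, by simp; tauto, h1, h2⟩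
  have hnew : ∀ t ∈ F, t ≠ {z, a, c} → ¬ Crossing t {z, b, d} := fun t ht hne hcr => by
    refine hne ?_
    rw [Finset.pair_comm a c]
    exact eq_of_crossing_diagonal (hF.card_eq ht) hz' h3 h4 (hF.1.2 _ hbc _ ht) (hF.1.2 _ hcd _ ht)
      (hF.1.2 _ hda _ ht) (hF.1.2 _ hab _ ht) hcr
  have hmem : ∀ p q, {z, p, q} ∈ F → (p ∉ ({z, a, c} : Finset (ZMod n)) ∨
      q ∉ ({z, a, c} : Finset (ZMod n))) →
      {z, p, q} ∈ insert {z, b, d} (F \ {{z, a, c}}) := fun p q hpq h => by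
    refine Or.inr ⟨hpq, fun heq => ?_⟩
    rw [Set.mem_singleton_iff] at heq
    rw [← heq] at h
    simp at h
  refine ⟨⟨?_, ?_⟩, ?_⟩
  · rintro t (rfl | ht)
    exacts [hcard, hF.card_eq ht.1]
  · rintro s (rfl | hs) t (rfl | ht)
    · exact not_crossing_self _
    · exact fun hcr => hnew t ht.1 ht.2 hcr.symm
    · exact hnew s hs.1 hs.2
    · exact hF.1.2 s hs.1 t ht.1
  · -- maximality: a triangle compatible with the new family crosses at most the removed diagonal,
    -- and if it does, it is the new one
    intro H hH hsub t ht
    by_cases hteq : t = {z, b, d}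
    · exact Or.inl hteq
    have hnc (s) (hs : s ∈ insert {z, b, d} (F \ {{z, a, c}})) : ¬ Crossing s t :=
      hH.2 s (hsub hs) t ht
    have htF : t ∈ F := by
      refine hF.mem_of_not_crossing (hH.1 t ht) fun s hs hcr => ?_
      by_cases hsac : s = {z, a, c}
      · subst hsac
        refine hteq (eq_of_crossing_diagonal (hH.1 t ht) hz h1 h2 (hnc _ (hmem a b hab (Or.inr ?_)))
          (hnc _ (hmem b c hbc (Or.inl ?_))) (hnc _ (hmem c d hcd (Or.inr ?_)))
          (hnc _ (hmem d a hda (Or.inl ?_))) hcr.symm) <;> simp <;> tauto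
      · exact hnc s (Or.inr ⟨hs, hsac⟩) hcr
    refine Or.inr ⟨htF, ?_⟩
    rintro rfl
    exact hH.2 _ ht _ (hsub (Or.inl rfl)) hcross

/-! ### The end points of the link -/

/-- The position of `x - k e`. -/
theorem pos_neg_pt {k : ℕ} (hk : 0 < k) (hk' : k < n) : pos e x (pt (-e) x k) = n - k := by
  have h : pos (-e) x (pt (-e) x k) = k := pos_pt hk'
  have hne : pt (-e) x k ≠ x := by
    rw [← pos_pos (e := -e), h]; exact hk
  have h2 := pos_neg (-e) hne
  rw [neg_neg, h] at h2
  exact h2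

/-- An interval crosses no triangle, since it has no room for an element between two of its own. -/
theorem IsCluster.mem_interval (hF : IsCluster F) (hn : 3 ≤ n) (i : ZMod n) :
    {i, i + 1, i + 2} ∈ F := by
  have h0 : pos 1 i i = 0 := pos_self 1 i
  have h1 : pos 1 i (i + 1) = 1 := by
    have := pos_pt (n := n) (e := 1) (x := i) (k := 1) (by omega); simpa [pt] using this
  have h2 : pos 1 i (i + 2) = 2 := by
    have := pos_pt (n := n) (e := 1) (x := i) (k := 2) (by omega); simpa [pt] using this
  have hmem (y : ZMod n) : y ∈ ({i, i + 1, i + 2} : Finset (ZMod n)) ↔ pos 1 i y ≤ 2 := by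
    simp only [Finset.mem_insert, Finset.mem_singleton]
    rw [← pos_inj (e := 1) (x := i), ← pos_inj (e := 1) (x := i) (b := i + 1),
      ← pos_inj (e := 1) (x := i) (b := i + 2)]
    omega
  refine hF.mem_of_not_crossing (card_triple_eq_three.2 ⟨?_, ?_, ?_⟩) fun s hs hcr => ?_
  · rw [Ne, ← pos_inj (e := 1) (x := i)]; omega
  · rw [Ne, ← pos_inj (e := 1) (x := i)]; omega
  · rw [Ne, ← pos_inj (e := 1) (x := i)]; omega
  · rcases hcr.exists_pos_lt 1 i with ⟨a, b, c, d, ha, ha', hb, hb', hc, hc', hd, hd', h4, h5, h6⟩ |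
      ⟨a, b, c, d, ha, ha', hb, hb', hc, hc', hd, hd', h4, h5, h6⟩
    · rw [hmem] at hd; omega
    · rw [hmem] at hb' hc; omega

theorem IsCluster.adj_pt_one_pt_two (hF : IsCluster F) (hn : 3 ≤ n) (e : ℤˣ) (x : ZMod n) :
    (linkGraph F x).Adj (pt e x 1) (pt e x 2) := by
  rw [hF.linkGraph_adj]
  rcases Int.units_eq_one_or e with rfl | rfl
  · simpa [pt] using hF.mem_interval hn x
  · have h := hF.mem_interval hn (x - 2)
    have h1 : x - 2 + 1 = x - 1 := by ring
    rw [h1, sub_add_cancel, Finset.pair_comm, Finset.insert_comm, Finset.pair_comm] at h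
    simpa [pt, ← sub_eq_add_neg] using h

theorem IsCluster.adj_ends (hF : IsCluster F) (hn : 3 ≤ n) (e : ℤˣ) (x : ZMod n) :
    (linkGraph F x).Adj (pt e x 1) (pt (-e) x 1) := by
  have h : (linkGraph F x).Adj (x - 1) (x + 1) := by
    rw [hF.linkGraph_adj]
    have h := hF.mem_interval hn (x - 1)
    have h1 : x - 1 + 2 = x + 1 := by ring
    rwa [h1, sub_add_cancel, Finset.insert_comm] at h
  rcases Int.units_eq_one_or e with rfl | rfl
  · simpa [pt, ← sub_eq_add_neg] using h.symm
  · simpa [pt, ← sub_eq_add_neg] using h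

/-! ### Triangulation points -/

theorem isTriPoint_iff {G : SimpleGraph (ZMod n)} {p : ZMod n} :
    IsTriPoint G p ↔ ∃ a b, a ≠ b ∧ G.Adj p a ∧ G.Adj p b := by
  unfold IsTriPoint deg
  rw [Nat.succ_le_iff, Set.one_lt_ncard_iff (Set.toFinite _)]
  simp only [SimpleGraph.mem_neighborSet]
  constructor
  · rintro ⟨a, b, ha, hb, hab⟩; exact ⟨a, b, hab, ha, hb⟩
  · rintro ⟨a, b, hab, ha, hb⟩; exact ⟨a, b, ha, hb, hab⟩

theorem deg_eq_one_iff {G : SimpleGraph (ZMod n)} {p : ZMod n} :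
    deg G p = 1 ↔ ∃ a, ∀ b, G.Adj p b ↔ b = a := by
  unfold deg
  rw [Set.ncard_eq_one]
  simp [Set.ext_iff]

theorem deg_eq_two_iff {G : SimpleGraph (ZMod n)} {p : ZMod n} :
    deg G p = 2 ↔ ∃ a b, a ≠ b ∧ ∀ c, G.Adj p c ↔ c = a ∨ c = b := by
  unfold deg
  rw [Set.ncard_eq_two]
  simp [Set.ext_iff]

theorem IsLeafAt.eq {G : SimpleGraph (ZMod n)} {p q r : ZMod n} (h : IsLeafAt G p q)
    (hr : G.Adj q r) : r = p := by
  obtain ⟨a, ha⟩ := deg_eq_one_iff.1 h.2.2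
  rw [(ha r).1 hr, (ha p).1 h.2.1.symm]

theorem IsLeafAt.not_isTriPoint {G : SimpleGraph (ZMod n)} {p q : ZMod n} (h : IsLeafAt G p q) :
    ¬ IsTriPoint G q := by
  unfold IsTriPoint; rw [h.2.2]; omega

theorem isTriPoint_or_isLeafAt {G : SimpleGraph (ZMod n)} {p q : ZMod n} (hp : IsTriPoint G p)
    (h : G.Adj p q) : IsTriPoint G q ∨ IsLeafAt G p q := by
  by_cases hq : IsTriPoint G q
  · exact Or.inl hq
  · refine Or.inr ⟨hp, h, ?_⟩
    unfold IsTriPoint at hq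
    have : deg G q ≠ 0 := by
      exact ((Set.ncard_pos (Set.toFinite _)).2 ⟨p, h.symm⟩).ne'
    omega

theorem IsTriPoint.ne {p : ZMod n} (hp : IsTriPoint (linkGraph F x) p) : p ≠ x := by
  obtain ⟨a, -, -, ha, -⟩ := isTriPoint_iff.1 hp
  exact ha.2.1

theorem pos_eq_one_iff (hn : 2 ≤ n) {p : ZMod n} : pos e x p = 1 ↔ p = pt e x 1 := by
  have := pos_pt (e := e) (x := x) (k := 1) (by omega : 1 < n)
  rw [← pos_inj (e := e) (x := x), this]

theorem pos_eq_sub_one_iff (hn : 2 ≤ n) {p : ZMod n} : pos e x p = n - 1 ↔ p = pt (-e) x 1 := by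
  have := pos_neg_pt (e := e) (x := x) (k := 1) (by omega) (by omega : 1 < n)
  rw [← pos_inj (e := e) (x := x), this]

theorem IsCluster.isTriPoint_end (hF : IsCluster F) (hn : 5 ≤ n) (e : ℤˣ) (x : ZMod n) :
    IsTriPoint (linkGraph F x) (pt e x 1) := by
  refine isTriPoint_iff.2 ⟨pt e x 2, pt (-e) x 1, ?_, hF.adj_pt_one_pt_two (by omega) e x,
    hF.adj_ends (by omega) e x⟩
  rw [Ne, ← pos_inj (e := e) (x := x), pos_pt (by omega), pos_neg_pt (by omega) (by omega)]
  omega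

/-- A triangulation point other than the first one has a smaller neighbour. -/
theorem IsCluster.exists_adj_lt (hF : IsCluster F) (hn : 5 ≤ n) {p : ZMod n}
    (hp : IsTriPoint (linkGraph F x) p) (hp1 : p ≠ pt e x 1) :
    ∃ q, (linkGraph F x).Adj p q ∧ pos e x q < pos e x p := by
  by_contra! hcon
  obtain ⟨a, b, hab, ha, hb⟩ := isTriPoint_iff.1 hp
  have h0 := pos_pos (e := e).2 hp.ne
  have h1 : pos e x p ≠ 1 := fun h => hp1 ((pos_eq_one_iff (by omega)).1 h)
  have hpa : pos e x p < pos e x a := by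
    have := hcon a ha
    have : pos e x a ≠ pos e x p := fun h => ha.1 (pos_inj.1 h).symm
    omega
  have hpb : pos e x p < pos e x b := by
    have := hcon b hb
    have : pos e x b ≠ pos e x p := fun h => hb.1 (pos_inj.1 h).symm
    omega
  have hab' : pos e x a ≠ pos e x b := fun h => hab (pos_inj.1 h)
  have hend := hF.adj_ends (by omega) e x
  have := pos_lt e x a
  -- an innermost edge spanning `p`
  obtain ⟨⟨u, w⟩, ⟨huw, hup, hpw⟩, hmin⟩ := exists_minimizer
    (S := fun y : ZMod n × ZMod n => (linkGraph F x).Adj y.1 y.2 ∧ pos e x y.1 < pos e x p ∧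
      pos e x p < pos e x y.2) (fun y => pos e x y.2 - pos e x y.1)
    ⟨(pt e x 1, pt (-e) x 1), hend, by dsimp only; rw [pos_pt (by omega)]; omega,
      by dsimp only; rw [pos_neg_pt (by omega) (by omega)]; omega⟩
  simp only [Prod.forall] at hmin huw hup hpw
  have hle (c : ZMod n) (hc : (linkGraph F x).Adj p c) : pos e x c ≤ pos e x w := by
    by_contra! h
    exact hF.adj_noncrossing huw hc hup hpw h
  have hq : ∃ q, (linkGraph F x).Adj p q ∧ pos e x p < pos e x q ∧ pos e x q < pos e x w := by
    have := hle a ha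
    have := hle b hb
    by_cases h : pos e x a < pos e x w
    · exact ⟨a, ha, hpa, h⟩
    · exact ⟨b, hb, hpb, by omega⟩
  obtain ⟨q, hq1, hq2, hq3⟩ := hq
  rcases hF.exists_adj_of_nested huw hq1 hup hq2 hq3 (by
    intro c d hcd h3 h4 h5
    have h6 := hmin c d ⟨hcd, h4, h5⟩
    have : pos e x d ≤ pos e x w := by
      by_contra! h
      exact hF.adj_noncrossing huw hcd h3 (by omega) h
    omega) with h | ⟨r, h3, h4, h5⟩
  · have := hcon u h.symm
    omega
  · have := hmin u r ⟨h5, hup, h3⟩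
    omega

theorem IsCluster.exists_adj_gt (hF : IsCluster F) (hn : 5 ≤ n) {p : ZMod n}
    (hp : IsTriPoint (linkGraph F x) p) (hp1 : p ≠ pt (-e) x 1) :
    ∃ q, (linkGraph F x).Adj p q ∧ pos e x p < pos e x q := by
  obtain ⟨q, hq, hlt⟩ := hF.exists_adj_lt hn hp hp1
  exact ⟨q, hq, (pos_neg_lt_iff hq.2.2.1 hp.ne).1 hlt⟩

/-- `q` is the next triangulation point after `p` in the direction of `e`. -/
def NextTri (e : ℤˣ) (x : ZMod n) (G : SimpleGraph (ZMod n)) (p q : ZMod n) : Prop :=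
  IsTriPoint G p ∧ IsTriPoint G q ∧ pos e x p < pos e x q ∧
    ∀ r, IsTriPoint G r → pos e x p < pos e x r → pos e x r < pos e x q → False

theorem nextTri_neg {p q : ZMod n} :
    NextTri (-e) x (linkGraph F x) q p ↔ NextTri e x (linkGraph F x) p q := by
  have key (e : ℤˣ) (p q : ZMod n) (h : NextTri (-e) x (linkGraph F x) q p) :
      NextTri e x (linkGraph F x) p q :=
    ⟨h.2.1, h.1, (pos_neg_lt_iff h.1.ne h.2.1.ne).1 h.2.2.1, fun r hr h1 h2 => h.2.2.2 r hr
      ((pos_neg_lt_iff h.1.ne hr.ne).2 h2) ((pos_neg_lt_iff hr.ne h.2.1.ne).2 h1)⟩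
  exact ⟨key e p q, fun h => key (-e) q p (by rwa [neg_neg])⟩

theorem isNextTri_iff {p q : ZMod n} :
    IsNextTri x (linkGraph F x) p q ↔ NextTri 1 x (linkGraph F x) p q := by
  unfold IsNextTri NextTri
  have key (a b : ZMod n) (ha : IsTriPoint (linkGraph F x) a) :
      sbtw x a b ↔ pos 1 x a < pos 1 x b := by
    rw [sbtw_iff_pos x, pos_self]
    have := pos_pos (e := 1).2 ha.ne
    omega
  constructor
  · rintro ⟨h1, h2, h3, h4⟩
    refine ⟨h1, h2, (key _ _ h1).1 h3, fun r hr h5 h6 =>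
      h4 r hr ⟨(key _ _ h1).2 h5, (key _ _ hr).2 h6⟩⟩
  · rintro ⟨h1, h2, h3, h4⟩
    exact ⟨h1, h2, (key _ _ h1).2 h3, fun r hr h5 =>
      h4 r hr ((key _ _ h1).1 h5.1) ((key _ _ hr).1 h5.2)⟩

theorem NextTri.unique {G : SimpleGraph (ZMod n)} {p q r : ZMod n} (h : NextTri e x G p q)
    (h' : NextTri e x G p r) : q = r := by
  rcases lt_trichotomy (pos e x q) (pos e x r) with h1 | h1 | h1
  · exact (h'.2.2.2 q h.2.1 h.2.2.1 h1).elim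
  · exact pos_inj.1 h1
  · exact (h.2.2.2 r h'.2.1 h'.2.2.1 h1).elim

theorem NextTri.unique_left {G : SimpleGraph (ZMod n)} {p q r : ZMod n} (h : NextTri e x G q p)
    (h' : NextTri e x G r p) : q = r := by
  rcases lt_trichotomy (pos e x q) (pos e x r) with h1 | h1 | h1
  · exact (h.2.2.2 r h'.1 h1 h'.2.2.1).elim
  · exact pos_inj.1 h1
  · exact (h'.2.2.2 q h.1 h1 h.2.2.1).elim

theorem IsCluster.exists_nextTri (hF : IsCluster F) (hn : 5 ≤ n) {p : ZMod n}
    (hp : IsTriPoint (linkGraph F x) p) (hp1 : p ≠ pt (-e) x 1) :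
    ∃ q, NextTri e x (linkGraph F x) p q := by
  obtain ⟨q, ⟨hq, hlt⟩, hmin⟩ := exists_minimizer (pos e x)
    (S := fun q => IsTriPoint (linkGraph F x) q ∧ pos e x p < pos e x q)
    ⟨pt (-e) x 1, hF.isTriPoint_end hn _ x, by
      rw [pos_neg_pt (by omega) (by omega)]
      have := pos_lt e x p
      have : pos e x p ≠ n - 1 := fun h => hp1 ((pos_eq_sub_one_iff (by omega)).1 h)
      omega⟩
  refine ⟨q, hp, hq, hlt, fun r hr h1 h2 => ?_⟩
  have := hmin r ⟨hr, h1⟩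
  omega

theorem IsCluster.exists_prevTri (hF : IsCluster F) (hn : 5 ≤ n) {p : ZMod n}
    (hp : IsTriPoint (linkGraph F x) p) (hp1 : p ≠ pt e x 1) :
    ∃ q, NextTri e x (linkGraph F x) q p := by
  obtain ⟨q, hq⟩ := hF.exists_nextTri (e := -e) hn hp (by rwa [neg_neg])
  exact ⟨q, nextTri_neg.1 hq⟩

theorem NextTri.ne_end (hn : 5 ≤ n) {G : SimpleGraph (ZMod n)} {p q : ZMod n}
    (h : NextTri e x G p q) : p ≠ pt (-e) x 1 := by
  intro hp
  rw [← pos_eq_sub_one_iff (by omega)] at hp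
  have := h.2.2.1
  have := pos_lt e x q
  omega

/-- The first and the last neighbour of a triangulation point other than `x ± 1` are adjacent. -/
theorem IsCluster.exists_first_last (hF : IsCluster F) (hn : 5 ≤ n) {p : ZMod n}
    (hp : IsTriPoint (linkGraph F x) p) (hp1 : p ≠ pt e x 1) (hp2 : p ≠ pt (-e) x 1) :
    ∃ l r, (linkGraph F x).Adj p l ∧ (linkGraph F x).Adj p r ∧ (linkGraph F x).Adj l r ∧
      pos e x l < pos e x p ∧ pos e x p < pos e x r ∧
      ∀ b, (linkGraph F x).Adj p b → pos e x l ≤ pos e x b ∧ pos e x b ≤ pos e x r := by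
  obtain ⟨a, ha, hap⟩ := hF.exists_adj_lt hn hp hp1
  obtain ⟨b, hb, hbp⟩ := hF.exists_adj_gt hn hp hp2
  obtain ⟨l, hl, hlm⟩ := exists_minimizer (pos e x) (S := (linkGraph F x).Adj p) ⟨a, ha⟩
  obtain ⟨r, hr, hrm⟩ := exists_pos_max e x (S := (linkGraph F x).Adj p) ⟨b, hb⟩
  have := hlm a ha
  have := hrm b hb
  exact ⟨l, r, hl, hr, hF.adj_first_last (e := e) hl hr (by omega) (by omega) hlm hrm, by omega,
    by omega, fun b hb => ⟨hlm b hb, hrm b hb⟩⟩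

/-- Consecutive triangulation points are adjacent. -/
theorem NextTri.adj (hF : IsCluster F) (hn : 5 ≤ n) {p q : ZMod n}
    (h : NextTri e x (linkGraph F x) p q) : (linkGraph F x).Adj p q := by
  by_contra hcon
  have hlt := h.2.2.1
  have hp0 := pos_pos (e := e).2 h.1.ne
  have hqn := pos_lt e x q
  -- an innermost edge spanning `p` and `q`
  obtain ⟨⟨u, w⟩, ⟨huw, hup, hqw⟩, hmin⟩ := exists_minimizer
    (S := fun y : ZMod n × ZMod n => (linkGraph F x).Adj y.1 y.2 ∧ pos e x y.1 ≤ pos e x p ∧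
      pos e x q ≤ pos e x y.2) (fun y => pos e x y.2 - pos e x y.1)
    ⟨(pt e x 1, pt (-e) x 1), hF.adj_ends (by omega) e x,
      by dsimp only; rw [pos_pt (by omega)]; omega,
      by dsimp only; rw [pos_neg_pt (by omega) (by omega)]; omega⟩
  simp only [Prod.forall] at hmin huw hup hqw
  have hu0 := pos_pos (e := e).2 huw.2.1
  have hwn := pos_lt e x w
  have inner (c d : ZMod n) (hcd : (linkGraph F x).Adj c d) (h1 : pos e x u ≤ pos e x c)
      (h2 : pos e x d ≤ pos e x w) (h3 : pos e x c ≤ pos e x p) (h4 : pos e x q ≤ pos e x d) :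
      pos e x c = pos e x u ∧ pos e x d = pos e x w := by
    have := hmin c d ⟨hcd, h3, h4⟩
    omega
  rcases hup.lt_or_eq with hup | hup
  · have hp1 : p ≠ pt e x 1 := by
      rintro rfl
      rw [pos_pt (by omega)] at hup
      omega
    obtain ⟨l, r, hl, hr, hlr, hlp, hpr, hb⟩ := hF.exists_first_last hn h.1 hp1 (h.ne_end hn)
    have hlu : pos e x u ≤ pos e x l := by
      by_contra! h1
      exact hF.adj_noncrossing hl.symm huw h1 hup (by omega)
    have hrw : pos e x r ≤ pos e x w := by
      by_contra! h1
      exact hF.adj_noncrossing huw hr hup (by omega) h1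
    have hrq : pos e x r < pos e x q := by
      by_contra! h1
      have := inner p r hr (by omega) hrw le_rfl h1
      omega
    exact h.2.2.2 r (isTriPoint_iff.2 ⟨p, l, hl.1, hr.symm, hlr.symm⟩) hpr hrq
  · obtain rfl := pos_inj.1 hup
    rcases hqw.lt_or_eq with hqw | hqw
    · have hq1 : q ≠ pt e x 1 := by
        rintro rfl
        rw [pos_pt (by omega)] at hlt
        omega
      have hq2 : q ≠ pt (-e) x 1 := by
        intro h1
        rw [← pos_eq_sub_one_iff (by omega)] at h1
        omega
      obtain ⟨l, r, hl, hr, hlr, hlp, hpr, hb⟩ := hF.exists_first_last hn h.2.1 hq1 hq2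
      have hlu : pos e x u ≤ pos e x l := by
        by_contra! h1
        exact hF.adj_noncrossing hl.symm huw h1 (by omega) (by omega)
      have hul : pos e x u ≠ pos e x l := fun h1 => hcon (pos_inj.1 h1 ▸ hl.symm)
      exact h.2.2.2 l (isTriPoint_iff.2 ⟨q, r, hr.1, hl.symm, hlr⟩) (by omega) hlp
    · obtain rfl := pos_inj.1 hqw
      exact hcon huw

/-- Below an edge that ends in a leaf there are no triangulation points adjacent to its other
end. -/
theorem IsLeafAt.not_isTriPoint_between (hF : IsCluster F) (hn : 5 ≤ n) {p q r : ZMod n}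
    (h : IsLeafAt (linkGraph F x) p q) (hr : IsTriPoint (linkGraph F x) r)
    (hpr : (linkGraph F x).Adj p r) (h1 : pos e x p < pos e x r) (h2 : pos e x r < pos e x q) :
    False := by
  obtain ⟨r, ⟨hr, hpr, h1, h2⟩, hmax⟩ := exists_pos_max e x
    (S := fun r => IsTriPoint (linkGraph F x) r ∧ (linkGraph F x).Adj p r ∧
      pos e x p < pos e x r ∧ pos e x r < pos e x q) ⟨r, hr, hpr, h1, h2⟩
  have hp0 := pos_pos (e := e).2 h.1.ne
  have hqn := pos_lt e x q
  have hr1 : r ≠ pt e x 1 := by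
    rintro rfl
    rw [pos_pt (by omega)] at h1
    omega
  have hr2 : r ≠ pt (-e) x 1 := by
    intro h1
    rw [← pos_eq_sub_one_iff (by omega)] at h1
    omega
  obtain ⟨l, z, hl, hz, hlz, hlr, hrz, hb⟩ := hF.exists_first_last hn hr hr1 hr2
  have hpl : pos e x p ≤ pos e x l := by
    by_contra! h3
    exact hF.adj_noncrossing hl.symm h.2.1 h3 h1 h2
  have := (hb p hpr.symm).1
  obtain rfl : p = l := pos_inj.1 (le_antisymm hpl this)
  have hzq : pos e x z ≤ pos e x q := by
    by_contra! h3
    exact hF.adj_noncrossing h.2.1 hz h1 h2 h3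
  have hzq' : pos e x z ≠ pos e x q := by
    intro h3
    obtain rfl := pos_inj.1 h3
    exact hl.1 (h.eq hz.symm)
  have := hmax z ⟨isTriPoint_iff.2 ⟨r, p, hl.1, hz.symm, hlz.symm⟩, hlz, by omega, by omega⟩
  omega

/-! ### Fans -/

/-- `q` belongs to the fan of `p`. -/
def InFan (e : ℤˣ) (x : ZMod n) (G : SimpleGraph (ZMod n)) (p q : ZMod n) : Prop :=
  IsLeafAt G p q ∨ NextTri e x G q p ∨ NextTri e x G p q

theorem inFan_neg {p q : ZMod n} :
    InFan (-e) x (linkGraph F x) p q ↔ InFan e x (linkGraph F x) p q := by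
  unfold InFan
  rw [nextTri_neg, nextTri_neg]
  tauto

theorem InFan.adj (hF : IsCluster F) (hn : 5 ≤ n) {p q : ZMod n}
    (h : InFan e x (linkGraph F x) p q) : (linkGraph F x).Adj p q := by
  rcases h with h | h | h
  exacts [h.2.1, (h.adj hF hn).symm, h.adj hF hn]

theorem InFan.isTriPoint {G : SimpleGraph (ZMod n)} {p q : ZMod n} (h : InFan e x G p q) :
    IsTriPoint G p := by
  rcases h with h | h | h
  exacts [h.1, h.2.1, h.1]

theorem InFan.le_next (hF : IsCluster F) (hn : 5 ≤ n) {p q r : ZMod n}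
    (h : InFan e x (linkGraph F x) p q) (hr : NextTri e x (linkGraph F x) p r) :
    pos e x q ≤ pos e x r := by
  rcases h with h | h | h
  · by_contra! h1
    exact h.not_isTriPoint_between hF hn hr.2.1 (hr.adj hF hn) hr.2.2.1 h1
  · exact (h.2.2.1.trans hr.2.2.1).le
  · rw [h.unique hr]

theorem InFan.prev_le (hF : IsCluster F) (hn : 5 ≤ n) {p q r : ZMod n}
    (h : InFan e x (linkGraph F x) p q) (hr : NextTri e x (linkGraph F x) r p) :
    pos e x r ≤ pos e x q := by
  by_contra! h1
  have h2 := (inFan_neg.2 h).le_next hF hn (nextTri_neg.2 hr)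
  rw [← pos_neg_lt_iff hr.1.ne (h.adj hF hn).2.2.1] at h1
  omega

/-- A neighbour of `p` between two members of its fan belongs to the fan. -/
theorem InFan.of_between (hF : IsCluster F) (hn : 5 ≤ n) {p q r b : ZMod n}
    (hq : InFan e x (linkGraph F x) p q) (hr : InFan e x (linkGraph F x) p r)
    (hb : (linkGraph F x).Adj p b) (h1 : pos e x q < pos e x b) (h2 : pos e x b < pos e x r) :
    InFan e x (linkGraph F x) p b := by
  rcases isTriPoint_or_isLeafAt hq.isTriPoint hb with hbt | hbl
  · have hp0 := pos_pos (e := e).2 hq.isTriPoint.ne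
    have hb0 := pos_pos (e := e).2 hb.2.2.1
    have hbn := pos_lt e x b
    have hpn := pos_lt e x p
    rcases lt_trichotomy (pos e x b) (pos e x p) with h | h | h
    · have hp1 : p ≠ pt e x 1 := by
        rintro rfl
        rw [pos_pt (by omega)] at h
        omega
      obtain ⟨P, hP⟩ := hF.exists_prevTri hn hq.isTriPoint hp1
      have := hq.prev_le hF hn hP
      exact (hP.2.2.2 b hbt (by omega) h).elim
    · exact (hb.1 (pos_inj.1 h).symm).elim
    · have hp1 : p ≠ pt (-e) x 1 := by
        intro h3
        rw [← pos_eq_sub_one_iff (by omega)] at h3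
        omega
      obtain ⟨P, hP⟩ := hF.exists_nextTri hn hq.isTriPoint hp1
      have := hr.le_next hF hn hP
      exact (hP.2.2.2 b hbt h (by omega)).elim
  · exact Or.inl hbl

/-- Border triangles belong to the cluster. -/
theorem InFan.mem_of_consecutive (hF : IsCluster F) (hn : 5 ≤ n) {p q r : ZMod n}
    (hq : InFan e x (linkGraph F x) p q) (hr : InFan e x (linkGraph F x) p r)
    (hlt : pos e x q < pos e x r)
    (hnone : ∀ b, InFan e x (linkGraph F x) p b → pos e x q < pos e x b → pos e x b < pos e x r →
      False) : {p, q, r} ∈ F := by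
  have key (e : ℤˣ) (q r : ZMod n) (hq : InFan e x (linkGraph F x) p q)
      (hr : InFan e x (linkGraph F x) p r) (hlt : pos e x q < pos e x r)
      (hnone : ∀ b, (linkGraph F x).Adj p b → pos e x q < pos e x b → pos e x b < pos e x r →
        False) (hpq : pos e x p < pos e x q) : {p, q, r} ∈ F := by
    refine (hF.adj_or_mem_of_consecutive (hq.adj hF hn) (hr.adj hF hn) hpq hlt
      hnone).resolve_left fun hqr => ?_
    have hq' : IsTriPoint (linkGraph F x) q := isTriPoint_iff.2
      ⟨p, r, (hr.adj hF hn).1, (hq.adj hF hn).symm, hqr⟩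
    have hr' : IsTriPoint (linkGraph F x) r := isTriPoint_iff.2
      ⟨p, q, (hq.adj hF hn).1, (hr.adj hF hn).symm, hqr.symm⟩
    have h2 : NextTri e x (linkGraph F x) p r := by
      rcases hr with h | h | h
      · exact (h.not_isTriPoint hr').elim
      · have := h.2.2.1
        omega
      · exact h
    exact h2.2.2.2 q hq' hpq hlt
  have hnone' : ∀ b, (linkGraph F x).Adj p b → pos e x q < pos e x b → pos e x b < pos e x r →
        False := fun b hb h1 h2 => hnone b (hq.of_between hF hn hr hb h1 h2) h1 h2
  have hqa := hq.adj hF hn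
  have hra := hr.adj hF hn
  rcases lt_trichotomy (pos e x p) (pos e x q) with h | h | h
  · exact key e q r hq hr hlt hnone' h
  · exact (hqa.1 (pos_inj.1 h)).elim
  · rcases lt_trichotomy (pos e x p) (pos e x r) with h1 | h1 | h1
    · exact hF.adj_pred_succ hqa hra h h1 hnone'
    · exact (hra.1 (pos_inj.1 h1)).elim
    · rw [Finset.pair_comm]
      refine key (-e) r q (inFan_neg.2 hr) (inFan_neg.2 hq)
        ((pos_neg_lt_iff hra.2.2.1 hqa.2.2.1).2 hlt) (fun b hb h2 h3 => ?_)
        ((pos_neg_lt_iff hqa.2.1 hra.2.2.1).2 h1)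
      exact hnone' b hb ((pos_neg_lt_iff hb.2.2.1 hqa.2.2.1).1 h3)
        ((pos_neg_lt_iff hra.2.2.1 hb.2.2.1).1 h2)

/-- A leaf other than `x + 2e` is not the first element of the fan. -/
theorem IsLeafAt.exists_inFan_lt (hF : IsCluster F) (hn : 5 ≤ n) {p q : ZMod n}
    (h : IsLeafAt (linkGraph F x) p q) (hq : q ≠ pt e x 2) :
    ∃ r, InFan e x (linkGraph F x) p r ∧ pos e x r < pos e x q := by
  by_cases hp : p = pt e x 1
  · subst hp
    have h1 := hF.adj_pt_one_pt_two (by omega) e x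
    have h2 := pos_pt (e := e) (x := x) (k := 1) (by omega : 1 < n)
    have h3 := pos_pt (e := e) (x := x) (k := 2) (by omega : 2 < n)
    refine ⟨pt e x 2, ?_, ?_⟩
    · rcases isTriPoint_or_isLeafAt h.1 h1 with h4 | h4
      · refine Or.inr (Or.inr ⟨h.1, h4, by omega, fun r _ _ _ => by omega⟩)
      · exact Or.inl h4
    · have h4 : pos e x q ≠ 2 := fun h4 => hq (pos_inj.1 (by rw [h4, h3]))
      have h5 : pos e x q ≠ 1 := fun h5 => h.2.1.1 (pos_inj.1 (by rw [h5, h2])).symm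
      have := pos_pos (e := e).2 h.2.1.2.2.1
      omega
  · obtain ⟨P, hP⟩ := hF.exists_prevTri hn h.1 hp
    refine ⟨P, Or.inr (Or.inl hP), ?_⟩
    have h1 := InFan.prev_le hF hn (Or.inl h) hP
    have h2 : pos e x P ≠ pos e x q := by
      intro h2
      obtain rfl := pos_inj.1 h2
      exact h.not_isTriPoint hP.1
    omega

/-! ### Border sums -/

/-- The sum of `g` over the consecutive pairs of a list. -/
def consecSum (g : ZMod n → ZMod n → ℂ) (L : List (ZMod n)) : ℂ :=
  ((L.zip L.tail).map fun y => g y.1 y.2).sum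

theorem consecSum_cons_cons (g : ZMod n → ZMod n → ℂ) (a b : ZMod n) (L : List (ZMod n)) :
    consecSum g (a :: b :: L) = g a b + consecSum g (b :: L) := by
  simp [consecSum]

theorem consecSum_singleton (g : ZMod n → ZMod n → ℂ) (a : ZMod n) : consecSum g [a] = 0 := by
  simp [consecSum]

theorem consecSum_append (g : ZMod n → ZMod n → ℂ) (L M : List (ZMod n)) (a : ZMod n) :
    consecSum g (L ++ a :: M) = consecSum g (L ++ [a]) + consecSum g (a :: M) := by
  induction L with
  | nil => simp [consecSum_singleton]
  | cons b L ih =>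
    cases L with
    | nil => simp [consecSum_cons_cons, consecSum_singleton]
    | cons c L =>
      simp only [List.cons_append, consecSum_cons_cons] at ih ⊢
      rw [ih, add_assoc]

theorem consecSum_reverse {g : ZMod n → ZMod n → ℂ} (hg : ∀ a b, g a b = g b a)
    (L : List (ZMod n)) : consecSum g L.reverse = consecSum g L := by
  induction L with
  | nil => simp
  | cons a L ih =>
    cases L with
    | nil => simp
    | cons b L =>
      rw [consecSum_cons_cons, ← ih, List.reverse_cons, List.reverse_cons, List.append_assoc,
        List.singleton_append, consecSum_append, consecSum_cons_cons, consecSum_singleton, hg b a]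
      ring

theorem consecSum_congr {g g' : ZMod n → ZMod n → ℂ} {L : List (ZMod n)}
    (h : ∀ a b, [a, b] <:+: L → g a b = g' a b) : consecSum g L = consecSum g' L := by
  induction L with
  | nil => rfl
  | cons a L ih =>
    cases L with
    | nil => simp [consecSum_singleton]
    | cons b L =>
      rw [consecSum_cons_cons, consecSum_cons_cons, h a b ⟨[], L, rfl⟩,
        ih fun c d hcd => h c d (hcd.trans (List.infix_cons (List.infix_refl _)))]

/-- `L` lists the fan of `p` in the direction of `e`. -/
def IsFan (e : ℤˣ) (x : ZMod n) (G : SimpleGraph (ZMod n)) (p : ZMod n) (L : List (ZMod n)) :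
    Prop :=
  L.Pairwise (fun a b => pos e x a < pos e x b) ∧ ∀ q, q ∈ L ↔ InFan e x G p q

theorem IsFan.unique {G : SimpleGraph (ZMod n)} {p : ZMod n} {L M : List (ZMod n)}
    (hL : IsFan e x G p L) (hM : IsFan e x G p M) : L = M := by
  refine List.Perm.eq_of_pairwise (le := fun a b => pos e x a < pos e x b) (fun a b _ _ h1 h2 => ?_)
    hL.1 hM.1 ((List.perm_ext_iff_of_nodup ?_ ?_).2 fun q => by rw [hL.2, hM.2])
  · omega
  · exact hL.1.imp ne_of_pos_lt
  · exact hM.1.imp ne_of_pos_lt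

/-- The lists produced by `fan` are increasing, and their elements are those of the fan. -/
theorem isFan_fan (hF : IsCluster F) (hn : 5 ≤ n) (p : ZMod n) :
    IsFan 1 x (linkGraph F x) p (fan x (linkGraph F x) p) := by
  have hpos (k : ℕ) (hk : k < n - 1) : pos 1 x (x + ((k + 1 : ℕ) : ZMod n)) = k + 1 := by
    have := pos_pt (e := 1) (x := x) (k := k + 1) (by omega : k + 1 < n)
    simpa [pt] using this
  constructor
  · refine List.Pairwise.filter _ ?_
    unfold around
    rw [List.pairwise_map]
    refine List.Pairwise.imp_of_mem ?_ List.pairwise_lt_range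
    intro a b ha hb hab
    rw [List.mem_range] at ha hb
    rw [hpos a ha, hpos b hb]
    omega
  · intro q
    simp only [fan, List.mem_filter, decide_eq_true_eq, isNextTri_iff]
    change _ ∧ InFan 1 x (linkGraph F x) p q ↔ _
    refine and_iff_right_of_imp fun h => ?_
    have hq := pos_pos (e := 1).2 (h.adj hF hn).2.2.1
    have hq' := pos_lt 1 x q
    simp only [around, List.mem_map, List.mem_range]
    refine ⟨pos 1 x q - 1, by omega, ?_⟩
    rw [← pos_inj (e := 1) (x := x), hpos _ (by omega)]
    omega

theorem IsFan.reverse (hF : IsCluster F) (hn : 5 ≤ n) {p : ZMod n} {L : List (ZMod n)}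
    (hL : IsFan e x (linkGraph F x) p L) : IsFan (-e) x (linkGraph F x) p L.reverse := by
  constructor
  · rw [List.pairwise_reverse]
    refine hL.1.imp_of_mem fun ha hb hab => ?_
    exact (pos_neg_lt_iff (((hL.2 _).1 hb).adj hF hn).2.2.1 (((hL.2 _).1 ha).adj hF hn).2.2.1).2 hab
  · intro q
    rw [List.mem_reverse, hL.2, inFan_neg]

theorem exists_isFan (hF : IsCluster F) (hn : 5 ≤ n) (e : ℤˣ) (p : ZMod n) :
    ∃ L, IsFan e x (linkGraph F x) p L := by
  rcases Int.units_eq_one_or e with rfl | rfl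
  · exact ⟨_, isFan_fan hF hn p⟩
  · exact ⟨_, (isFan_fan hF hn p).reverse hF hn⟩

theorem IsFan.borderSum_eq (hF : IsCluster F) (hn : 5 ≤ n) {p : ZMod n} {L : List (ZMod n)}
    (hL : IsFan e x (linkGraph F x) p L) (val : Finset (ZMod n) → ℂ) :
    borderSum x (linkGraph F x) val p = consecSum (fun a b => val {p, a, b}) L := by
  change consecSum (fun a b => val {p, a, b}) (fan x (linkGraph F x) p) = _
  rcases Int.units_eq_one_or e with rfl | rfl
  · rw [hL.unique (isFan_fan hF hn p)]
  · rw [hL.unique ((isFan_fan hF hn p).reverse hF hn), consecSum_reverse]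
    intro a b
    rw [Finset.pair_comm]

/-- In the list of a fan, an element is followed by the next one in position. -/
theorem IsFan.split_next {G : SimpleGraph (ZMod n)} {p a b : ZMod n} {L M : List (ZMod n)}
    (hL : IsFan e x G p (L ++ a :: M)) (hb : InFan e x G p b) (hab : pos e x a < pos e x b)
    (hnone : ∀ c, InFan e x G p c → pos e x a < pos e x c → pos e x c < pos e x b → False) :
    ∃ M', M = b :: M' := by
  obtain ⟨h1, h2⟩ := hL
  rw [List.pairwise_append, List.pairwise_cons] at h1
  obtain ⟨-, ⟨h3, h4⟩, h5⟩ := h1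
  have hbM : b ∈ M := by
    have := (h2 b).2 hb
    simp only [List.mem_append, List.mem_cons] at this
    rcases this with h | rfl | h
    · have := h5 b h a (by simp)
      omega
    · omega
    · exact h
  cases M with
  | nil => simp at hbM
  | cons c M =>
    refine ⟨M, ?_⟩
    rcases List.mem_cons.1 hbM with rfl | h
    · rfl
    · rw [List.pairwise_cons] at h4
      exact (hnone c ((h2 c).1 (by simp)) (h3 c (by simp)) (h4.1 b h)).elim

/-- A list of the fan, split at two consecutive elements. -/
theorem IsFan.exists_split {G : SimpleGraph (ZMod n)} {p a b : ZMod n} {K : List (ZMod n)}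
    (hK : IsFan e x G p K) (ha : InFan e x G p a) (hb : InFan e x G p b)
    (hab : pos e x a < pos e x b)
    (hnone : ∀ c, InFan e x G p c → pos e x a < pos e x c → pos e x c < pos e x b → False) :
    ∃ L M, K = L ++ a :: b :: M := by
  obtain ⟨L, M, rfl⟩ := List.append_of_mem ((hK.2 a).2 ha)
  obtain ⟨M', rfl⟩ := hK.split_next hb hab hnone
  exact ⟨L, M', rfl⟩

/-- Consecutive elements of the list of a fan have nothing of the fan between them. -/
theorem IsFan.consecutive_of_infix {G : SimpleGraph (ZMod n)} {p a b : ZMod n}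
    {K : List (ZMod n)} (hK : IsFan e x G p K) (h : [a, b] <:+: K) :
    InFan e x G p a ∧ InFan e x G p b ∧ pos e x a < pos e x b ∧
      ∀ c, InFan e x G p c → pos e x a < pos e x c → pos e x c < pos e x b → False := by
  obtain ⟨L, M, rfl⟩ := h
  obtain ⟨h1, h2⟩ := hK
  rw [List.append_assoc, List.pairwise_append] at h1
  simp only [List.cons_append, List.nil_append, List.pairwise_cons] at h1
  refine ⟨(h2 a).1 (by simp), (h2 b).1 (by simp), h1.2.1.1 b (by simp), fun c hc h3 h4 => ?_⟩
  have := (h2 c).2 hc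
  simp only [List.mem_append, List.mem_cons, List.not_mem_nil, or_false] at this
  rcases this with (h | rfl | rfl) | h
  · have := h1.2.2 c h a (by simp); omega
  · omega
  · omega
  · have := h1.2.1.2.1 c h; omega

theorem borderTriangles_subset (hF : IsCluster F) (hn : 5 ≤ n) :
    borderTriangles x (linkGraph F x) ⊆ F := by
  rintro t ⟨p, q, r, -, h, rfl⟩
  obtain ⟨h1, h2, h3, h4⟩ := (isFan_fan hF hn p).consecutive_of_infix h
  exact h1.mem_of_consecutive hF hn h2 h3 h4

/-! ### Plücker relations -/

/-- The value of `v` at the alternating coordinate `x_{a,b,c}`. -/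
def coord (v : GrassmannRing n →ₐ[ℂ] ℂ) (a b c : ZMod n) : ℂ :=
  v (Ideal.Quotient.mk (pluckerIdeal n) (homCoord a b c))

theorem coord_eq {v : GrassmannRing n →ₐ[ℂ] ℂ} {a b c : ZMod n} (h : sbtw a b c) :
    coord v a b c = v (plucker {a, b, c}) := by
  have hc : ({a, b, c} : Finset (ZMod n)).card = 3 := card_triple_eq_three.2
    ⟨fun h' => by subst h'; exact sbtw_irrefl_left h,
      fun h' => by subst h'; exact sbtw_irrefl_left_right h,
      fun h' => by subst h'; exact sbtw_irrefl_right h⟩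
  unfold coord homCoord plucker
  rw [dif_pos hc, if_pos h, dif_pos hc]

theorem coord_eq_neg {v : GrassmannRing n →ₐ[ℂ] ℂ} {a b c : ZMod n} (h : sbtw a c b) :
    coord v a b c = - v (plucker {a, b, c}) := by
  have hc : ({a, b, c} : Finset (ZMod n)).card = 3 := card_triple_eq_three.2
    ⟨fun h' => by subst h'; exact sbtw_irrefl_left_right h,
      fun h' => by subst h'; exact sbtw_irrefl_left h,
      fun h' => by subst h'; exact sbtw_irrefl_right h⟩
  have h' : ¬ sbtw a b c := fun h1 => sbtw_asymm h h1.cyclic_left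
  unfold coord homCoord plucker
  rw [dif_pos hc, if_neg h', dif_pos hc, map_neg, map_neg]

theorem coord_eq_zero {v : GrassmannRing n →ₐ[ℂ] ℂ} {a b c : ZMod n} (h : a = b ∨ a = c ∨ b = c) :
    coord v a b c = 0 := by
  unfold coord homCoord
  rw [dif_neg, map_zero, map_zero]
  rw [card_triple_eq_three]
  tauto

theorem coord_rotate (v : GrassmannRing n →ₐ[ℂ] ℂ) (a b c : ZMod n) :
    coord v a b c = coord v b c a := by
  by_cases h : a = b ∨ a = c ∨ b = c
  · rw [coord_eq_zero h, coord_eq_zero (by tauto)]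
  · have hs : ({b, c, a} : Finset (ZMod n)) = {a, b, c} := by
      ext; simp; tauto
    have h1 : sbtw a b c ∨ sbtw a c b := by
      by_contra! h2
      have h3 := btw_iff_not_sbtw.2 h2.1
      have h4 := btw_iff_not_sbtw.2 h2.2
      have := h3.antisymm h4.cyclic_right
      tauto
    rcases h1 with h1 | h1
    · rw [coord_eq h1, coord_eq h1.cyclic_left, hs]
    · rw [coord_eq_neg h1, coord_eq_neg h1.cyclic_right, hs]

theorem coord_swap (v : GrassmannRing n →ₐ[ℂ] ℂ) (a b c : ZMod n) :
    coord v b a c = - coord v a b c := by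
  by_cases h : a = b ∨ a = c ∨ b = c
  · rw [coord_eq_zero h, coord_eq_zero (by tauto), neg_zero]
  · have hs : ({b, a, c} : Finset (ZMod n)) = {a, b, c} := Finset.insert_comm _ _ _
    have h1 : sbtw a b c ∨ sbtw a c b := by
      by_contra! h2
      have h3 := btw_iff_not_sbtw.2 h2.1
      have h4 := btw_iff_not_sbtw.2 h2.2
      have := h3.antisymm h4.cyclic_right
      tauto
    rcases h1 with h1 | h1
    · rw [coord_eq h1, coord_eq_neg h1.cyclic_left, hs]
    · rw [coord_eq_neg h1, coord_eq h1.cyclic_right, hs, neg_neg]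

/-- The defining Plücker relations. -/
theorem coord_relation (v : GrassmannRing n →ₐ[ℂ] ℂ) (a b c d y z : ZMod n) :
    coord v y z a * coord v b c d - coord v y z b * coord v a c d + coord v y z c * coord v a b d
      - coord v y z d * coord v a b c = 0 := by
  have h : v (Ideal.Quotient.mk (pluckerIdeal n) (pluckerRelation y z ![a, b, c, d])) = 0 := by
    have hm : pluckerRelation y z ![a, b, c, d] ∈ pluckerIdeal n :=
      Ideal.subset_span ⟨y, z, _, rfl⟩
    rw [Ideal.Quotient.eq_zero_iff_mem.2 hm, map_zero]
  simp only [pluckerRelation, Fin.sum_univ_four] at h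
  have e1 : (Fin.succAbove (0 : Fin 4) : Fin 3 → Fin 4) = ![1, 2, 3] := by decide
  have e2 : (Fin.succAbove (1 : Fin 4) : Fin 3 → Fin 4) = ![0, 2, 3] := by decide
  have e3 : (Fin.succAbove (2 : Fin 4) : Fin 3 → Fin 4) = ![0, 1, 3] := by decide
  have e4 : (Fin.succAbove (3 : Fin 4) : Fin 3 → Fin 4) = ![0, 1, 2] := by decide
  simp only [e1, e2, e3, e4] at h
  simp at h
  unfold coord
  linear_combination h

/-- The exchange relation of a mutation. -/
theorem exchange_relation (v : GrassmannRing n →ₐ[ℂ] ℂ) {z a b c d : ZMod n}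
    (hz : [z, a, b, c, d].Nodup) (h1 : sbtw a b c) (h2 : sbtw c d a) :
    v (plucker {z, a, c}) * v (plucker {z, b, d}) =
      v (plucker {z, a, b}) * v (plucker {z, c, d}) +
      v (plucker {z, b, c}) * v (plucker {z, d, a}) := by
  simp only [List.nodup_cons, List.mem_cons, List.not_mem_nil, or_false, not_or] at hz
  obtain ⟨⟨ha, hb, hc, hd⟩, -⟩ := hz
  have h := coord_relation v z b c d z a
  rw [coord_eq_zero (a := z) (b := a) (c := z) (by simp)] at h
  rw [sbtw_iff_pos z] at h1 h2
  have key (y w : ZMod n) (hy : z ≠ y) (h : pos 1 z y < pos 1 z w) : 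
      coord v z y w = v (plucker {z, y, w}) ∧ coord v z w y = - v (plucker {z, y, w}) := by
    have : sbtw z y w := by
      rw [sbtw_iff_pos z, pos_self]
      have := pos_pos (e := 1).2 (Ne.symm hy)
      omega
    rw [coord_eq this, coord_eq_neg this, Finset.pair_comm w y]
    simp
  have : (pos 1 z a < pos 1 z b ∧ pos 1 z b < pos 1 z c ∧ pos 1 z c < pos 1 z d) ∨
      (pos 1 z b < pos 1 z c ∧ pos 1 z c < pos 1 z d ∧ pos 1 z d < pos 1 z a) ∨
      (pos 1 z c < pos 1 z d ∧ pos 1 z d < pos 1 z a ∧ pos 1 z a < pos 1 z b) ∨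
      (pos 1 z d < pos 1 z a ∧ pos 1 z a < pos 1 z b ∧ pos 1 z b < pos 1 z c) := by omega
  rw [Finset.pair_comm d a]
  rcases this with ⟨h3, h4, h5⟩ | ⟨h3, h4, h5⟩ | ⟨h3, h4, h5⟩ | ⟨h3, h4, h5⟩
  · rw [(key a b ha (by omega)).1, (key a c ha (by omega)).1, (key a d ha (by omega)).1,
      (key c d hc (by omega)).1, (key b d hb (by omega)).1, (key b c hb (by omega)).1] at h
    linear_combination h
  · rw [(key b a hb (by omega)).2, (key c a hc (by omega)).2, (key d a hd (by omega)).2,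
      (key c d hc (by omega)).1, (key b d hb (by omega)).1, (key b c hb (by omega)).1] at h
    rw [Finset.pair_comm a b, Finset.pair_comm a c, Finset.pair_comm a d]
    linear_combination -h
  · rw [(key a b ha (by omega)).1, (key c a hc (by omega)).2, (key d a hd (by omega)).2,
      (key c d hc (by omega)).1, (key d b hd (by omega)).2, (key c b hc (by omega)).2] at h
    rw [Finset.pair_comm b c, Finset.pair_comm a c, Finset.pair_comm a d, Finset.pair_comm b d]
    linear_combination h
  · rw [(key a b ha (by omega)).1, (key a c ha (by omega)).1, (key d a hd (by omega)).2,
      (key d c hd (by omega)).2, (key d b hd (by omega)).2, (key b c hb (by omega)).1] at h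
    rw [Finset.pair_comm c d, Finset.pair_comm b d, Finset.pair_comm a d]
    linear_combination -h

/-! ### Removing an edge of the link by a mutation -/

/-- The mutation at `{x, p, q₂}`, where `q₁, q₂, q₃` are neighbours of `p` in the link of `x`. -/
theorem IsCluster.mutation_at_edge (hF : IsCluster F) {v : GrassmannRing n →ₐ[ℂ] ℂ} {c : ℂ}
    (hv : HasValueAt v F x c) {p q₁ q₂ q₃ : ZMod n} (h1 : (linkGraph F x).Adj p q₁)
    (h2 : (linkGraph F x).Adj p q₂) (h3 : (linkGraph F x).Adj p q₃) (h12 : {p, q₁, q₂} ∈ F)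
    (h23 : {p, q₂, q₃} ∈ F) (hlt : pos e x q₁ < pos e x q₂) (hlt' : pos e x q₂ < pos e x q₃)
    (hF' : F' = (F ∪ {{p, q₁, q₃}}) \ {{x, p, q₂}}) :
    IsMutation F F' ∧ IsCluster F' ∧ HasValueAt v F' x c ∧
      linkGraph F' x = (linkGraph F x).deleteEdges {s(p, q₂)} ∧
      v (plucker {p, q₁, q₃}) = v (plucker {p, q₁, q₂}) + v (plucker {p, q₂, q₃}) := by
  wlog he : e = 1 generalizing e q₁ q₃
  · have he' : e = -1 := (Int.units_eq_one_or e).resolve_left he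
    subst he'
    rw [Finset.pair_comm] at h12 h23
    rw [Finset.pair_comm q₁ q₃] at hF' ⊢
    obtain ⟨r1, r2, r3, r4, r5⟩ := this (e := 1) h3 h1 h23 h12
      ((pos_neg_lt_iff h2.2.2.1 h3.2.2.1).1 hlt') ((pos_neg_lt_iff h1.2.2.1 h2.2.2.1).1 hlt) hF' rfl
    refine ⟨r1, r2, r3, r4, ?_⟩
    rw [r5, add_comm, Finset.pair_comm q₂ q₁, Finset.pair_comm q₃ q₂]
  subst he
  have hpx := h1.2.1
  have n1 := h1.1
  have n2 := h2.1
  have n3 := h3.1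
  have x1 := h1.2.2.1
  have x2 := h2.2.2.1
  have x3 := h3.2.2.1
  have q12 := ne_of_pos_lt hlt
  have q23 := ne_of_pos_lt hlt'
  have q13 := ne_of_pos_lt (hlt.trans hlt')
  have hnodup : [p, x, q₁, q₂, q₃].Nodup := by
    simp only [List.nodup_cons, List.mem_cons, List.not_mem_nil, or_false, not_or]
    tauto
  have s1 : sbtw x q₁ q₂ := by
    rw [sbtw_iff_pos x, pos_self]
    have := pos_pos (e := 1).2 x1
    omega
  have s2 : sbtw q₂ q₃ x := by
    rw [sbtw_iff_pos x, pos_self]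
    have := pos_pos (e := 1).2 x2
    omega
  have hxn : x ∉ ({p, q₁, q₃} : Finset (ZMod n)) := by simp; tauto
  have m1 : {p, x, q₁} ∈ F := by rw [Finset.insert_comm]; exact h1.2.2.2
  have m2 : {p, x, q₂} ∈ F := by rw [Finset.insert_comm]; exact h2.2.2.2
  have m3 : {p, q₃, x} ∈ F := by rw [Finset.pair_comm, Finset.insert_comm]; exact h3.2.2.2
  have hne : ({p, q₁, q₃} : Finset (ZMod n)) ≠ {x, p, q₂} := fun h => hxn (h ▸ by simp)
  have hmut : IsMutation F F' := by
    refine ⟨p, x, q₁, q₂, q₃, hnodup, s1, s2, m1, h12, h23, m3, m2, ?_⟩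
    rw [hF', Finset.insert_comm p x]
    ext t
    simp only [Set.mem_sdiff, Set.mem_union, Set.mem_singleton_iff, Set.mem_insert_iff]
    constructor
    · tauto
    · rintro (rfl | h)
      · exact ⟨Or.inr rfl, hne⟩
      · tauto
  have hval : HasValueAt v F' x c := by
    refine ⟨hv.1, fun t ht hxt => hv.2 t ?_ hxt⟩
    rw [hF'] at ht
    rcases ht.1 with h | h
    · exact h
    · rw [Set.mem_singleton_iff] at h
      subst h
      exact (hxn hxt).elim
  refine ⟨hmut, hmut.isCluster hF, hval, ?_, ?_⟩
  · ext a b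
    rw [SimpleGraph.deleteEdges_adj, (hmut.isCluster hF).linkGraph_adj, hF', hF.linkGraph_adj]
    have key : ({x, a, b} : Finset (ZMod n)) ≠ {p, q₁, q₃} := fun h => hxn (h ▸ by simp)
    simp only [Set.mem_sdiff, Set.mem_union, Set.mem_singleton_iff, key, or_false]
    refine and_congr_right fun hab => not_congr ?_
    have hab' := hF.linkGraph_adj.2 hab
    rw [Sym2.eq_iff]
    constructor
    · intro h
      have ha : a ∈ ({x, p, q₂} : Finset (ZMod n)) := h ▸ by simp
      have hb : b ∈ ({x, p, q₂} : Finset (ZMod n)) := h ▸ by simp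
      simp only [Finset.mem_insert, Finset.mem_singleton] at ha hb
      have := hab'.1
      have := hab'.2.1
      have := hab'.2.2.1
      rcases ha with rfl | rfl | rfl <;> rcases hb with rfl | rfl | rfl <;> tauto
    · rintro (⟨rfl, rfl⟩ | ⟨rfl, rfl⟩)
      · rfl
      · rw [Finset.pair_comm]
  · -- in the exchange relation the three triangles at `x` take the same nonzero value
    have hr := exchange_relation v hnodup s1 s2
    rw [hv.2 _ m1 (by simp), hv.2 _ m2 (by simp), hv.2 _ m3 (by simp)] at hr
    have := hv.1
    apply mul_left_cancel₀ this
    linear_combination hr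

/-- The predecessor of `q` in a fan. -/
theorem InFan.exists_pred {G : SimpleGraph (ZMod n)} {p q r : ZMod n} (hr : InFan e x G p r)
    (h : pos e x r < pos e x q) :
    ∃ q₁, InFan e x G p q₁ ∧ pos e x q₁ < pos e x q ∧
      ∀ b, InFan e x G p b → pos e x q₁ < pos e x b → pos e x b < pos e x q → False := by
  obtain ⟨a, ⟨h1, h2⟩, h3⟩ := exists_pos_max e x
    (S := fun r => InFan e x G p r ∧ pos e x r < pos e x q) ⟨r, hr, h⟩
  refine ⟨a, h1, h2, fun b hb h4 h5 => ?_⟩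
  have := h3 b ⟨hb, h5⟩
  omega

/-- A leaf other than `x ± 2` is removed from the link by a mutation. -/
theorem IsLeafAt.exists_mutation (hF : IsCluster F) (hn : 5 ≤ n) {v : GrassmannRing n →ₐ[ℂ] ℂ}
    {c : ℂ} (hv : HasValueAt v F x c) {p q₂ : ZMod n} (h : IsLeafAt (linkGraph F x) p q₂)
    (hq : q₂ ≠ x + 2) (hq' : q₂ ≠ x - 2) :
    ∃ (q₁ q₃ : ZMod n) (F' : Set (Finset (ZMod n))) (L M : List (ZMod n)),
      fan x (linkGraph F x) p = L ++ q₁ :: q₂ :: q₃ :: M ∧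
      F' = (F ∪ {{p, q₁, q₃}}) \ {{x, p, q₂}} ∧
      IsMutation F F' ∧ IsCluster F' ∧ HasValueAt v F' x c ∧
      linkGraph F' x = (linkGraph F x).deleteEdges {s(p, q₂)} ∧
      v (plucker {p, q₁, q₃}) = v (plucker {p, q₁, q₂}) + v (plucker {p, q₂, q₃}) := by
  have hfan : InFan 1 x (linkGraph F x) p q₂ := Or.inl h
  obtain ⟨r, hr, hrq⟩ := h.exists_inFan_lt (e := 1) hF hn (by simpa [pt] using hq)
  obtain ⟨s, hs, hsq⟩ := h.exists_inFan_lt (e := -1) hF hn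
    (by simpa [pt, ← sub_eq_add_neg] using hq')
  obtain ⟨q₁, h1, hlt1, hn1⟩ := hr.exists_pred hrq
  obtain ⟨q₃, h3, hlt3, hn3⟩ := hs.exists_pred hsq
  rw [inFan_neg] at h3
  have h2a := (hfan.adj hF hn).2.2.1
  have h3a := (h3.adj hF hn).2.2.1
  rw [pos_neg_lt_iff h3a h2a] at hlt3
  have hn3' : ∀ b, InFan 1 x (linkGraph F x) p b → pos 1 x q₂ < pos 1 x b →
      pos 1 x b < pos 1 x q₃ → False := fun b hb h4 h5 =>
    hn3 b (inFan_neg.2 hb) ((pos_neg_lt_iff h3a (hb.adj hF hn).2.2.1).2 h5)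
      ((pos_neg_lt_iff (hb.adj hF hn).2.2.1 h2a).2 h4)
  have hK := isFan_fan hF hn (x := x) p
  obtain ⟨L, M, hL⟩ := hK.exists_split h1 hfan hlt1 hn1
  rw [hL] at hK
  have hK' : IsFan 1 x (linkGraph F x) p ((L ++ [q₁]) ++ q₂ :: M) := by simpa using hK
  obtain ⟨M', rfl⟩ := hK'.split_next h3 hlt3 hn3'
  exact ⟨q₁, q₃, _, L, M', hL, rfl, hF.mutation_at_edge hv (h1.adj hF hn) (hfan.adj hF hn)
    (h3.adj hF hn) (h1.mem_of_consecutive hF hn hfan hlt1 hn1)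
    (hfan.mem_of_consecutive hF hn h3 hlt3 hn3') hlt1 hlt3 rfl⟩

/-- The neighbours of a triangulation point of degree two other than `x ± 1`. -/
theorem exists_neighbours_of_deg_two (hF : IsCluster F) (hn : 5 ≤ n) {p : ZMod n}
    (h : deg (linkGraph F x) p = 2) (hp1 : p ≠ pt e x 1) (hp2 : p ≠ pt (-e) x 1) :
    ∃ p₀ p₁, NextTri e x (linkGraph F x) p₀ p ∧ NextTri e x (linkGraph F x) p p₁ ∧
      (linkGraph F x).Adj p₀ p₁ ∧ {p, p₀, p₁} ∈ F ∧
      ∀ b, (linkGraph F x).Adj p b ↔ b = p₀ ∨ b = p₁ := by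
  have hp : IsTriPoint (linkGraph F x) p := h.ge
  obtain ⟨p₀, h0⟩ := hF.exists_prevTri hn hp hp1
  obtain ⟨p₁, h1⟩ := hF.exists_nextTri hn hp hp2
  have a0 := (h0.adj hF hn).symm
  have a1 := h1.adj hF hn
  have hlt := h0.2.2.1
  have hlt' := h1.2.2.1
  have hall : ∀ b, (linkGraph F x).Adj p b ↔ b = p₀ ∨ b = p₁ := by
    obtain ⟨a, b, hab, hc⟩ := deg_eq_two_iff.1 h
    have e0 := (hc p₀).1 a0
    have e1 := (hc p₁).1 a1
    have hne : p₀ ≠ p₁ := ne_of_pos_lt (hlt.trans hlt')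
    intro y
    rw [hc]
    rcases e0 with rfl | rfl <;> rcases e1 with rfl | rfl <;> tauto
  refine ⟨p₀, p₁, h0, h1, ?_, ?_, hall⟩
  · refine hF.adj_first_last (e := e) a0 a1 hlt hlt' (fun b hb => ?_) fun b hb => ?_ <;>
    · rcases (hall b).1 hb with rfl | rfl <;> omega
  · refine hF.adj_pred_succ (e := e) a0 a1 hlt hlt' fun b hb h3 h4 => ?_
    rcases (hall b).1 hb with rfl | rfl <;> omega

/-- At a triangulation point `p` of degree two, the edge towards `p₀` is removed by a mutation,
unless `p = x + 2e`. -/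
theorem exists_mutation_of_deg_two (hF : IsCluster F) (hn : 5 ≤ n) {v : GrassmannRing n →ₐ[ℂ] ℂ}
    {c : ℂ} (hv : HasValueAt v F x c) {p p₀ p₁ : ZMod n}
    (h0 : NextTri e x (linkGraph F x) p₀ p) (h1 : NextTri e x (linkGraph F x) p p₁)
    (h01 : (linkGraph F x).Adj p₀ p₁) (hT : {p, p₀, p₁} ∈ F) (hp : p ≠ pt e x 2) :
    ∃ (q₁ : ZMod n) (F' : Set (Finset (ZMod n))) (L : List (ZMod n)),
      IsFan e x (linkGraph F x) p₀ (L ++ [q₁, p]) ∧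
      F' = (F ∪ {{q₁, p₀, p₁}}) \ {{x, p₀, p}} ∧
      IsMutation F F' ∧ IsCluster F' ∧ HasValueAt v F' x c ∧
      linkGraph F' x = (linkGraph F x).deleteEdges {s(p₀, p)} ∧
      v (plucker {q₁, p₀, p₁}) = v (plucker {q₁, p₀, p}) + v (plucker {p₀, p, p₁}) := by
  have hfan : InFan e x (linkGraph F x) p₀ p := Or.inr (Or.inr h0)
  have hlt := h0.2.2.1
  have hr : ∃ r, InFan e x (linkGraph F x) p₀ r ∧ pos e x r < pos e x p := by
    by_cases hp0 : p₀ = pt e x 1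
    · have b1 := pos_pt (e := e) (x := x) (k := 1) (by omega : 1 < n)
      have b2 := pos_pt (e := e) (x := x) (k := 2) (by omega : 2 < n)
      have h3 : pos e x p ≠ 2 := fun h3 => hp (pos_inj.1 (by rw [h3, b2]))
      have hadj := hF.adj_pt_one_pt_two (by omega) e x
      rw [← hp0] at b1 hadj
      refine ⟨pt e x 2, ?_, by omega⟩
      rcases isTriPoint_or_isLeafAt h0.1 hadj with h4 | h4
      · exact Or.inr (Or.inr ⟨h0.1, h4, by omega, fun r _ _ _ => by omega⟩)
      · exact Or.inl h4
    · obtain ⟨P, hP⟩ := hF.exists_prevTri hn h0.1 hp0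
      exact ⟨P, Or.inr (Or.inl hP), hP.2.2.1.trans hlt⟩
  obtain ⟨r, hr, hrp⟩ := hr
  obtain ⟨q₁, hq, hlt1, hn1⟩ := hr.exists_pred hrp
  obtain ⟨K, hK⟩ := exists_isFan hF hn (x := x) e p₀
  obtain ⟨L, M, rfl⟩ := hK.exists_split hq hfan hlt1 hn1
  have hM : M = [] := by
    rw [List.eq_nil_iff_forall_not_mem]
    intro y hy
    have h2 := ((hK.2 y).1 (by simp [hy])).le_next hF hn h0
    have h3 := hK.1
    rw [List.pairwise_append, List.pairwise_cons, List.pairwise_cons] at h3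
    have := h3.2.1.2.1 y hy
    omega
  subst hM
  refine ⟨q₁, _, L, hK, rfl, ?_⟩
  rw [Finset.insert_comm q₁ p₀ {p₁}, Finset.insert_comm q₁ p₀ {p}]
  refine hF.mutation_at_edge hv (hq.adj hF hn) (hfan.adj hF hn) h01
    (hq.mem_of_consecutive hF hn hfan hlt1 hn1) ?_ hlt1 h1.2.2.1 rfl
  rwa [Finset.insert_comm]

/-! ### The effect of removing an edge on the border sums -/

theorem linkGraph_deleteEdges_adj {G G' : SimpleGraph (ZMod n)} {p q : ZMod n}
    (hG : G' = G.deleteEdges {s(p, q)}) {a b : ZMod n} :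
    G'.Adj a b ↔ G.Adj a b ∧ ¬ (a = p ∧ b = q ∨ a = q ∧ b = p) := by
  rw [hG, SimpleGraph.deleteEdges_adj, Set.mem_singleton_iff, Sym2.eq_iff]

theorem deg_deleteEdges {G G' : SimpleGraph (ZMod n)} {p q : ZMod n}
    (hG : G' = G.deleteEdges {s(p, q)}) {y : ZMod n} (hp : y ≠ p) (hq : y ≠ q) :
    deg G' y = deg G y := by
  unfold deg
  congr 1
  ext a
  rw [SimpleGraph.mem_neighborSet, SimpleGraph.mem_neighborSet, linkGraph_deleteEdges_adj hG]
  tauto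

section Leaf

variable {G G' : SimpleGraph (ZMod n)} {p q : ZMod n}

theorem IsLeafAt.isTriPoint_deleteEdges (h : IsLeafAt G p q)
    (hG : G' = G.deleteEdges {s(p, q)}) (hp : IsTriPoint G' p) (y : ZMod n) :
    IsTriPoint G' y ↔ IsTriPoint G y := by
  by_cases hyp : y = p
  · subst hyp
    exact ⟨fun _ => h.1, fun _ => hp⟩
  · by_cases hyq : y = q
    · subst hyq
      refine ⟨fun hy => ?_, fun hy => (h.not_isTriPoint hy).elim⟩
      obtain ⟨a, b, hab, ha, hb⟩ := isTriPoint_iff.1 hy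
      rw [linkGraph_deleteEdges_adj hG] at ha hb
      exact (hab ((h.eq ha.1).trans (h.eq hb.1).symm)).elim
    · unfold IsTriPoint
      rw [deg_deleteEdges hG hyp hyq]

theorem IsLeafAt.isLeafAt_deleteEdges (h : IsLeafAt G p q)
    (hG : G' = G.deleteEdges {s(p, q)}) (hp : IsTriPoint G' p) (a b : ZMod n) :
    IsLeafAt G' a b ↔ IsLeafAt G a b ∧ ¬ (a = p ∧ b = q) := by
  by_cases hbq : b = q
  · subst hbq
    refine ⟨fun h1 => ?_, fun h1 => (h1.2 ⟨h.eq h1.1.2.1.symm, rfl⟩).elim⟩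
    have h2 := (linkGraph_deleteEdges_adj hG).1 h1.2.1
    exact (h2.2 (Or.inl ⟨h.eq h2.1.symm, rfl⟩)).elim
  · by_cases hbp : b = p
    · subst hbp
      exact ⟨fun h1 => (h1.not_isTriPoint hp).elim, fun h1 => (h1.1.not_isTriPoint h.1).elim⟩
    · unfold IsLeafAt
      rw [h.isTriPoint_deleteEdges hG hp, linkGraph_deleteEdges_adj hG, deg_deleteEdges hG hbp hbq]
      tauto

theorem IsLeafAt.inFan_deleteEdges (h : IsLeafAt G p q)
    (hG : G' = G.deleteEdges {s(p, q)}) (hp : IsTriPoint G' p) (a b : ZMod n) :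
    InFan e x G' a b ↔ InFan e x G a b ∧ ¬ (a = p ∧ b = q) := by
  have hN (a b) : NextTri e x G' a b ↔ NextTri e x G a b := by
    unfold NextTri
    simp only [h.isTriPoint_deleteEdges hG hp]
  unfold InFan
  rw [h.isLeafAt_deleteEdges hG hp, hN, hN]
  have h1 : NextTri e x G a b → b ≠ q := fun h1 h2 => h.not_isTriPoint (h2 ▸ h1.2.1)
  have h2 : NextTri e x G b a → b ≠ q := fun h1 h2 => h.not_isTriPoint (h2 ▸ h1.1)
  tauto

end Leaf

/-- Removing a leaf by a mutation does not change the border sums, since the values of two border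
triangles are replaced by their sum. -/
theorem IsLeafAt.borderSum_deleteEdges (hF : IsCluster F) (hF' : IsCluster F') (hn : 5 ≤ n)
    {p q₁ q₂ q₃ : ZMod n} {L M : List (ZMod n)} (h : IsLeafAt (linkGraph F x) p q₂)
    (hfan : fan x (linkGraph F x) p = L ++ q₁ :: q₂ :: q₃ :: M)
    (hG : linkGraph F' x = (linkGraph F x).deleteEdges {s(p, q₂)})
    {w : Finset (ZMod n) → ℂ} (hw : w {p, q₁, q₃} = w {p, q₁, q₂} + w {p, q₂, q₃}) :
    IsTriPoint (linkGraph F' x) p ∧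
      ∀ y, borderSum x (linkGraph F' x) w y = borderSum x (linkGraph F x) w y := by
  have hK := isFan_fan hF hn (x := x) p
  rw [hfan] at hK
  have hs := hK.1
  have hmem := hK.2
  simp only [List.pairwise_append, List.pairwise_cons, List.mem_cons, List.mem_append] at hs hmem
  have hlt1 : pos 1 x q₁ < pos 1 x q₂ := hs.2.1.1 q₂ (by simp)
  have hlt2 : pos 1 x q₂ < pos 1 x q₃ := hs.2.1.2.1 q₃ (by simp)
  have a1 := ((hmem q₁).1 (by simp)).adj hF hn
  have a3 := ((hmem q₃).1 (by simp)).adj hF hn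
  have hp : IsTriPoint (linkGraph F' x) p := by
    refine isTriPoint_iff.2 ⟨q₁, q₃, ne_of_pos_lt (hlt1.trans hlt2), ?_, ?_⟩ <;>
    rw [linkGraph_deleteEdges_adj hG]
    · have := ne_of_pos_lt hlt1
      have := h.2.1.1
      tauto
    · have := ne_of_pos_lt hlt2
      have := h.2.1.1
      tauto
  refine ⟨hp, fun y => ?_⟩
  have hI := h.inFan_deleteEdges (e := 1) (x := x) hG hp
  by_cases hy : y = p
  · subst hy
    have hK' : IsFan 1 x (linkGraph F' x) y (L ++ q₁ :: q₃ :: M) := by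
      refine ⟨hK.1.sublist (List.Sublist.append_left ((List.sublist_cons_self _ _).cons_cons _) _),
        fun b => ?_⟩
      rw [hI, ← hmem]
      simp only [List.mem_append, List.mem_cons]
      have r1 : b ∈ L → b ≠ q₂ := fun hb => ne_of_pos_lt (hs.2.2 b hb q₂ (by simp))
      have r2 : b ∈ M → b ≠ q₂ := fun hb => (ne_of_pos_lt (hs.2.1.2.1 b (by simp [hb]))).symm
      have r3 : b = q₁ → b ≠ q₂ := fun hb => hb ▸ ne_of_pos_lt hlt1
      have r4 : b = q₃ → b ≠ q₂ := fun hb => hb ▸ (ne_of_pos_lt hlt2).symm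
      constructor
      · rintro (h | h | h | h)
        · exact ⟨Or.inl h, fun h' => r1 h h'.2⟩
        · exact ⟨Or.inr (Or.inl h), fun h' => r3 h h'.2⟩
        · exact ⟨Or.inr (Or.inr (Or.inr (Or.inl h))), fun h' => r4 h h'.2⟩
        · exact ⟨Or.inr (Or.inr (Or.inr (Or.inr h))), fun h' => r2 h h'.2⟩
      · rintro ⟨h | h | h | h | h, h'⟩
        · exact Or.inl h
        · exact Or.inr (Or.inl h)
        · exact (h' ⟨trivial, h⟩).elim
        · exact Or.inr (Or.inr (Or.inl h))
        · exact Or.inr (Or.inr (Or.inr h))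
    rw [hK'.borderSum_eq hF' hn, hK.borderSum_eq hF hn, consecSum_append _ L (q₃ :: M),
      consecSum_append _ L (q₂ :: q₃ :: M)]
    simp only [consecSum_cons_cons, hw]
    ring
  · obtain ⟨K, hK⟩ := exists_isFan hF hn (x := x) 1 y
    have hK' : IsFan 1 x (linkGraph F' x) y K := ⟨hK.1, fun b => by
      rw [hK.2, hI, and_iff_left fun h => hy h.1]⟩
    rw [hK.borderSum_eq hF hn, hK'.borderSum_eq hF' hn]

section DegTwo

variable {G G' : SimpleGraph (ZMod n)} {p p₀ p₁ : ZMod n}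

theorem isTriPoint_deleteEdges_of_deg_two (h0 : NextTri e x G p₀ p)
    (hall : ∀ b, G.Adj p b ↔ b = p₀ ∨ b = p₁) (hp0 : IsTriPoint G' p₀)
    (hG : G' = G.deleteEdges {s(p₀, p)}) (y : ZMod n) :
    IsTriPoint G' y ↔ IsTriPoint G y ∧ y ≠ p := by
  have hne : p₀ ≠ p := ne_of_pos_lt h0.2.2.1
  by_cases hy0 : y = p₀
  · subst hy0
    exact ⟨fun _ => ⟨h0.1, hne⟩, fun _ => hp0⟩
  · by_cases hyp : y = p
    · subst hyp
      refine ⟨fun hy => ?_, fun hy => (hy.2 rfl).elim⟩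
      obtain ⟨a, b, hab, ha, hb⟩ := isTriPoint_iff.1 hy
      rw [linkGraph_deleteEdges_adj hG, hall] at ha hb
      have ha' : a = p₁ := by tauto
      have hb' : b = p₁ := by tauto
      exact (hab (ha'.trans hb'.symm)).elim
    · unfold IsTriPoint
      rw [deg_deleteEdges hG hy0 hyp]
      tauto

/-- After the removal of `{p₀, p}`, the point `p` of degree two has become a leaf in `p₁`. -/
theorem isLeafAt_deleteEdges_of_deg_two (h0 : NextTri e x G p₀ p) (h1 : NextTri e x G p p₁)
    (hall : ∀ b, G.Adj p b ↔ b = p₀ ∨ b = p₁) (hp0 : IsTriPoint G' p₀)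
    (hG : G' = G.deleteEdges {s(p₀, p)}) (a b : ZMod n) :
    IsLeafAt G' a b ↔ IsLeafAt G a b ∨ a = p₁ ∧ b = p := by
  have hT := isTriPoint_deleteEdges_of_deg_two h0 hall hp0 hG
  have hne : p₀ ≠ p := ne_of_pos_lt h0.2.2.1
  have hne1 : p ≠ p₁ := ne_of_pos_lt h1.2.2.1
  have hne01 : p₀ ≠ p₁ := ne_of_pos_lt (h0.2.2.1.trans h1.2.2.1)
  have hG' {a b : ZMod n} := linkGraph_deleteEdges_adj hG (a := a) (b := b)
  by_cases hbp : b = p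
  · subst hbp
    constructor
    · intro h
      have h2 := hG'.1 h.2.1
      have h3 := (hall a).1 h2.1.symm
      right
      tauto
    · rintro (h | ⟨rfl, -⟩)
      · exact (h.not_isTriPoint h0.2.1).elim
      · refine ⟨(hT a).2 ⟨h1.2.1, hne1.symm⟩, ?_, ?_⟩
        · rw [hG']
          exact ⟨((hall a).2 (Or.inr rfl)).symm, by tauto⟩
        · rw [deg_eq_one_iff]
          refine ⟨a, fun c => ?_⟩
          rw [hG', hall]
          constructor
          · tauto
          · rintro rfl; tauto
  · by_cases hb0 : b = p₀
    · subst hb0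
      refine ⟨fun h => (h.not_isTriPoint hp0).elim, ?_⟩
      rintro (h | h)
      · exact (h.not_isTriPoint h0.1).elim
      · exact (hbp h.2).elim
    · unfold IsLeafAt
      rw [hT, hG', deg_deleteEdges hG hb0 hbp]
      constructor
      · tauto
      · rintro (⟨h2, h3, h4⟩ | h)
        · refine ⟨⟨h2, ?_⟩, ⟨h3, by tauto⟩, h4⟩
          rintro rfl
          rcases (hall b).1 h3 with rfl | rfl
          · exact hb0 rfl
          · have := h1.2.1
            unfold IsTriPoint at this
            omega
        · exact (hbp h.2).elim

/-- After the removal of `{p₀, p}`, the point `p` is no triangulation point any more, so that `p₁`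
follows `p₀`. -/
theorem nextTri_deleteEdges_of_deg_two (h0 : NextTri e x G p₀ p) (h1 : NextTri e x G p p₁)
    (hall : ∀ b, G.Adj p b ↔ b = p₀ ∨ b = p₁) (hp0 : IsTriPoint G' p₀)
    (hG : G' = G.deleteEdges {s(p₀, p)}) (a b : ZMod n) :
    NextTri e x G' a b ↔ NextTri e x G a b ∧ a ≠ p ∧ b ≠ p ∨ a = p₀ ∧ b = p₁ := by
  have hT := isTriPoint_deleteEdges_of_deg_two h0 hall hp0 hG
  have hlt := h0.2.2.1
  have hlt' := h1.2.2.1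
  unfold NextTri
  simp only [hT]
  constructor
  · rintro ⟨⟨ha, hap⟩, ⟨hb, hbp⟩, hab, hnone⟩
    have hap' : pos e x a ≠ pos e x p := fun h => hap (pos_inj.1 h)
    have hbp' : pos e x b ≠ pos e x p := fun h => hbp (pos_inj.1 h)
    by_cases hpb : pos e x a < pos e x p ∧ pos e x p < pos e x b
    · right
      have e1 : pos e x a = pos e x p₀ := by
        rcases lt_trichotomy (pos e x a) (pos e x p₀) with h | h | h
        · exact (hnone p₀ ⟨h0.1, ne_of_pos_lt hlt⟩ h (by omega)).elim
        · exact h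
        · exact (h0.2.2.2 a ha h hpb.1).elim
      have e2 : pos e x b = pos e x p₁ := by
        rcases lt_trichotomy (pos e x b) (pos e x p₁) with h | h | h
        · exact (h1.2.2.2 b hb hpb.2 h).elim
        · exact h
        · exact (hnone p₁ ⟨h1.2.1, (ne_of_pos_lt hlt').symm⟩ (by omega) h).elim
      exact ⟨pos_inj.1 e1, pos_inj.1 e2⟩
    · left
      refine ⟨⟨ha, hb, hab, fun r hr h2 h3 => hnone r ⟨hr, ?_⟩ h2 h3⟩, hap, hbp⟩
      rintro rfl
      exact hpb ⟨h2, h3⟩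
  · rintro (⟨⟨ha, hb, hab, hnone⟩, hap, hbp⟩ | ⟨rfl, rfl⟩)
    · exact ⟨⟨ha, hap⟩, ⟨hb, hbp⟩, hab, fun r hr => hnone r hr.1⟩
    · refine ⟨⟨h0.1, ne_of_pos_lt hlt⟩, ⟨h1.2.1, (ne_of_pos_lt hlt').symm⟩, hlt.trans hlt',
        fun r hr h2 h3 => ?_⟩
      rcases lt_trichotomy (pos e x r) (pos e x p) with h | h | h
      · exact h0.2.2.2 r hr.1 h2 h
      · exact hr.2 (pos_inj.1 h)
      · exact h1.2.2.2 r hr.1 h h3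

end DegTwo

/-- The border sum at a triangulation point of degree two. -/
theorem borderSum_of_deg_two (hF : IsCluster F) (hn : 5 ≤ n) {p p₀ p₁ : ZMod n}
    (h0 : NextTri e x (linkGraph F x) p₀ p) (h1 : NextTri e x (linkGraph F x) p p₁)
    (hall : ∀ b, (linkGraph F x).Adj p b ↔ b = p₀ ∨ b = p₁) (w : Finset (ZMod n) → ℂ) :
    borderSum x (linkGraph F x) w p = w {p, p₀, p₁} := by
  have hK : IsFan e x (linkGraph F x) p [p₀, p₁] := by
    refine ⟨by simpa using h0.2.2.1.trans h1.2.2.1, fun b => ?_⟩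
    simp only [List.mem_cons, List.not_mem_nil, or_false]
    constructor
    · rintro (rfl | rfl)
      · exact Or.inr (Or.inl h0)
      · exact Or.inr (Or.inr h1)
    · exact fun h => (hall b).1 (h.adj hF hn)
  rw [hK.borderSum_eq hF hn, consecSum_cons_cons, consecSum_singleton, add_zero]

/-- Removing an edge at a triangulation point `p` of degree two by a mutation adds the value of
its border triangle to the border sums at its neighbours. -/
theorem borderSum_deleteEdges_of_deg_two (hF : IsCluster F) (hF' : IsCluster F') (hn : 5 ≤ n)
    {p p₀ p₁ q₁ : ZMod n} {L : List (ZMod n)}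
    (h0 : NextTri e x (linkGraph F x) p₀ p) (h1 : NextTri e x (linkGraph F x) p p₁)
    (h01 : (linkGraph F x).Adj p₀ p₁)
    (hall : ∀ b, (linkGraph F x).Adj p b ↔ b = p₀ ∨ b = p₁)
    (hfan : IsFan e x (linkGraph F x) p₀ (L ++ [q₁, p]))
    (hG : linkGraph F' x = (linkGraph F x).deleteEdges {s(p₀, p)})
    {w : Finset (ZMod n) → ℂ} (hw : w {q₁, p₀, p₁} = w {q₁, p₀, p} + w {p₀, p, p₁}) :
    IsTriPoint (linkGraph F' x) p₀ ∧
      borderSum x (linkGraph F' x) w p₀ =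
        borderSum x (linkGraph F x) w p₀ + borderSum x (linkGraph F x) w p ∧
      borderSum x (linkGraph F' x) w p₁ =
        borderSum x (linkGraph F x) w p₁ + borderSum x (linkGraph F x) w p ∧
      ∀ y, y ≠ p → y ≠ p₀ → y ≠ p₁ →
        borderSum x (linkGraph F' x) w y = borderSum x (linkGraph F x) w y := by
  have hlt := h0.2.2.1
  have hlt' := h1.2.2.1
  have hne : p₀ ≠ p := ne_of_pos_lt hlt
  have hne1 : p ≠ p₁ := ne_of_pos_lt hlt'
  have hne01 : p₀ ≠ p₁ := ne_of_pos_lt (hlt.trans hlt')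
  have hs := hfan.1
  have hmem := hfan.2
  simp only [List.pairwise_append, List.pairwise_cons, List.mem_cons, List.mem_append,
    List.not_mem_nil, or_false] at hs hmem
  have hqp : pos e x q₁ < pos e x p := hs.2.1.1 p rfl
  have hq := (hmem q₁).1 (by simp)
  have hp0 : IsTriPoint (linkGraph F' x) p₀ := by
    refine isTriPoint_iff.2 ⟨q₁, p₁, ne_of_pos_lt (hqp.trans hlt'), ?_, ?_⟩ <;>
    rw [linkGraph_deleteEdges_adj hG]
    · refine ⟨hq.adj hF hn, ?_⟩
      have := ne_of_pos_lt hqp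
      tauto
    · exact ⟨h01, by tauto⟩
  have hI (a b : ZMod n) : InFan e x (linkGraph F' x) a b ↔
      IsLeafAt (linkGraph F x) a b ∨ a = p₁ ∧ b = p ∨
      NextTri e x (linkGraph F x) b a ∧ b ≠ p ∧ a ≠ p ∨ b = p₀ ∧ a = p₁ ∨
      NextTri e x (linkGraph F x) a b ∧ a ≠ p ∧ b ≠ p ∨ a = p₀ ∧ b = p₁ := by
    unfold InFan
    rw [isLeafAt_deleteEdges_of_deg_two h0 h1 hall hp0 hG,
      nextTri_deleteEdges_of_deg_two h0 h1 hall hp0 hG,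
      nextTri_deleteEdges_of_deg_two h0 h1 hall hp0 hG]
    simp only [or_assoc]
  have hpl (a : ZMod n) : ¬ IsLeafAt (linkGraph F x) a p := fun h => h.not_isTriPoint h0.2.1
  have hnext (b : ZMod n) (h : NextTri e x (linkGraph F x) p₀ b) : b = p := h.unique h0
  have hprev (b : ZMod n) (h : NextTri e x (linkGraph F x) b p₁) : b = p := h.unique_left h1
  have hpp0 : ¬ NextTri e x (linkGraph F x) p p₀ := fun h => by
    have := h.2.2.1; omega
  have hpp1 : ¬ NextTri e x (linkGraph F x) p₁ p := fun h => by
    have := h.2.2.1; omega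
  refine ⟨hp0, ?_, ?_, ?_⟩
  · -- in the fan of `p₀` the last element `p` is replaced by `p₁`
    have hK' : IsFan e x (linkGraph F' x) p₀ (L ++ [q₁, p₁]) := by
      constructor
      · simp only [List.pairwise_append, List.pairwise_cons, List.mem_cons, List.not_mem_nil,
          or_false]
        refine ⟨hs.1, ⟨fun b hb => hb ▸ hqp.trans hlt', by simp⟩, ?_⟩
        rintro a ha b (rfl | rfl)
        · exact hs.2.2 a ha b (by simp)
        · exact (hs.2.2 a ha p (by simp)).trans hlt'
      · intro b
        rw [hI]
        have h2 := hmem b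
        unfold InFan at h2
        have r1 : b ∈ L → b ≠ p := fun hb => ne_of_pos_lt (hs.2.2 b hb p (by simp))
        have r2 : b = q₁ → b ≠ p := fun hb => hb ▸ ne_of_pos_lt hqp
        have r3 : IsLeafAt (linkGraph F x) p₀ b → b ≠ p := fun hb h => hpl _ (h ▸ hb)
        have r4 := hnext b
        have r5 : NextTri e x (linkGraph F x) b p₀ → b ≠ p := fun hb h => hpp0 (h ▸ hb)
        simp only [List.mem_append, List.mem_cons, List.not_mem_nil, or_false]
        constructor
        · intro h
          by_cases hb : b = p₁
          · simp [hb]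
          have h3 : b ≠ p := by
            rcases h with h | h | h
            exacts [r1 h, r2 h, (hb h).elim]
          rcases h2.1 (by
            rcases h with h | h | h
            exacts [Or.inl h, Or.inr (Or.inl h), (hb h).elim]) with h4 | h4 | h4
          · exact Or.inl h4
          · exact Or.inr (Or.inr (Or.inl ⟨h4, h3, hne⟩))
          · exact (h3 (r4 h4)).elim
        · have aux (h : b ∈ L ∨ b = q₁ ∨ b = p) (h' : b ≠ p) : b ∈ L ∨ b = q₁ ∨ b = p₁ := by
            rcases h with h | h | h
            exacts [Or.inl h, Or.inr (Or.inl h), (h' h).elim]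
          rintro (h | h | h | h | h | h)
          · exact aux (h2.2 (Or.inl h)) (r3 h)
          · exact (hne01 h.1).elim
          · exact aux (h2.2 (Or.inr (Or.inl h.1))) h.2.1
          · exact (hne01 h.2).elim
          · exact (h.2.2 (r4 h.1)).elim
          · exact Or.inr (Or.inr h.2)
    rw [hK'.borderSum_eq hF' hn, hfan.borderSum_eq hF hn, borderSum_of_deg_two hF hn h0 h1 hall,
      consecSum_append _ L [p₁], consecSum_append _ L [p]]
    simp only [consecSum_cons_cons, consecSum_singleton]
    rw [Finset.insert_comm p₀ q₁, Finset.insert_comm p₀ q₁, Finset.insert_comm p p₀, hw]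
    ring
  · -- the fan of `p₁` began with `p` and is preceded by `p₀` now
    obtain ⟨K, hK⟩ := exists_isFan hF hn (x := x) e p₁
    have hpK : InFan e x (linkGraph F x) p₁ p := Or.inr (Or.inl h1)
    obtain ⟨S, M, rfl⟩ := List.append_of_mem ((hK.2 p).2 hpK)
    have hS : S = [] := by
      rw [List.eq_nil_iff_forall_not_mem]
      intro y hy
      have h2 := ((hK.2 y).1 (by simp [hy])).prev_le hF hn h1
      have h3 := hK.1
      rw [List.pairwise_append] at h3
      have := h3.2.2 y hy p (by simp)
      omega
    subst hS
    rw [List.nil_append] at hK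
    have hK' : IsFan e x (linkGraph F' x) p₁ (p₀ :: p :: M) := by
      constructor
      · rw [List.pairwise_cons]
        refine ⟨?_, hK.1⟩
        have h3 := hK.1
        rw [List.pairwise_cons] at h3
        intro b hb
        rcases List.mem_cons.1 hb with rfl | hb
        · exact hlt
        · exact hlt.trans (h3.1 b hb)
      · intro b
        rw [List.mem_cons, hK.2, hI]
        unfold InFan
        have r4 := hprev b
        have r5 : NextTri e x (linkGraph F x) p₁ b → b ≠ p := fun hb h => hpp1 (h ▸ hb)
        constructor
        · rintro (h | h | h | h)
          · exact Or.inr (Or.inr (Or.inr (Or.inl ⟨h, rfl⟩)))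
          · exact Or.inl h
          · exact Or.inr (Or.inl ⟨rfl, hprev b h⟩)
          · exact Or.inr (Or.inr (Or.inr (Or.inr (Or.inl ⟨h, hne1.symm, r5 h⟩))))
        · rintro (h | h | h | h | h | h)
          · exact Or.inr (Or.inl h)
          · exact Or.inr (Or.inr (Or.inl (h.2 ▸ h1)))
          · exact Or.inr (Or.inr (Or.inl h.1))
          · exact Or.inl h.1
          · exact Or.inr (Or.inr (Or.inr h.1))
          · exact (hne01 h.1.symm).elim
    rw [hK'.borderSum_eq hF' hn, hK.borderSum_eq hF hn, borderSum_of_deg_two hF hn h0 h1 hall,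
      consecSum_cons_cons, add_comm]
    congr 2
    ext; simp; tauto
  · intro y hy hy0 hy1
    obtain ⟨K, hK⟩ := exists_isFan hF hn (x := x) e y
    have hK' : IsFan e x (linkGraph F' x) y K := by
      refine ⟨hK.1, fun b => ?_⟩
      rw [hK.2, hI]
      unfold InFan
      have r1 : NextTri e x (linkGraph F x) b y → b ≠ p := fun h hb => hy1 ((hb ▸ h).unique h1)
      have r2 : NextTri e x (linkGraph F x) y b → b ≠ p := fun h hb =>
        hy0 ((hb ▸ h).unique_left h0)
      constructor
      · rintro (h | h | h)
        · exact Or.inl h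
        · exact Or.inr (Or.inr (Or.inl ⟨h, r1 h, hy⟩))
        · exact Or.inr (Or.inr (Or.inr (Or.inr (Or.inl ⟨h, hy, r2 h⟩))))
      · rintro (h | h | h | h | h | h)
        · exact Or.inl h
        · exact (hy1 h.1).elim
        · exact Or.inr (Or.inl h.1)
        · exact (hy1 h.2).elim
        · exact Or.inr (Or.inr h.1)
        · exact (hy0 h.1).elim
    rw [hK'.borderSum_eq hF' hn, hK.borderSum_eq hF hn]

/-! ### The initialization -/

theorem pt_one (x : ZMod n) (k : ℕ) : pt 1 x k = x + k := by simp [pt]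

theorem pt_neg_one (x : ZMod n) (k : ℕ) : pt (-1) x k = x - k := by simp [pt, sub_eq_add_neg]

theorem add_one_eq (x : ZMod n) : x + 1 = pt 1 x 1 := by simp [pt_one]

theorem add_two_eq (x : ZMod n) : x + 2 = pt 1 x 2 := by simp [pt_one]

theorem sub_one_eq (x : ZMod n) : x - 1 = pt (-1) x 1 := by simp [pt_neg_one]

theorem sub_two_eq (x : ZMod n) : x - 2 = pt (-1) x 2 := by simp [pt_neg_one]

theorem pt_ne {j k : ℕ} (hj : j < n) (hk : k < n) (h : j ≠ k) : pt e x j ≠ pt e x k := by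
  rw [Ne, ← pos_inj (e := e) (x := x), pos_pt hj, pos_pt hk]
  exact h

theorem pt_ne_neg {j k : ℕ} (hk : 0 < k) (h : j + k < n) : pt e x j ≠ pt (-e) x k := by
  rw [Ne, ← pos_inj (e := e) (x := x), pos_pt (by omega), pos_neg_pt hk (by omega)]
  omega

theorem IsLeafAt.eq_end (hF : IsCluster F) (hn : 5 ≤ n) {p : ZMod n}
    (h : IsLeafAt (linkGraph F x) p (pt e x 2)) : p = pt e x 1 :=
  (h.eq (hF.adj_pt_one_pt_two (by omega) e x).symm).symm

/-- If `x + e` has a leaf other than `x + 2e`, then `x + 2e` is a leaf in it, too. -/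
theorem IsLeafAt.isLeafAt_end (hF : IsCluster F) (hn : 5 ≤ n) {q : ZMod n}
    (h : IsLeafAt (linkGraph F x) (pt e x 1) q) :
    IsLeafAt (linkGraph F x) (pt e x 1) (pt e x 2) := by
  have h1 := hF.adj_pt_one_pt_two (by omega) e x
  refine (isTriPoint_or_isLeafAt h.1 h1).resolve_left fun h2 => ?_
  have b1 := pos_pt (e := e) (x := x) (k := 1) (by omega : 1 < n)
  have b2 := pos_pt (e := e) (x := x) (k := 2) (by omega : 2 < n)
  have hnext : NextTri e x (linkGraph F x) (pt e x 1) (pt e x 2) :=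
    ⟨h.1, h2, by omega, fun r _ _ _ => by omega⟩
  have h3 := InFan.le_next hF hn (Or.inl h) hnext
  have h4 := pos_pos (e := e).2 h.2.1.2.2.1
  have h5 : pos e x q ≠ 1 := fun h5 => h.2.1.1 (pos_inj.1 (by rw [h5, b1])).symm
  have h6 : q = pt e x 2 := (pos_inj (e := e) (x := x)).1 (by omega)
  exact h.not_isTriPoint (h6 ▸ h2)

/-- In the graph of a cluster the initialization removes exactly the leaves other than `x ± 2`. -/
theorem isRemovedLeaf_iff (hF : IsCluster F) (hn : 5 ≤ n) {p q : ZMod n} :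
    IsRemovedLeaf x (linkGraph F x) p q ↔
      IsLeafAt (linkGraph F x) p q ∧ q ≠ x + 2 ∧ q ≠ x - 2 := by
  unfold IsRemovedLeaf
  rw [add_one_eq, add_two_eq, sub_one_eq, sub_two_eq]
  have hne : pt 1 x 1 ≠ pt (-1) x 1 := pt_ne_neg (by omega) (by omega)
  constructor
  · rintro ⟨h, h1⟩
    refine ⟨h, ?_, ?_⟩ <;> rintro rfl
    · have := h.eq_end hF hn
      rcases h1 with h1 | h1 | h1
      · exact h1.1 this
      · exact h1.2.2 rfl
      · exact hne (this.symm.trans h1.1)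
    · have := h.eq_end hF hn
      rcases h1 with h1 | h1 | h1
      · exact h1.2 this
      · exact hne (h1.1.symm.trans this)
      · exact h1.2.2 rfl
  · rintro ⟨h, h1, h2⟩
    refine ⟨h, ?_⟩
    by_cases hp1 : p = pt 1 x 1
    · subst hp1
      exact Or.inr (Or.inl ⟨rfl, h.isLeafAt_end hF hn, h1⟩)
    · by_cases hp2 : p = pt (-1) x 1
      · subst hp2
        exact Or.inr (Or.inr ⟨rfl, h.isLeafAt_end hF hn, h2⟩)
      · exact Or.inl ⟨hp1, hp2⟩

theorem borderLabel_congr {G G' : SimpleGraph (ZMod n)} {w w' : Finset (ZMod n) → ℂ} {y : ZMod n}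
    (h1 : IsTriPoint G' y ↔ IsTriPoint G y)
    (h2 : y = x + 1 → (IsLeafAt G' (x + 1) (x + 2) ↔ IsLeafAt G (x + 1) (x + 2)))
    (h3 : y = x - 1 → (IsLeafAt G' (x - 1) (x - 2) ↔ IsLeafAt G (x - 1) (x - 2)))
    (h4 : IsTriPoint G y → borderSum x G' w' y = borderSum x G w y) :
    borderLabel x G' w' y = borderLabel x G w y := by
  unfold borderLabel
  have hc : (IsTriPoint G' y ∧ (y = x + 1 → IsLeafAt G' (x + 1) (x + 2)) ∧
      (y = x - 1 → IsLeafAt G' (x - 1) (x - 2))) ↔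
      (IsTriPoint G y ∧ (y = x + 1 → IsLeafAt G (x + 1) (x + 2)) ∧
      (y = x - 1 → IsLeafAt G (x - 1) (x - 2))) :=
    and_congr h1 (and_congr (imp_congr_right h2) (imp_congr_right h3))
  by_cases h : IsTriPoint G y ∧ (y = x + 1 → IsLeafAt G (x + 1) (x + 2)) ∧
      (y = x - 1 → IsLeafAt G (x - 1) (x - 2))
  · rw [if_pos h, if_pos (hc.2 h), h4 h.1]
  · rw [if_neg h, if_neg (fun h' => h (hc.1 h'))]

/-- Removing a leaf by a mutation changes no labels. -/
theorem IsLeafAt.exists_leafMutation (hF : IsCluster F) (hn : 5 ≤ n) {v : GrassmannRing n →ₐ[ℂ] ℂ}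
    (hv : HasValueAt v F x 1) {p q : ZMod n} (h : IsLeafAt (linkGraph F x) p q)
    (hq : q ≠ x + 2) (hq' : q ≠ x - 2) :
    ∃ F', LeafMutation v x F F' ∧ linkGraph F' x = (linkGraph F x).deleteEdges {s(p, q)} ∧
      (borderLabel x (linkGraph F' x) fun t => v (plucker t)) =
        (borderLabel x (linkGraph F x) fun t => v (plucker t)) ∧
      ∀ a b, IsLeafAt (linkGraph F' x) a b ↔ IsLeafAt (linkGraph F x) a b ∧ ¬ (a = p ∧ b = q) := by
  obtain ⟨q₁, q₃, F', L, M, h1, -, h2, h3, h4, h5, h6⟩ := h.exists_mutation hF hn hv hq hq'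
  obtain ⟨h7, h8⟩ := h.borderSum_deleteEdges hF h3 hn h1 h5 (w := fun t => v (plucker t)) h6
  have hl := h.isLeafAt_deleteEdges h5 h7
  refine ⟨F', ⟨h2, h3, h4, p, q, h, hq, hq', h5⟩, h5, ?_, hl⟩
  ext1 y
  refine borderLabel_congr (h.isTriPoint_deleteEdges h5 h7 y) (fun _ => ?_) (fun _ => ?_)
    fun _ => h8 y
  · rw [hl, and_iff_left fun h' => hq h'.2.symm]
  · rw [hl, and_iff_left fun h' => hq' h'.2.symm]

/-- The state after the initialization is realized by removing the leaves one by one; `N` is the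
number of leaves still to be removed. -/
theorem exists_realizes_initState (hn : 5 ≤ n) {v : GrassmannRing n →ₐ[ℂ] ℂ} (N : ℕ) :
    ∀ F, IsCluster F → HasValueAt v F x 1 →
      {y : ZMod n × ZMod n | IsLeafAt (linkGraph F x) y.1 y.2 ∧ y.2 ≠ x + 2 ∧
        y.2 ≠ x - 2}.ncard = N →
      ∃ F₁, Relation.ReflTransGen (LeafMutation v x) F F₁ ∧
        Realizes v x F₁ (initState x (linkGraph F x) fun t => v (plucker t)) := by
  induction N with
  | zero =>
    intro F hF hv hN
    rw [Set.ncard_eq_zero (Set.toFinite _), Set.eq_empty_iff_forall_notMem] at hN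
    have hg : (initState x (linkGraph F x) fun t => v (plucker t)).graph = linkGraph F x := by
      ext a b
      simp only [initState, SimpleGraph.deleteEdges_adj, isRemovedLeaf_iff hF hn, Set.mem_ofPred_eq,
        and_iff_left_iff_imp]
      rintro - ⟨p, q, hpq, -⟩
      exact hN (p, q) hpq
    refine ⟨F, .refl, hF, hv, hg, ?_, ?_⟩
    · intro p q hpq
      rw [hg] at hpq
      by_contra! h
      exact hN (p, q) ⟨hpq, h⟩
    · rw [hg]
      rfl
  | succ N ih =>
    intro F hF hv hN
    obtain ⟨⟨p, q⟩, hpq⟩ : {y : ZMod n × ZMod n | IsLeafAt (linkGraph F x) y.1 y.2 ∧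
        y.2 ≠ x + 2 ∧ y.2 ≠ x - 2}.Nonempty := by
      rw [← Set.ncard_pos (Set.toFinite _)]
      omega
    have hmem := hpq
    obtain ⟨hl, hq, hq'⟩ := hpq
    dsimp only at hl hq hq'
    obtain ⟨F', hm, hG, hlab, hleaf⟩ := hl.exists_leafMutation hF hn hv hq hq'
    obtain ⟨F₁, h1, h2⟩ := ih F' hm.2.1 hm.2.2.1 (by
      have : {y : ZMod n × ZMod n | IsLeafAt (linkGraph F' x) y.1 y.2 ∧ y.2 ≠ x + 2 ∧ y.2 ≠ x - 2}
          = {y : ZMod n × ZMod n | IsLeafAt (linkGraph F x) y.1 y.2 ∧ y.2 ≠ x + 2 ∧ y.2 ≠ x - 2} \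
            {(p, q)} := by
        ext ⟨a, b⟩
        simp only [Set.mem_ofPred_eq, hleaf, Set.mem_sdiff, Set.mem_singleton_iff, Prod.mk.injEq]
        tauto
      rw [this, Set.ncard_sdiff_singleton_of_mem hmem, hN]
      rfl)
    refine ⟨F₁, h1.head hm, ?_⟩
    convert h2 using 1
    have hrem (p' q' : ZMod n) : IsRemovedLeaf x (linkGraph F' x) p' q' ↔
        IsRemovedLeaf x (linkGraph F x) p' q' ∧ ¬ (p' = p ∧ q' = q) := by
      rw [isRemovedLeaf_iff hm.2.1 hn, isRemovedLeaf_iff hF hn, hleaf, and_right_comm]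
    have hpq : IsRemovedLeaf x (linkGraph F x) p q := (isRemovedLeaf_iff hF hn).2 ⟨hl, hq, hq'⟩
    unfold initState
    congr 1
    · rw [hG, SimpleGraph.deleteEdges_deleteEdges, ← hG]
      congr 1
      ext y
      rw [Set.mem_union, Set.mem_singleton_iff, Set.mem_ofPred_eq, Set.mem_ofPred_eq]
      constructor
      · rintro ⟨p', q', h3, h4⟩
        by_cases h5 : p' = p ∧ q' = q
        · rw [h5.1, h5.2] at h4
          exact Or.inl h4
        · exact Or.inr ⟨p', q', (hrem p' q').2 ⟨h3, h5⟩, h4⟩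
      · rintro (h4 | ⟨p', q', h3, h4⟩)
        · exact ⟨p, q, hpq, h4⟩
        · exact ⟨p', q', ((hrem p' q').1 h3).1, h4⟩
    · exact hlab.symm

theorem initState_congr {G : SimpleGraph (ZMod n)} {val w : Finset (ZMod n) → ℂ}
    (h : ∀ t ∈ borderTriangles x G, val t = w t) : initState x G val = initState x G w := by
  unfold initState
  congr 1
  ext1 y
  refine borderLabel_congr Iff.rfl (fun _ => Iff.rfl) (fun _ => Iff.rfl) fun hy => ?_
  exact consecSum_congr (g := fun a b => val {y, a, b}) (g' := fun a b => w {y, a, b})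
    fun a b hab => h _ ⟨y, a, b, hy, hab, rfl⟩

/-! ### The loop -/

theorem borderLabel_eq_some {G : SimpleGraph (ZMod n)} {w : Finset (ZMod n) → ℂ} {y : ZMod n}
    (hy : IsTriPoint G y) (h1 : y ≠ x + 1) (h2 : y ≠ x - 1) :
    borderLabel x G w y = some (borderSum x G w y) := by
  unfold borderLabel
  rw [if_pos ⟨hy, fun h => (h1 h).elim, fun h => (h2 h).elim⟩]

theorem ne_ends_iff {p : ZMod n} :
    (p ≠ x + 1 ∧ p ≠ x - 1) ↔ p ≠ pt e x 1 ∧ p ≠ pt (-e) x 1 := by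
  rw [add_one_eq, sub_one_eq]
  rcases Int.units_eq_one_or e with rfl | rfl
  · rfl
  · rw [neg_neg]; tauto

theorem borderLabel_end {G : SimpleGraph (ZMod n)} (hn : 5 ≤ n) (w : Finset (ZMod n) → ℂ)
    (e : ℤˣ) (hy : IsTriPoint G (pt e x 1)) :
    (IsLeafAt G (pt e x 1) (pt e x 2) →
      borderLabel x G w (pt e x 1) = some (borderSum x G w (pt e x 1))) ∧
    (¬ IsLeafAt G (pt e x 1) (pt e x 2) → borderLabel x G w (pt e x 1) = none) := by
  have hne : pt 1 x 1 ≠ pt (-1) x 1 := pt_ne_neg (by omega) (by omega)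
  unfold borderLabel
  rw [add_one_eq, add_two_eq, sub_one_eq, sub_two_eq]
  rcases Int.units_eq_one_or e with rfl | rfl
  · constructor
    · intro h
      rw [if_pos ⟨hy, fun _ => h, fun h' => (hne h').elim⟩]
    · intro h
      rw [if_neg fun h' => h (h'.2.1 rfl)]
  · constructor
    · intro h
      rw [if_pos ⟨hy, fun h' => (hne h'.symm).elim, fun _ => h⟩]
    · intro h
      rw [if_neg fun h' => h (h'.2.2 rfl)]

/-- The label of `y` depends on the graph only through its border sum, on whether `y` is a
triangulation point, and, for the ends `y = x ± 1`, on whether `x ± 2` is a leaf in it. -/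
theorem borderLabel_congr_dir {G G' : SimpleGraph (ZMod n)} {w : Finset (ZMod n) → ℂ} {y : ZMod n}
    (h1 : IsTriPoint G' y ↔ IsTriPoint G y)
    (h2 : ∀ e : ℤˣ, y = pt e x 1 →
      (IsLeafAt G' (pt e x 1) (pt e x 2) ↔ IsLeafAt G (pt e x 1) (pt e x 2)))
    (h4 : borderSum x G' w y = borderSum x G w y) :
    borderLabel x G' w y = borderLabel x G w y := by
  refine borderLabel_congr h1 ?_ ?_ fun _ => h4
  · rw [add_one_eq, add_two_eq]; exact h2 1
  · rw [sub_one_eq, sub_two_eq]; exact h2 (-1)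

/-- If the border sum of `y` grows by `d`, so does its label, provided that it has one. -/
theorem borderLabel_add {G G' : SimpleGraph (ZMod n)} {w : Finset (ZMod n) → ℂ} {y : ZMod n} {d : ℂ}
    (h1 : IsTriPoint G' y ↔ IsTriPoint G y)
    (h2 : ∀ e : ℤˣ, y = pt e x 1 →
      (IsLeafAt G' (pt e x 1) (pt e x 2) ↔ IsLeafAt G (pt e x 1) (pt e x 2)))
    (h4 : borderSum x G' w y = borderSum x G w y + d) :
    borderLabel x G' w y = Option.map₂ (fun a b => a + b) (borderLabel x G w y) (some d) := by
  have h2' := h2 1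
  have h3' := h2 (-1)
  rw [← add_one_eq, ← add_two_eq] at h2'
  rw [← sub_one_eq, ← sub_two_eq] at h3'
  unfold borderLabel
  have hc : (IsTriPoint G' y ∧ (y = x + 1 → IsLeafAt G' (x + 1) (x + 2)) ∧
      (y = x - 1 → IsLeafAt G' (x - 1) (x - 2))) ↔
      (IsTriPoint G y ∧ (y = x + 1 → IsLeafAt G (x + 1) (x + 2)) ∧
      (y = x - 1 → IsLeafAt G (x - 1) (x - 2))) :=
    and_congr h1 (and_congr (imp_congr_right h2') (imp_congr_right h3'))
  by_cases h : IsTriPoint G y ∧ (y = x + 1 → IsLeafAt G (x + 1) (x + 2)) ∧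
      (y = x - 1 → IsLeafAt G (x - 1) (x - 2))
  · rw [if_pos h, if_pos (hc.2 h), h4]
    rfl
  · rw [if_neg h, if_neg (fun h' => h (hc.1 h'))]
    rfl

/-- The mutation that removes the edge `{p₀, p}` at a triangulation point `p ≠ x + 2e` of degree
two realizes the change of the labels in a pass of the loop. -/
theorem exists_edgeMutation_of_deg_two (hF : IsCluster F) (hn : 5 ≤ n)
    {v : GrassmannRing n →ₐ[ℂ] ℂ} (hv : HasValueAt v F x 1) {p : ZMod n}
    (h : deg (linkGraph F x) p = 2) (hp1 : p ≠ pt e x 1) (hp2 : p ≠ pt (-e) x 1)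
    (hp : p ≠ pt e x 2) :
    ∃ p₀ p₁ F', p₀ ≠ p ∧ p₁ ≠ p ∧ p₀ ≠ p₁ ∧ (∀ b, (linkGraph F x).Adj p b ↔ b = p₀ ∨ b = p₁) ∧
      EdgeMutation v x F F' ∧ linkGraph F' x = (linkGraph F x).deleteEdges {s(p₀, p)} ∧
      (∀ a b, IsLeafAt (linkGraph F' x) a b ↔ IsLeafAt (linkGraph F x) a b ∨ a = p₁ ∧ b = p) ∧
      (p ≠ pt (-e) x 2 → (borderLabel x (linkGraph F' x) fun t => v (plucker t)) =
        Function.update (addLabel (addLabel (borderLabel x (linkGraph F x) fun t => v (plucker t))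
          p₀ p) p₁ p) p none) ∧
      (p = pt (-e) x 2 → (borderLabel x (linkGraph F' x) fun t => v (plucker t)) =
        Function.update (addLabel (Function.update
          (borderLabel x (linkGraph F x) fun t => v (plucker t)) (pt (-e) x 1)
          (borderLabel x (linkGraph F x) (fun t => v (plucker t)) p)) p₀ p) p none ∧
        p₁ = pt (-e) x 1) := by
  obtain ⟨p₀, p₁, h0, h1, h01, hT, hall⟩ := exists_neighbours_of_deg_two hF hn h hp1 hp2
  obtain ⟨q₁, F', L, hfan, -, hmut, hF', hv', hG, hval⟩ :=
    exists_mutation_of_deg_two hF hn hv h0 h1 h01 hT hp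
  obtain ⟨htri, hs0, hs1, hs⟩ := borderSum_deleteEdges_of_deg_two hF hF' hn h0 h1 h01 hall hfan hG
    (w := fun t => v (plucker t)) hval
  have hne0 : p₀ ≠ p := ne_of_pos_lt h0.2.2.1
  have hne1 : p₁ ≠ p := (ne_of_pos_lt h1.2.2.1).symm
  have hne01 : p₀ ≠ p₁ := ne_of_pos_lt (h0.2.2.1.trans h1.2.2.1)
  have hT' := isTriPoint_deleteEdges_of_deg_two h0 hall htri hG
  have hL' := isLeafAt_deleteEdges_of_deg_two h0 h1 hall htri hG
  set w : Finset (ZMod n) → ℂ := fun t => v (plucker t) with hw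
  have hends := (ne_ends_iff (e := e)).2 ⟨hp1, hp2⟩
  have hlabp : borderLabel x (linkGraph F x) w p = some (borderSum x (linkGraph F x) w p) :=
    borderLabel_eq_some h0.2.1 hends.1 hends.2
  have hpnone : borderLabel x (linkGraph F' x) w p = none := by
    unfold borderLabel
    rw [if_neg fun h' => ((hT' p).1 h'.1).2 rfl]
  -- a leaf status that matters for the label of `y` changes only for `y = p₁`
  have hflag (y : ZMod n) (hy : y ≠ p₁) (e' : ℤˣ) (hye : y = pt e' x 1) :
      IsLeafAt (linkGraph F' x) (pt e' x 1) (pt e' x 2) ↔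
        IsLeafAt (linkGraph F x) (pt e' x 1) (pt e' x 2) := by
    rw [hL', or_iff_left fun h' => hy (hye.trans h'.1)]
  have hl0 : borderLabel x (linkGraph F' x) w p₀ = Option.map₂ (fun a b => a + b)
      (borderLabel x (linkGraph F x) w p₀) (some (borderSum x (linkGraph F x) w p)) :=
    borderLabel_add ((hT' _).trans (and_iff_left hne0)) (hflag p₀ hne01) hs0
  have hlo (y : ZMod n) (hy : y ≠ p) (hy0 : y ≠ p₀) (hy1 : y ≠ p₁) :
      borderLabel x (linkGraph F' x) w y = borderLabel x (linkGraph F x) w y :=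
    borderLabel_congr_dir ((hT' _).trans (and_iff_left hy)) (hflag y hy1) (hs y hy hy0 hy1)
  refine ⟨p₀, p₁, F', hne0, hne1, hne01, hall, ⟨hmut, hF', hv', p₀, p, h0.adj hF hn, hG⟩, hG, hL',
    ?_, ?_⟩
  · intro hp3
    have hl1 : borderLabel x (linkGraph F' x) w p₁ = Option.map₂ (fun a b => a + b)
        (borderLabel x (linkGraph F x) w p₁) (some (borderSum x (linkGraph F x) w p)) := by
      refine borderLabel_add ((hT' _).trans (and_iff_left hne1)) (fun e' _ => ?_) hs1
      rw [hL', or_iff_left]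
      rintro ⟨-, h3⟩
      rcases Int.units_eq_one_or e with rfl | rfl <;> rcases Int.units_eq_one_or e' with rfl | rfl
      · exact hp h3.symm
      · exact hp3 h3.symm
      · exact hp3 (by rw [neg_neg]; exact h3.symm)
      · exact hp h3.symm
    ext1 y
    by_cases hy : y = p
    · subst hy
      rw [Function.update_self, hpnone]
    · rw [Function.update_of_ne hy]
      unfold addLabel
      by_cases hy1 : y = p₁
      · subst hy1
        rw [Function.update_self, Function.update_of_ne hne01.symm, Function.update_of_ne hne0.symm,
          hl1, hlabp]
      · rw [Function.update_of_ne hy1]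
        by_cases hy0 : y = p₀
        · subst hy0
          rw [Function.update_self, hl0, hlabp]
        · rw [Function.update_of_ne hy0, hlo y hy hy0 hy1]
  · intro hp3
    have b2 := pos_neg_pt (e := e) (x := x) (k := 2) (by omega) (by omega : 2 < n)
    have b1 := pos_neg_pt (e := e) (x := x) (k := 1) (by omega) (by omega : 1 < n)
    rw [← hp3] at b2
    have hp1e : p₁ = pt (-e) x 1 := by
      refine (pos_inj (e := e) (x := x)).1 ?_
      have := h1.2.2.1
      have := pos_lt e x p₁
      omega
    -- the fan of `p₁ = x - e` consists of `p = x - 2e` alone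
    have hsum : borderSum x (linkGraph F x) w p₁ = 0 := by
      have hK : IsFan e x (linkGraph F x) p₁ [p] := by
        refine ⟨by simp, fun b => ?_⟩
        rw [List.mem_singleton]
        constructor
        · rintro rfl
          exact Or.inr (Or.inl h1)
        · intro hb
          have h3 := hb.prev_le hF hn h1
          have h4 := pos_lt e x b
          have h5 : pos e x b ≠ n - 1 := fun h5 =>
            (hb.adj hF hn).1 (hp1e.trans (pos_inj.1 (by rw [h5, b1])).symm)
          exact (pos_inj (e := e) (x := x)).1 (by omega)
      rw [hK.borderSum_eq hF hn, consecSum_singleton]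
    have hl1 : borderLabel x (linkGraph F' x) w p₁ = some (borderSum x (linkGraph F x) w p) := by
      have htri1 := (hT' p₁).2 ⟨h1.2.1, hne1⟩
      rw [hp1e] at htri1
      have h5 := (borderLabel_end hn w (-e) htri1).1 ((hL' _ _).2 (Or.inr ⟨hp1e.symm, hp3.symm⟩))
      rw [hp1e, h5, ← hp1e, hs1, hsum, zero_add]
    refine ⟨?_, hp1e⟩
    rw [← hp1e]
    ext1 y
    by_cases hy : y = p
    · subst hy
      rw [Function.update_self, hpnone]
    · rw [Function.update_of_ne hy]
      unfold addLabel
      by_cases hy0 : y = p₀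
      · subst hy0
        rw [Function.update_self, Function.update_of_ne hne01, Function.update_of_ne hne1.symm,
          hl0, hlabp]
      · rw [Function.update_of_ne hy0]
        by_cases hy1 : y = p₁
        · subst hy1
          rw [Function.update_self, hl1, hlabp]
        · rw [Function.update_of_ne hy1, hlo y hy hy0 hy1]

theorem LeafMutation.edgeMutation {v : GrassmannRing n →ₐ[ℂ] ℂ} (h : LeafMutation v x F F') :
    EdgeMutation v x F F' := by
  obtain ⟨h1, h2, h3, p, q, h4, -, -, h5⟩ := h
  exact ⟨h1, h2, h3, p, q, h4.2.1, h5⟩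

/-- A pass of the loop at `x + 2e` is realized by the mutation that removes the edge from `x + 2e`
to its neighbour other than `x + e`. -/
theorem realizes_end_step (hn : 5 ≤ n) {v : GrassmannRing n →ₐ[ℂ] ℂ} {s : AlgState n}
    (hR : Realizes v x F s) {q : ZMod n} (e : ℤˣ) (hp : deg s.graph (pt e x 2) = 2)
    (hq : s.graph.Adj (pt e x 2) q) (hne : q ≠ pt e x 1) :
    ∃ F₂, Relation.ReflTransGen (EdgeMutation v x) F F₂ ∧
      Realizes v x F₂
        { graph := s.graph.deleteEdges {s(pt e x 2, q)}
          label := Function.update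
            (addLabel (Function.update s.label (pt e x 1) (s.label (pt e x 2))) q (pt e x 2))
            (pt e x 2) none } := by
  obtain ⟨hF, hv, hg, hleaf, hlab⟩ := hR
  rw [hg] at hp hq hleaf hlab
  have n1 : pt e x 2 ≠ pt (-e) x 1 := pt_ne_neg (by omega) (by omega)
  have n2 : pt e x 2 ≠ pt e x 1 := pt_ne (by omega) (by omega) (by omega)
  have n3 : pt e x 2 ≠ pt (-e) x 2 := pt_ne_neg (by omega) (by omega)
  obtain ⟨p₀, p₁, F', h1, h2, h3, hall, hm, hG, hL, -, hl⟩ :=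
    exists_edgeMutation_of_deg_two (e := -e) hF hn hv hp n1 (by rwa [neg_neg]) n3
  rw [neg_neg] at hl
  obtain ⟨hl, hp1⟩ := hl rfl
  have hqp : q = p₀ := ((hall q).1 hq).resolve_right fun h => hne (h.trans hp1)
  subst hqp
  refine ⟨F', .single hm, hm.2.1, hm.2.2.1, ?_, ?_, ?_⟩
  · rw [hG, hg, Sym2.eq_swap]
  · dsimp only
    intro a b hab
    rw [hg, Sym2.eq_swap, ← hG, hL] at hab
    rcases hab with hab | ⟨-, rfl⟩
    · exact hleaf a b hab
    · rw [add_two_eq, sub_two_eq]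
      rcases Int.units_eq_one_or e with rfl | rfl
      · exact Or.inl rfl
      · exact Or.inr rfl
  · dsimp only
    rw [hg, Sym2.eq_swap, ← hG, hl, hlab]

/-- Every pass of the loop is realized by mutations: one at `x ± 2`, and two at any other point `p`,
the first making `p` a leaf and the second removing that leaf. -/
theorem Realizes.step (hn : 5 ≤ n) {v : GrassmannRing n →ₐ[ℂ] ℂ} {s s' : AlgState n}
    (hR : Realizes v x F s) (hs : Step x s s') :
    ∃ F₂, Relation.ReflTransGen (EdgeMutation v x) F F₂ ∧ Realizes v x F₂ s' := by
  cases hs with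
  | right q hrun hp hq hne =>
    simp only [add_one_eq, add_two_eq] at *
    exact realizes_end_step hn hR 1 hp hq hne
  | left q hrun hp hq hne =>
    simp only [sub_one_eq, sub_two_eq] at *
    exact realizes_end_step hn hR (-1) hp hq hne
  | inner p q r hrun hp h₁ h₂ h₃ h₄ hq hr hne =>
    obtain ⟨hF, hv, hg, hleaf, hlab⟩ := hR
    rw [hg] at hp hq hr hleaf hlab
    obtain ⟨p₀, p₁, F', h1, h2, h3, hall, hm, hG, hL, hl, -⟩ :=
      exists_edgeMutation_of_deg_two (e := 1) hF hn hv hp (by rwa [← add_one_eq])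
        (by rwa [← sub_one_eq]) (by rwa [← add_two_eq])
    have hl := hl (by rwa [← sub_two_eq])
    have hpl : IsLeafAt (linkGraph F' x) p₁ p := (hL _ _).2 (Or.inr ⟨rfl, rfl⟩)
    obtain ⟨F'', hm', hG', hlab', hL'⟩ := hpl.exists_leafMutation hm.2.1 hn hm.2.2.1 h₃ h₄
    have hqr : q = p₀ ∧ r = p₁ ∨ q = p₁ ∧ r = p₀ := by
      rcases (hall q).1 hq with rfl | rfl <;> rcases (hall r).1 hr with rfl | rfl
      · exact (hne rfl).elim
      · exact Or.inl ⟨rfl, rfl⟩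
      · exact Or.inr ⟨rfl, rfl⟩
      · exact (hne rfl).elim
    have hgr : linkGraph F'' x = (linkGraph F x).deleteEdges {s(p, q), s(p, r)} := by
      rw [hG', hG, SimpleGraph.deleteEdges_deleteEdges]
      congr 1
      rw [Set.singleton_union]
      rcases hqr with ⟨rfl, rfl⟩ | ⟨rfl, rfl⟩
      · rw [Sym2.eq_swap, Sym2.eq_swap (a := r)]
      · rw [Sym2.eq_swap, Sym2.eq_swap (a := q), Set.pair_comm]
    refine ⟨F'', (Relation.ReflTransGen.single hm).tail hm'.edgeMutation, hm'.2.1, hm'.2.2.1,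
      ?_, ?_, ?_⟩
    · rw [hgr, hg]
    · dsimp only
      intro a b hab
      rw [hg, ← hgr, hL', hL] at hab
      exact hleaf a b (by tauto)
    · dsimp only
      rw [hg, ← hgr, hlab', hl, hlab]
      congr 1
      rcases hqr with ⟨rfl, rfl⟩ | ⟨rfl, rfl⟩
      · rfl
      · unfold addLabel
        rw [Function.update_comm hne, Function.update_of_ne h2.symm, Function.update_of_ne h1.symm,
          Function.update_of_ne hne, Function.update_of_ne hne.symm]

theorem Step.ncard_lt {s s' : AlgState n} (h : Step x s s') :
    s'.graph.edgeSet.ncard < s.graph.edgeSet.ncard := by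
  have key (G : SimpleGraph (ZMod n)) (S : Set (Sym2 (ZMod n))) (a b : ZMod n) (hab : G.Adj a b)
      (hS : s(a, b) ∈ S) : (G.deleteEdges S).edgeSet.ncard < G.edgeSet.ncard := by
    refine Set.ncard_lt_ncard ?_ (Set.toFinite _)
    rw [SimpleGraph.edgeSet_deleteEdges, Set.ssubset_iff_of_subset Set.sdiff_subset]
    exact ⟨s(a, b), hab, fun h => h.2 hS⟩
  cases h with
  | right q hrun hp hq hne => exact key _ _ _ _ hq rfl
  | left q hrun hp hq hne => exact key _ _ _ _ hq rfl
  | inner p q r hrun hp h₁ h₂ h₃ h₄ hq hr hne => exact key _ _ _ _ hq (Or.inl rfl)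

theorem step_acc (s : AlgState n) : Acc (fun s' s => Step x s s') s :=
  Subrelation.accessible (fun h => Step.ncard_lt h)
    ((measure fun s : AlgState n => s.graph.edgeSet.ncard).wf.apply s)

/-! ### Points of degree two -/

/-- Every edge of the graph has an endpoint of degree at least two: otherwise the innermost edge
around it could be joined to one of its endpoints. -/
theorem IsCluster.isTriPoint_or_isTriPoint (hF : IsCluster F) (hn : 5 ≤ n) {p q : ZMod n}
    (h : (linkGraph F x).Adj p q) :
    IsTriPoint (linkGraph F x) p ∨ IsTriPoint (linkGraph F x) q := by
  wlog hlt : pos 1 x p < pos 1 x q generalizing p q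
  · have hne : pos 1 x p ≠ pos 1 x q := fun h' => h.1 (pos_inj.1 h')
    exact (this h.symm (by omega)).symm
  by_contra! hcon
  obtain ⟨hp, hq⟩ := hcon
  have hp' (b : ZMod n) (hb : (linkGraph F x).Adj p b) : b = q := by
    by_contra hbq
    exact hp (isTriPoint_iff.2 ⟨b, q, hbq, hb, h⟩)
  have hq' (b : ZMod n) (hb : (linkGraph F x).Adj q b) : b = p := by
    by_contra hbq
    exact hq (isTriPoint_iff.2 ⟨b, p, hbq, hb, h.symm⟩)
  have hp1 : pos 1 x p ≠ 1 := fun h1 =>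
    hp ((pos_eq_one_iff (by omega)).1 h1 ▸ hF.isTriPoint_end hn 1 x)
  have hq1 : pos 1 x q ≠ n - 1 := fun h1 =>
    hq ((pos_eq_sub_one_iff (by omega)).1 h1 ▸ hF.isTriPoint_end hn (-1) x)
  have b1 := pos_pt (e := 1) (x := x) (k := 1) (by omega : 1 < n)
  have b2 := pos_neg_pt (e := 1) (x := x) (k := 1) (by omega) (by omega : 1 < n)
  have b3 := pos_pos (e := 1).2 h.2.1
  have b4 := pos_lt 1 x q
  obtain ⟨⟨u, w⟩, ⟨huw, hup, hqw⟩, hmin⟩ := exists_minimizer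
    (S := fun y : ZMod n × ZMod n => (linkGraph F x).Adj y.1 y.2 ∧ pos 1 x y.1 < pos 1 x p ∧
      pos 1 x q < pos 1 x y.2) (fun y => pos 1 x y.2 - pos 1 x y.1)
    ⟨(pt 1 x 1, pt (-1) x 1), hF.adj_ends (by omega) 1 x, by dsimp only; omega,
      by dsimp only; omega⟩
  dsimp only at huw hup hqw hmin
  -- no edge crosses `{u, p}`, or `{u, q}`, from inside the innermost edge `{u, w}` around `{p, q}`
  have key (a b : ZMod n) (hab : (linkGraph F x).Adj a b) (h1 : pos 1 x u < pos 1 x a)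
      (h2 : pos 1 x a < pos 1 x p) (h3 : pos 1 x p < pos 1 x b) : False := by
    rcases lt_trichotomy (pos 1 x b) (pos 1 x q) with h4 | h4 | h4
    · exact hF.adj_noncrossing hab h h2 h3 h4
    · rw [pos_inj] at h4
      subst h4
      have := hq' a hab.symm
      subst this
      exact lt_irrefl _ h2
    · rcases le_or_gt (pos 1 x b) (pos 1 x w) with h5 | h5
      · have := hmin (a, b) ⟨hab, h2, h4⟩
        dsimp only at this
        omega
      · exact hF.adj_noncrossing huw hab h1 (by omega) h5
  have key' (a b : ZMod n) (hab : (linkGraph F x).Adj a b) (h1 : pos 1 x u < pos 1 x a)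
      (h2 : pos 1 x a < pos 1 x q) (h3 : pos 1 x q < pos 1 x b) : False := by
    rcases lt_trichotomy (pos 1 x a) (pos 1 x p) with h4 | h4 | h4
    · exact key a b hab h1 h4 (by omega)
    · rw [pos_inj] at h4
      subst h4
      have := hp' b hab
      subst this
      omega
    · exact hF.adj_noncrossing h hab h4 h2 h3
  rcases hF.adj_of_nested huw h hup hlt hqw key key' with h4 | h4
  · have := hp' u h4.symm
    subst this
    omega
  · have := hq' u h4.symm
    subst this
    omega

/-- The three edges of the graph at the end of the algorithm. -/
def finalEdges (e : ℤˣ) (x : ZMod n) : Set (Sym2 (ZMod n)) :=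
  {s(pt (-e) x 2, pt (-e) x 1), s(pt (-e) x 1, pt e x 1), s(pt e x 1, pt e x 2)}

theorem finalEdges_neg : finalEdges (-e) x = finalEdges e x := by
  unfold finalEdges
  rw [neg_neg, Sym2.eq_swap, Sym2.eq_swap (a := pt e x 1) (b := pt (-e) x 1),
    Sym2.eq_swap (a := pt (-e) x 1) (b := pt (-e) x 2)]
  ext y
  simp only [Set.mem_insert_iff, Set.mem_singleton_iff]
  tauto

theorem finalEdges_eq (e : ℤˣ) : finalEdges e x =
    {s(x - 2, x - 1), s(x - 1, x + 1), s(x + 1, x + 2)} := by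
  have h : finalEdges 1 x = {s(x - 2, x - 1), s(x - 1, x + 1), s(x + 1, x + 2)} := by
    rw [add_one_eq, add_two_eq, sub_one_eq, sub_two_eq]
    rfl
  rcases Int.units_eq_one_or e with rfl | rfl
  · exact h
  · rw [finalEdges_neg, h]

theorem ncard_finalEdges (hn : 5 ≤ n) : (finalEdges e x).ncard = 3 := by
  have n1 : pt e x 1 ≠ pt (-e) x 1 := pt_ne_neg (by omega) (by omega)
  have n2 : pt e x 2 ≠ pt (-e) x 1 := pt_ne_neg (by omega) (by omega)
  have n3 : pt e x 1 ≠ pt (-e) x 2 := pt_ne_neg (by omega) (by omega)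
  have n4 : pt e x 2 ≠ pt e x 1 := pt_ne (by omega) (by omega) (by omega)
  have n5 : pt (-e) x 2 ≠ pt (-e) x 1 := pt_ne (by omega) (by omega) (by omega)
  rw [Set.ncard_eq_three]
  refine ⟨_, _, _, ?_, ?_, ?_, rfl⟩ <;> rw [Ne, Sym2.eq_iff] <;> tauto

theorem IsCluster.finalEdges_subset (hF : IsCluster F) (hn : 5 ≤ n) :
    finalEdges e x ⊆ (linkGraph F x).edgeSet := by
  rintro y (rfl | rfl | rfl)
  · exact (hF.adj_pt_one_pt_two (by omega) (-e) x).symm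
  · exact (hF.adj_ends (by omega) e x).symm
  · exact hF.adj_pt_one_pt_two (by omega) e x

/-- If no triangulation point lies strictly between `x + 1` and `x - 1`, only three edges
are left. -/
theorem edgeSet_subset_finalEdges (hF : IsCluster F) (hn : 5 ≤ n)
    (hleaf : ∀ p q, IsLeafAt (linkGraph F x) p q → q = x + 2 ∨ q = x - 2)
    (h : ∀ p, IsTriPoint (linkGraph F x) p → ∃ e : ℤˣ, p = pt e x 1) :
    (linkGraph F x).edgeSet ⊆ finalEdges 1 x := by
  have key (a b : ZMod n) (hab : (linkGraph F x).Adj a b) (ha : IsTriPoint (linkGraph F x) a) :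
      s(a, b) ∈ finalEdges 1 x := by
    rcases isTriPoint_or_isLeafAt ha hab with hb | hb
    · obtain ⟨e, rfl⟩ := h a ha
      obtain ⟨e', rfl⟩ := h b hb
      have hne : e ≠ e' := fun h' => hab.1 (h' ▸ rfl)
      rcases Int.units_eq_one_or e with rfl | rfl <;> rcases Int.units_eq_one_or e' with rfl | rfl
      · exact (hne rfl).elim
      · exact Or.inr (Or.inl Sym2.eq_swap)
      · exact Or.inr (Or.inl rfl)
      · exact (hne rfl).elim
    · rcases hleaf a b hb with rfl | rfl
      · rw [add_two_eq] at hb ⊢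
        rw [hb.eq_end hF hn]
        exact Or.inr (Or.inr rfl)
      · rw [sub_two_eq] at hb ⊢
        rw [hb.eq_end hF hn]
        exact Or.inl Sym2.eq_swap
  intro y
  induction y with | _ a b => ?_
  intro hab
  rcases hF.isTriPoint_or_isTriPoint hn hab with ha | hb
  · exact key a b hab ha
  · rw [Sym2.eq_swap]
    exact key b a hab.symm hb

/-- While there are more than three edges, there is a point of degree two to continue with, namely
the triangulation point with the shortest span between its first and its last neighbour. -/
theorem exists_deg_two (hF : IsCluster F) (hn : 5 ≤ n)
    (hleaf : ∀ p q, IsLeafAt (linkGraph F x) p q → q = x + 2 ∨ q = x - 2)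
    (hrun : 3 < (linkGraph F x).edgeSet.ncard) :
    ∃ p, deg (linkGraph F x) p = 2 ∧ p ≠ x + 1 ∧ p ≠ x - 1 := by
  obtain ⟨p₀, hp₀, hpne⟩ : ∃ p, IsTriPoint (linkGraph F x) p ∧ ∀ e : ℤˣ, p ≠ pt e x 1 := by
    by_contra! hcon
    have := Set.ncard_le_ncard (edgeSet_subset_finalEdges hF hn hleaf hcon) (Set.toFinite _)
    rw [ncard_finalEdges hn] at this
    omega
  obtain ⟨l₀, r₀, h₀⟩ := hF.exists_first_last (e := 1) hn hp₀ (hpne 1) (hpne (-1))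
  obtain ⟨⟨p, l, r⟩, ⟨hp, hpne, hl, hr, -, hlp, hpr, hall⟩, hmin⟩ := exists_minimizer
    (S := fun y : ZMod n × ZMod n × ZMod n => IsTriPoint (linkGraph F x) y.1 ∧
      (∀ e : ℤˣ, y.1 ≠ pt e x 1) ∧ (linkGraph F x).Adj y.1 y.2.1 ∧
      (linkGraph F x).Adj y.1 y.2.2 ∧ (linkGraph F x).Adj y.2.1 y.2.2 ∧
      pos 1 x y.2.1 < pos 1 x y.1 ∧ pos 1 x y.1 < pos 1 x y.2.2 ∧
      ∀ b, (linkGraph F x).Adj y.1 b → pos 1 x y.2.1 ≤ pos 1 x b ∧ pos 1 x b ≤ pos 1 x y.2.2)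
    (fun y => pos 1 x y.2.2 - pos 1 x y.2.1) ⟨(p₀, l₀, r₀), hp₀, hpne, h₀⟩
  dsimp only at hp hpne hl hr hlp hpr hall hmin
  refine ⟨p, deg_eq_two_iff.2 ⟨l, r, ne_of_pos_lt (hlp.trans hpr), fun c => ⟨fun hc => ?_, ?_⟩⟩,
    ?_, ?_⟩
  · by_contra! hcon
    have hcl : pos 1 x c ≠ pos 1 x l := fun h => hcon.1 (pos_inj.1 h)
    have hcr : pos 1 x c ≠ pos 1 x r := fun h => hcon.2 (pos_inj.1 h)
    have hcp : pos 1 x p ≠ pos 1 x c := fun h => hc.1 (pos_inj.1 h)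
    have h1 := hall c hc
    have h2 := pos_lt 1 x r
    have h3 := pos_pos (e := 1).2 hl.2.2.1
    rcases isTriPoint_or_isLeafAt hp hc with hct | hct
    · -- a third neighbour `c` would be a triangulation point with a shorter span
      have hc1 : pos 1 x c ≠ 1 := by omega
      have hc2 : pos 1 x c ≠ n - 1 := by omega
      rw [Ne, pos_eq_one_iff (by omega)] at hc1
      rw [Ne, pos_eq_sub_one_iff (by omega)] at hc2
      have hce : ∀ e : ℤˣ, c ≠ pt e x 1 := fun e => by
        rcases Int.units_eq_one_or e with rfl | rfl
        · exact hc1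
        · exact hc2
      obtain ⟨l', r', h⟩ := hF.exists_first_last (e := 1) hn hct hc1 hc2
      have h4 := hmin (c, l', r') ⟨hct, hce, h⟩
      dsimp only at h4
      obtain ⟨hl', hr', -, hlc, hcr', hall'⟩ := h
      have h5 := hall' p hc.symm
      rcases lt_or_gt_of_ne hcp with h6 | h6
      · have h7 : ¬ pos 1 x l' < pos 1 x p := fun h7 =>
          hF.adj_noncrossing hl'.symm hr h7 h6 (by omega)
        have h8 : ¬ pos 1 x r < pos 1 x r' := fun h8 =>
          hF.adj_noncrossing hr hr' h6 (by omega) h8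
        omega
      · have h7 : ¬ pos 1 x p < pos 1 x r' := fun h7 =>
          hF.adj_noncrossing hl.symm hr' (by omega) h6 h7
        have h8 : ¬ pos 1 x l' < pos 1 x l := fun h8 =>
          hF.adj_noncrossing hl'.symm hl.symm h8 (by omega) h6
        omega
    · rcases hleaf p c hct with rfl | rfl
      · rw [add_two_eq] at hct
        exact hpne _ (hct.eq_end hF hn)
      · rw [sub_two_eq] at hct
        exact hpne _ (hct.eq_end hF hn)
  · rintro (rfl | rfl)
    exacts [hl, hr]
  · rw [add_one_eq]
    exact hpne 1
  · rw [sub_one_eq]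
    exact hpne (-1)

theorem Realizes.exists_step (hn : 5 ≤ n) {v : GrassmannRing n →ₐ[ℂ] ℂ} {s : AlgState n}
    (hR : Realizes v x F s) (hs : Running s) : ∃ s', Step x s s' := by
  obtain ⟨hF, -, hg, hleaf, -⟩ := hR
  obtain ⟨p, hp, hp1, hp2⟩ : ∃ p, deg s.graph p = 2 ∧ p ≠ x + 1 ∧ p ≠ x - 1 := by
    rw [hg]
    rw [hg] at hleaf
    exact exists_deg_two hF hn hleaf (hg ▸ hs)
  obtain ⟨a, b, hab, h⟩ := deg_eq_two_iff.1 hp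
  have ha := (h a).2 (Or.inl rfl)
  have hb := (h b).2 (Or.inr rfl)
  have key (c : ZMod n) : ∃ q, s.graph.Adj p q ∧ q ≠ c := by
    by_cases hac : a = c
    · exact ⟨b, hb, fun hbc => hab (hac.trans hbc.symm)⟩
    · exact ⟨a, ha, hac⟩
  by_cases h1 : p = x + 2
  · subst h1
    obtain ⟨q, hq, hne⟩ := key (x + 1)
    exact ⟨_, .right s q hs hp hq hne⟩
  by_cases h2 : p = x - 2
  · subst h2
    obtain ⟨q, hq, hne⟩ := key (x - 1)
    exact ⟨_, .left s q hs hp hq hne⟩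
  exact ⟨_, .inner s p a b hs hp hp1 hp2 h1 h2 ha hb hab⟩

/-! ### The output -/

theorem Realizes.edgeSet_eq (hn : 5 ≤ n) {v : GrassmannRing n →ₐ[ℂ] ℂ} {s : AlgState n}
    (hR : Realizes v x F s) (hs : ¬ Running s) (e : ℤˣ) : s.graph.edgeSet = finalEdges e x := by
  have h := hR.1.finalEdges_subset (e := e) (x := x) hn
  rw [← hR.2.2.1] at h
  refine (Set.eq_of_subset_of_ncard_le h ?_ (Set.toFinite _)).symm
  rw [ncard_finalEdges hn]
  exact not_lt.1 hs

/-- When the loop stops, the fan of `x + e` consists of `x + 2e` and `x - e`, so that its label is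
the value of a single border triangle. -/
theorem Realizes.output (hn : 5 ≤ n) {v : GrassmannRing n →ₐ[ℂ] ℂ} {s : AlgState n}
    (hR : Realizes v x F s) (hs : ¬ Running s) (e : ℤˣ) :
    {pt e x 1, pt e x 2, pt (-e) x 1} ∈ F ∧
      s.label (pt e x 1) = some (v (plucker {pt e x 1, pt e x 2, pt (-e) x 1})) := by
  have hE := hR.edgeSet_eq hn hs e
  obtain ⟨hF, -, hg, -, hlab⟩ := hR
  rw [hg] at hE hlab
  have n1 : pt e x 1 ≠ pt (-e) x 1 := pt_ne_neg (by omega) (by omega)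
  have n2 : pt e x 2 ≠ pt (-e) x 1 := pt_ne_neg (by omega) (by omega)
  have n3 : pt e x 1 ≠ pt (-e) x 2 := pt_ne_neg (by omega) (by omega)
  have n4 : pt e x 2 ≠ pt e x 1 := pt_ne (by omega) (by omega) (by omega)
  have n5 : pt e x 2 ≠ pt (-e) x 2 := pt_ne_neg (by omega) (by omega)
  have hadj (a b : ZMod n) : (linkGraph F x).Adj a b ↔ s(a, b) ∈ finalEdges e x := by
    rw [← hE, SimpleGraph.mem_edgeSet]
  have h1 (b : ZMod n) (hb : (linkGraph F x).Adj (pt e x 1) b) :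
      b = pt e x 2 ∨ b = pt (-e) x 1 := by
    simp only [hadj, finalEdges, Set.mem_insert_iff, Set.mem_singleton_iff, Sym2.eq_iff] at hb
    tauto
  have h2 (b : ZMod n) (hb : (linkGraph F x).Adj (pt e x 2) b) : b = pt e x 1 := by
    simp only [hadj, finalEdges, Set.mem_insert_iff, Set.mem_singleton_iff, Sym2.eq_iff] at hb
    tauto
  have h12 := hF.adj_pt_one_pt_two (by omega) e x
  have htri := hF.isTriPoint_end hn e x
  have hdeg : deg (linkGraph F x) (pt e x 2) = 1 :=
    deg_eq_one_iff.2 ⟨_, fun b => ⟨h2 b, fun h => h ▸ h12.symm⟩⟩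
  have hl : IsLeafAt (linkGraph F x) (pt e x 1) (pt e x 2) := ⟨htri, h12, hdeg⟩
  obtain ⟨q, hq⟩ := hF.exists_nextTri hn htri n1
  have hq' : q = pt (-e) x 1 := by
    rcases h1 q (hq.adj hF hn) with rfl | h
    · exact (hl.not_isTriPoint hq.2.1).elim
    · exact h
  subst hq'
  have hf1 : InFan e x (linkGraph F x) (pt e x 1) (pt e x 2) := Or.inl hl
  have hf2 : InFan e x (linkGraph F x) (pt e x 1) (pt (-e) x 1) := Or.inr (Or.inr hq)
  have hlt : pos e x (pt e x 2) < pos e x (pt (-e) x 1) := by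
    rw [pos_pt (by omega), pos_neg_pt (by omega) (by omega)]
    omega
  have hK : IsFan e x (linkGraph F x) (pt e x 1) [pt e x 2, pt (-e) x 1] := by
    refine ⟨by simpa using hlt, fun b => ?_⟩
    rw [List.mem_cons, List.mem_singleton]
    constructor
    · rintro (rfl | rfl)
      exacts [hf1, hf2]
    · exact fun hb => h1 b (hb.adj hF hn)
  refine ⟨hf1.mem_of_consecutive hF hn hf2 hlt fun b hb h3 h4 => ?_, ?_⟩
  · rcases h1 b (hb.adj hF hn) with rfl | rfl
    · exact lt_irrefl _ h3
    · exact lt_irrefl _ h4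
  · rw [hlab, (borderLabel_end hn _ e htri).1 hl, hK.borderSum_eq hF hn, consecSum_cons_cons,
      consecSum_singleton, add_zero]

theorem Realizes.mem_of_not_running (hn : 5 ≤ n) {v : GrassmannRing n →ₐ[ℂ] ℂ} {s : AlgState n}
    (hR : Realizes v x F s) (hs : ¬ Running s) :
    ({x - 1, x + 1, x + 2} ∈ F ∧ {x - 2, x - 1, x + 1} ∈ F) ∧
    s.label (x + 1) = some (v (plucker {x - 1, x + 1, x + 2})) ∧
    s.label (x - 1) = some (v (plucker {x - 2, x - 1, x + 1})) := by
  have h1 := hR.output hn hs 1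
  have h2 := hR.output hn hs (-1)
  rw [neg_neg] at h2
  simp only [← add_one_eq, ← add_two_eq, ← sub_one_eq, ← sub_two_eq] at h1 h2
  have e1 : ({x + 1, x + 2, x - 1} : Finset (ZMod n)) = {x - 1, x + 1, x + 2} := by
    ext; simp only [Finset.mem_insert, Finset.mem_singleton]; tauto
  have e2 : ({x - 1, x - 2, x + 1} : Finset (ZMod n)) = {x - 2, x - 1, x + 1} := by
    ext; simp only [Finset.mem_insert, Finset.mem_singleton]; tauto
  rw [e1] at h1
  rw [e2] at h2
  exact ⟨⟨h1.1, h2.1⟩, h1.2, h2.2⟩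

theorem exists_realizes_init (hn : 5 ≤ n) {v : GrassmannRing n →ₐ[ℂ] ℂ} (hF : IsCluster F)
    (hv : HasValueAt v F x 1) {val : Finset (ZMod n) → ℂ}
    (hval : ∀ t ∈ borderTriangles x (linkGraph F x), val t = v (plucker t)) :
    ∃ F₁, Relation.ReflTransGen (LeafMutation v x) F F₁ ∧
      Realizes v x F₁ (initState x (linkGraph F x) val) := by
  rw [initState_congr hval]
  exact exists_realizes_initState hn _ F hF hv rfl

theorem Reachable.exists_realizes (hn : 5 ≤ n) {v : GrassmannRing n →ₐ[ℂ] ℂ} (hF : IsCluster F)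
    (hv : HasValueAt v F x 1) {val : Finset (ZMod n) → ℂ}
    (hval : ∀ t ∈ borderTriangles x (linkGraph F x), val t = v (plucker t)) {s : AlgState n}
    (h : Reachable x (linkGraph F x) val s) : ∃ F₁, Realizes v x F₁ s := by
  induction h with
  | refl => exact (exists_realizes_init hn hF hv hval).imp fun _ h => h.2
  | tail _ hs ih =>
    obtain ⟨F₁, h⟩ := ih
    exact (h.step hn hs).imp fun _ h => h.2

/-! ### Almost continuous Plücker coordinates -/

/-- The Plücker coordinate with two cyclically adjacent indices needs no sign. -/
theorem plucker_eq_coord (hn : 5 ≤ n) (v : GrassmannRing n →ₐ[ℂ] ℂ) (i j : ZMod n) :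
    v (plucker {i, i + 1, j}) = coord v i (i + 1) j := by
  have b0 : pos 1 i i = 0 := pos_eq_zero.2 rfl
  have b1 : pos 1 i (i + 1) = 1 := by
    rw [add_one_eq, pos_pt (by omega)]
  by_cases h0 : j = i
  · rw [coord_eq_zero (Or.inr (Or.inl h0.symm)), plucker, dif_neg, map_zero]
    rw [card_triple_eq_three]
    exact fun h => h.2.1 h0.symm
  by_cases h1 : j = i + 1
  · rw [coord_eq_zero (Or.inr (Or.inr h1.symm)), plucker, dif_neg, map_zero]
    rw [card_triple_eq_three]
    exact fun h => h.2.2 h1.symm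
  rw [coord_eq]
  rw [sbtw_iff_pos i, b0, b1]
  have h2 : pos 1 i j ≠ 0 := fun h => h0 (pos_eq_zero.1 h)
  have h3 : pos 1 i j ≠ 1 := fun h => h1 (pos_inj.1 (h.trans b1.symm))
  omega

theorem lowerDelta_eq_coord (hn : 5 ≤ n) (v : GrassmannRing n →ₐ[ℂ] ℂ) (k : ℕ) (i : ZMod n) :
    lowerDelta v k i = coord v i (i + 1) (i + k + 2) :=
  plucker_eq_coord hn v _ _

theorem upperDelta_eq_coord (hn : 5 ≤ n) (v : GrassmannRing n →ₐ[ℂ] ℂ) (k : ℕ) (i : ZMod n) :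
    upperDelta v k i = coord v (i + k + 1) (i + k + 1 + 1) i := by
  rw [← plucker_eq_coord hn, upperDelta]
  congr 2
  rw [show i + (k : ZMod n) + 1 + 1 = i + k + 2 by ring]
  ext
  simp only [Finset.mem_insert, Finset.mem_singleton]
  tauto

/-- The linear recurrence of order three behind all the recursions: the rows of the Plücker frieze
satisfy it, and the coefficients do not depend on the column `y`. -/
theorem coord_recurrence (hn : 5 ≤ n) {v : GrassmannRing n →ₐ[ℂ] ℂ}
    (hv : ∀ i : ZMod n, v (plucker {i, i + 1, i + 2}) = 1) (i y : ZMod n) :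
    coord v (i + 3) (i + 3 + 1) y = coord v i (i + 1) y
      - lowerDelta v 1 i * coord v (i + 1) (i + 1 + 1) y
      + upperDelta v 1 (i + 1) * coord v (i + 2) (i + 2 + 1) y := by
  have hI (m : ZMod n) : coord v m (m + 1) (m + 2) = 1 := by rw [← plucker_eq_coord hn, hv]
  have hA (m : ZMod n) : lowerDelta v 1 m = coord v m (m + 1) (m + 3) := by
    rw [lowerDelta_eq_coord hn]
    congr 1
    push_cast
    ring
  have hB (m : ZMod n) : upperDelta v 1 m = coord v m (m + 2) (m + 3) := by
    rw [upperDelta_eq_coord hn, ← coord_rotate]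
    congr 1 <;> push_cast <;> ring
  -- expand the last index of a coordinate in the three preceding indices
  have key (m z : ZMod n) : coord v y z (m + 3) = coord v y z m
      - upperDelta v 1 m * coord v y z (m + 1) + lowerDelta v 1 m * coord v y z (m + 2) := by
    have h1 := coord_relation v m (m + 1) (m + 2) (m + 3) y z
    have h2 : coord v (m + 1) (m + 2) (m + 3) = 1 := by
      have := hI (m + 1)
      rwa [show m + 1 + 1 = m + 2 by ring, show m + 1 + 2 = m + 3 by ring] at this
    rw [hI, h2] at h1
    rw [hA, hB]
    linear_combination -h1
  have k1 := key i (i + 1)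
  have k2 := key (i + 1) (i + 3)
  have z1 : coord v y (i + 1) (i + 1) = 0 := coord_eq_zero (by tauto)
  have z2 : coord v y (i + 3) (i + 3) = 0 := coord_eq_zero (by tauto)
  have s (a b : ZMod n) : coord v y b a = - coord v y a b := by
    rw [coord_rotate v y b a, coord_swap v a b y, coord_rotate v y a b]
  rw [show i + 1 + 3 = i + 3 + 1 by ring, show i + 1 + 1 = i + 2 by ring,
    show i + 1 + 2 = i + 3 by ring, z2, s (i + 1) (i + 3), s (i + 2) (i + 3)] at k2
  rw [z1, s i (i + 1)] at k1
  rw [show i + 1 + 1 = i + 2 by ring, show i + 2 + 1 = i + 3 by ring, ← coord_rotate v y,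
    ← coord_rotate v y, ← coord_rotate v y, ← coord_rotate v y]
  linear_combination k2 - k1

theorem lowerDelta_zero {v : GrassmannRing n →ₐ[ℂ] ℂ}
    (hv : ∀ i : ZMod n, v (plucker {i, i + 1, i + 2}) = 1) (i : ZMod n) :
    lowerDelta v 0 i = 1 := by
  rw [lowerDelta, Nat.cast_zero, add_zero, hv]

theorem upperDelta_zero {v : GrassmannRing n →ₐ[ℂ] ℂ}
    (hv : ∀ i : ZMod n, v (plucker {i, i + 1, i + 2}) = 1) (i : ZMod n) :
    upperDelta v 0 i = 1 := by
  rw [upperDelta, Nat.cast_zero, add_zero, hv]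

theorem lowerDelta_add_three (hn : 5 ≤ n) {v : GrassmannRing n →ₐ[ℂ] ℂ}
    (hv : ∀ i : ZMod n, v (plucker {i, i + 1, i + 2}) = 1) (k : ℕ) (i : ZMod n) :
    lowerDelta v (k + 3) i = lowerDelta v 1 i * lowerDelta v (k + 2) (i + 1)
      - upperDelta v 1 (i + 1) * lowerDelta v (k + 1) (i + 2) + lowerDelta v k (i + 3) := by
  have h := coord_recurrence hn hv i (i + (k + 3 : ℕ) + 2)
  rw [lowerDelta_eq_coord hn v (k + 3), lowerDelta_eq_coord hn v (k + 2),
    lowerDelta_eq_coord hn v (k + 1), lowerDelta_eq_coord hn v k]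
  rw [show i + 1 + ((k + 2 : ℕ) : ZMod n) + 2 = i + (k + 3 : ℕ) + 2 by push_cast; ring,
    show i + 2 + ((k + 1 : ℕ) : ZMod n) + 2 = i + (k + 3 : ℕ) + 2 by push_cast; ring,
    show i + 3 + (k : ZMod n) + 2 = i + (k + 3 : ℕ) + 2 by push_cast; ring]
  linear_combination -h

theorem upperDelta_add_three (hn : 5 ≤ n) {v : GrassmannRing n →ₐ[ℂ] ℂ}
    (hv : ∀ i : ZMod n, v (plucker {i, i + 1, i + 2}) = 1) (k : ℕ) (i : ZMod n) :
    upperDelta v (k + 3) i = upperDelta v 1 (i + k + 2) * upperDelta v (k + 2) i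
      - lowerDelta v 1 (i + k + 1) * upperDelta v (k + 1) i + upperDelta v k i := by
  have h := coord_recurrence hn hv (i + k + 1) i
  rw [upperDelta_eq_coord hn v (k + 3), upperDelta_eq_coord hn v (k + 2),
    upperDelta_eq_coord hn v (k + 1), upperDelta_eq_coord hn v k]
  rw [show i + ((k + 3 : ℕ) : ZMod n) + 1 = i + k + 1 + 3 by push_cast; ring,
    show i + ((k + 2 : ℕ) : ZMod n) + 1 = i + k + 1 + 2 by push_cast; ring,
    show i + ((k + 1 : ℕ) : ZMod n) + 1 = i + k + 1 + 1 by push_cast; ring,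
    show i + (k : ZMod n) + 2 = i + k + 1 + 1 by ring]
  linear_combination h

theorem lowerDelta_two (hn : 5 ≤ n) {v : GrassmannRing n →ₐ[ℂ] ℂ}
    (hv : ∀ i : ZMod n, v (plucker {i, i + 1, i + 2}) = 1) (i : ZMod n) :
    lowerDelta v 2 i = lowerDelta v 1 i * lowerDelta v 1 (i + 1) - upperDelta v 1 (i + 1) := by
  have h := coord_recurrence hn hv i (i + (2 : ℕ) + 2)
  have h0 : coord v (i + 3) (i + 3 + 1) (i + (2 : ℕ) + 2) = 0 :=
    coord_eq_zero (Or.inr (Or.inr (by push_cast; ring)))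
  have h1 : coord v (i + 2) (i + 2 + 1) (i + (2 : ℕ) + 2) = 1 := by
    rw [← plucker_eq_coord hn, Nat.cast_two, hv]
  rw [lowerDelta_eq_coord hn v 2, lowerDelta_eq_coord hn v 1 (i + 1),
    show i + 1 + ((1 : ℕ) : ZMod n) + 2 = i + (2 : ℕ) + 2 by push_cast; ring]
  linear_combination h0 - h - upperDelta v 1 (i + 1) * h1

theorem upperDelta_two (hn : 5 ≤ n) {v : GrassmannRing n →ₐ[ℂ] ℂ}
    (hv : ∀ i : ZMod n, v (plucker {i, i + 1, i + 2}) = 1) (i : ZMod n) :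
    upperDelta v 2 i = upperDelta v 1 (i + 1) * upperDelta v 1 i - lowerDelta v 1 i := by
  have h := coord_recurrence hn hv i i
  have h0 : coord v i (i + 1) i = 0 := coord_eq_zero (Or.inr (Or.inl rfl))
  have h1 : coord v (i + 1) (i + 1 + 1) i = 1 := by
    have := upperDelta_zero hv i
    rwa [upperDelta_eq_coord hn, Nat.cast_zero, add_zero] at this
  rw [upperDelta_eq_coord hn v 2, upperDelta_eq_coord hn v 1 i,
    show i + ((2 : ℕ) : ZMod n) + 1 = i + 3 by push_cast; ring,
    show i + ((1 : ℕ) : ZMod n) + 1 = i + 2 by push_cast; ring]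
  linear_combination h + h0 - lowerDelta v 1 i * h1

theorem lowerRec_eq (hn : 5 ≤ n) {v : GrassmannRing n →ₐ[ℂ] ℂ}
    (hv : ∀ i : ZMod n, v (plucker {i, i + 1, i + 2}) = 1) :
    ∀ (k : ℕ) (i : ZMod n), lowerRec (lowerDelta v 1) (upperDelta v 1) k i = lowerDelta v k i
  | 0, i => by rw [lowerRec, lowerDelta_zero hv]
  | 1, i => by rw [lowerRec]
  | 2, i => by rw [lowerRec, lowerDelta_two hn hv]
  | k + 3, i => by
    rw [lowerRec, lowerRec_eq hn hv (k + 2), lowerRec_eq hn hv (k + 1), lowerRec_eq hn hv k,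
      lowerDelta_add_three hn hv]

theorem upperRec_eq (hn : 5 ≤ n) {v : GrassmannRing n →ₐ[ℂ] ℂ}
    (hv : ∀ i : ZMod n, v (plucker {i, i + 1, i + 2}) = 1) :
    ∀ (k : ℕ) (i : ZMod n), upperRec (lowerDelta v 1) (upperDelta v 1) k i = upperDelta v k i
  | 0, i => by rw [upperRec, upperDelta_zero hv]
  | 1, i => by rw [upperRec]
  | 2, i => by rw [upperRec, upperDelta_two hn hv]
  | k + 3, i => by
    rw [upperRec, upperRec_eq hn hv (k + 2), upperRec_eq hn hv (k + 1), upperRec_eq hn hv k,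
      upperDelta_add_three hn hv]

/-! ### The frieze -/

theorem pluckerFrieze_eq_coord (hn : 5 ≤ n) (v : GrassmannRing n →ₐ[ℂ] ℂ) (i j : ℤ) :
    pluckerFrieze v i j = coord v (i : ZMod n) (i + 1) (i + j + 2) :=
  plucker_eq_coord hn v _ _

/-- The `3 × 3` diamonds with a given first column `y` all have the same determinant, since by the
recurrence a row operation passes from one to the next. -/
theorem det_coord_eq_one (hn : 5 ≤ n) {v : GrassmannRing n →ₐ[ℂ] ℂ}
    (hv : ∀ i : ZMod n, v (plucker {i, i + 1, i + 2}) = 1) (i y : ZMod n) :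
    (Matrix.of fun a b : Fin 3 => coord v (i + (a : ℕ)) (i + (a : ℕ) + 1) (y + (b : ℕ))).det
      = 1 := by
  have key (k : ℕ) : (Matrix.of fun a b : Fin 3 => coord v (y - 2 + k + (a : ℕ))
      (y - 2 + k + (a : ℕ) + 1) (y + (b : ℕ))).det = 1 := by
    induction k with
    | zero =>
      -- the matrix is unitriangular
      have h1 (m : ZMod n) : coord v m (m + 1) (m + 2) = 1 := by rw [← plucker_eq_coord hn, hv]
      have a00 := h1 (y - 2)
      have a11 := h1 (y - 2 + 1)
      have a22 := h1 (y - 2 + 2)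
      have a10 : coord v (y - 2 + 1) (y - 2 + 1 + 1) y = 0 :=
        coord_eq_zero (Or.inr (Or.inr (by ring)))
      have a20 : coord v (y - 2 + 2) (y - 2 + 2 + 1) y = 0 :=
        coord_eq_zero (Or.inr (Or.inl (by ring)))
      have a21 : coord v (y - 2 + 2) (y - 2 + 2 + 1) (y + 1) = 0 :=
        coord_eq_zero (Or.inr (Or.inr (by ring)))
      rw [show y - 2 + 2 = y by ring] at a00
      rw [show y - 2 + 1 + 2 = y + 1 by ring] at a11
      rw [show y - 2 + 2 + 2 = y + 2 by ring] at a22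
      rw [Matrix.det_fin_three]
      simp only [Matrix.of_apply, Fin.val_zero, Fin.val_one, Fin.val_two, Nat.cast_zero,
        Nat.cast_one, Nat.cast_ofNat, add_zero, a00, a11, a22, a10, a20, a21]
      ring
    | succ k ih =>
      rw [Matrix.det_fin_three] at ih ⊢
      simp only [Matrix.of_apply, Fin.val_zero, Fin.val_one, Fin.val_two, Nat.cast_zero,
        Nat.cast_one, Nat.cast_ofNat, add_zero, Nat.cast_add] at ih ⊢
      simp only [← add_assoc] at ih ⊢
      generalize y - 2 + (k : ZMod n) = m at ih ⊢
      have h := coord_recurrence hn hv m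
      rw [show m + 1 + 1 = m + 2 by ring] at *
      rw [show m + 1 + 2 = m + 3 by ring]
      rw [h y, h (y + 1), h (y + 2)]
      linear_combination ih
  obtain ⟨k, hk⟩ := ZMod.natCast_zmod_surjective (n := n) (i - (y - 2))
  have h := key k
  rwa [hk, add_sub_cancel] at h

/-- By the recurrence the rows of a `4 × 4` diamond are linearly dependent. -/
theorem det_coord_eq_zero (hn : 5 ≤ n) {v : GrassmannRing n →ₐ[ℂ] ℂ}
    (hv : ∀ i : ZMod n, v (plucker {i, i + 1, i + 2}) = 1) (i y : ZMod n) :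
    (Matrix.of fun a b : Fin 4 => coord v (i + (a : ℕ)) (i + (a : ℕ) + 1) (y + (b : ℕ))).det
      = 0 := by
  rw [← Matrix.exists_vecMul_eq_zero_iff]
  refine ⟨![1, -lowerDelta v 1 i, upperDelta v 1 (i + 1), -1], fun h => ?_, ?_⟩
  · have := congrFun h 0
    simp at this
  · ext b
    have h := coord_recurrence hn hv i (y + (b : ℕ))
    simp only [Matrix.vecMul, dotProduct, Fin.sum_univ_four, Matrix.of_apply, Pi.zero_apply]
    norm_num [Fin.coe_ofNat_eq_mod]
    rw [show (![1, -lowerDelta v 1 i, upperDelta v 1 (i + 1), -1] : Fin 4 → ℂ) 2 =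
        upperDelta v 1 (i + 1) from rfl,
      show (![1, -lowerDelta v 1 i, upperDelta v 1 (i + 1), -1] : Fin 4 → ℂ) 3 = -1 from rfl]
    linear_combination -h

theorem isTameSL3Frieze_pluckerFrieze (hn : 5 ≤ n) {v : GrassmannRing n →ₐ[ℂ] ℂ}
    (hv : ∀ i : ZMod n, v (plucker {i, i + 1, i + 2}) = 1) :
    IsTameSL3Frieze (n - 4) (pluckerFrieze v) := by
  have hw : ((n - 4 : ℕ) : ZMod n) = -4 := by
    rw [Nat.cast_sub (by omega), ZMod.natCast_self, zero_sub]
    norm_num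
  have hI (m : ZMod n) : coord v m (m + 1) (m + 2) = 1 := by rw [← plucker_eq_coord hn, hv]
  have hdiamond (i j : ℤ) (a b : ℕ) : pluckerFrieze v (i + a) (j + b - a) =
      coord v ((i : ZMod n) + a) ((i : ZMod n) + a + 1) ((i : ZMod n) + j + 2 + b) := by
    rw [pluckerFrieze_eq_coord hn]
    push_cast
    congr 1
    ring
  refine ⟨fun i => ⟨?_, ?_, ?_, ?_, ?_, ?_⟩, fun i j _ _ => ?_, fun i j _ _ => ?_⟩
  · rw [pluckerFrieze_eq_coord hn]
    exact coord_eq_zero (Or.inr (Or.inl (by push_cast; ring)))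
  · rw [pluckerFrieze_eq_coord hn]
    exact coord_eq_zero (Or.inr (Or.inr (by push_cast; ring)))
  · rw [pluckerFrieze_eq_coord hn, Int.cast_zero, add_zero, hI]
  · rw [pluckerFrieze_eq_coord hn, ← coord_rotate]
    have := hI ((i : ZMod n) - 1)
    convert this using 2
    · push_cast
      rw [hw]
      ring
    · ring
    · ring
  · rw [pluckerFrieze_eq_coord hn]
    exact coord_eq_zero (Or.inr (Or.inl (by push_cast; rw [hw]; ring)))
  · rw [pluckerFrieze_eq_coord hn]
    exact coord_eq_zero (Or.inr (Or.inr (by push_cast; rw [hw]; ring)))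
  · simp only [hdiamond]
    exact det_coord_eq_one hn hv _ _
  · simp only [hdiamond]
    exact det_coord_eq_zero hn hv _ _

theorem pluckerFrieze_natCast (v : GrassmannRing n →ₐ[ℂ] ℂ) (i : ℤ) (k : ℕ) :
    pluckerFrieze v i k = lowerDelta v k (i : ZMod n) := by
  rw [pluckerFrieze, lowerDelta, Int.cast_natCast]

/-- The second family of values appears in the frieze through the rotation `{i + k + 1, i + k + 2,
i}` of `{i, i + k + 1, i + k + 2}`. -/
theorem pluckerFrieze_reflect (hn : 5 ≤ n) (v : GrassmannRing n →ₐ[ℂ] ℂ) (i : ℤ) (k : ℕ) :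
    pluckerFrieze v (i + k + 1) ((n : ℤ) - 3 - k) = upperDelta v k (i : ZMod n) := by
  rw [pluckerFrieze_eq_coord hn, upperDelta_eq_coord hn]
  push_cast
  congr 1
  rw [ZMod.natCast_self]
  ring

/-! ### The output on a unitary cluster -/

theorem border_val_eq_one (hn : 5 ≤ n) {v : GrassmannRing n →ₐ[ℂ] ℂ} (hF : IsCluster F)
    (hv : ∀ t ∈ F, v (plucker t) = 1) (x : ZMod n) :
    ∀ t ∈ borderTriangles x (linkGraph F x), (1 : ℂ) = v (plucker t) :=
  fun t ht => (hv t (borderTriangles_subset hF hn ht)).symm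

/-- Since the loop terminates and never gets stuck, it stops in some state. -/
theorem exists_reachable_not_running (hn : 5 ≤ n) {v : GrassmannRing n →ₐ[ℂ] ℂ} (hF : IsCluster F)
    (hv : HasValueAt v F x 1) {val : Finset (ZMod n) → ℂ}
    (hval : ∀ t ∈ borderTriangles x (linkGraph F x), val t = v (plucker t)) :
    ∃ s, Reachable x (linkGraph F x) val s ∧ ¬ Running s := by
  have key (s : AlgState n) (hs : Acc (fun s' s => Step x s s') s) :
      Reachable x (linkGraph F x) val s →
      ∃ s, Reachable x (linkGraph F x) val s ∧ ¬ Running s := by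
    induction hs with
    | intro s _ ih =>
      intro hr
      by_cases h : Running s
      · obtain ⟨F₁, hF₁⟩ := hr.exists_realizes hn hF hv hval
        obtain ⟨s', hs'⟩ := hF₁.exists_step hn h
        exact ih s' hs' (Relation.ReflTransGen.tail hr hs')
      · exact ⟨s, hr, h⟩
  exact key _ (step_acc _) .refl

/-- The output of the algorithm exists and does not depend on the choices. -/
theorem outputs_iff (hn : 5 ≤ n) {v : GrassmannRing n →ₐ[ℂ] ℂ} (hF : IsCluster F)
    (hv : HasValueAt v F x 1) {val : Finset (ZMod n) → ℂ}
    (hval : ∀ t ∈ borderTriangles x (linkGraph F x), val t = v (plucker t)) {a b : ℂ} :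
    Outputs x (linkGraph F x) val b a ↔
      b = upperDelta v 1 (x - 1) ∧ a = lowerDelta v 1 (x - 2) := by
  have hb : upperDelta v 1 (x - 1) = v (plucker {x - 1, x + 1, x + 2}) := by
    rw [upperDelta, show x - 1 + ((1 : ℕ) : ZMod n) + 1 = x + 1 by push_cast; ring,
      show x - 1 + ((1 : ℕ) : ZMod n) + 2 = x + 2 by push_cast; ring]
  have ha : lowerDelta v 1 (x - 2) = v (plucker {x - 2, x - 1, x + 1}) := by
    rw [lowerDelta, show x - 2 + 1 = x - 1 by ring,
      show x - 2 + ((1 : ℕ) : ZMod n) + 2 = x + 1 by push_cast; ring]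
  rw [ha, hb]
  have key {s : AlgState n} (hr : Reachable x (linkGraph F x) val s) (hs : ¬ Running s) :
      s.label (x + 1) = some (v (plucker {x - 1, x + 1, x + 2})) ∧
      s.label (x - 1) = some (v (plucker {x - 2, x - 1, x + 1})) := by
    obtain ⟨F₁, h⟩ := hr.exists_realizes hn hF hv hval
    exact (h.mem_of_not_running hn hs).2
  constructor
  · rintro ⟨s, hr, hs, h1, h2⟩
    obtain ⟨h3, h4⟩ := key hr hs
    rw [h1] at h3
    rw [h2] at h4
    exact ⟨Option.some_injective _ h3, Option.some_injective _ h4⟩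
  · rintro ⟨rfl, rfl⟩
    obtain ⟨s, hr, hs⟩ := exists_reachable_not_running hn hF hv hval
    obtain ⟨h3, h4⟩ := key hr hs
    exact ⟨s, hr, hs, h3, h4⟩

end

theorem mainTheorem5 (n : ℕ) (hn : 5 ≤ n) :
    -- removing leaves
    (∀ (F : Set (Finset (ZMod n))) (v : GrassmannRing n →ₐ[ℂ] ℂ) (x : ZMod n) (c : ℂ),
      IsCluster F → HasValueAt v F x c →
      ∀ p q₂ : ZMod n, IsLeafAt (linkGraph F x) p q₂ → q₂ ≠ x + 2 → q₂ ≠ x - 2 →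
      ∃ (q₁ q₃ : ZMod n) (F' : Set (Finset (ZMod n))),
        [q₁, q₂, q₃] <:+: fan x (linkGraph F x) p ∧
        F' = (F ∪ {{p, q₁, q₃}}) \ {{x, p, q₂}} ∧
        IsMutation F F' ∧ IsCluster F' ∧ HasValueAt v F' x c ∧
        linkGraph F' x = (linkGraph F x).deleteEdges {s(p, q₂)} ∧
        v (plucker {p, q₁, q₃}) = v (plucker {p, q₁, q₂}) + v (plucker {p, q₂, q₃})) ∧
    -- removing edges at triangulation points of degree two
    (∀ (F : Set (Finset (ZMod n))) (v : GrassmannRing n →ₐ[ℂ] ℂ) (x : ZMod n) (c : ℂ),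
      IsCluster F → HasValueAt v F x c →
      ∀ p : ZMod n, deg (linkGraph F x) p = 2 → p ≠ x + 1 → p ≠ x - 1 →
      ∃ p₀ p₁ : ZMod n, IsNextTri x (linkGraph F x) p₀ p ∧ IsNextTri x (linkGraph F x) p p₁ ∧
        (p ≠ x + 2 → ∃ (q₁ : ZMod n) (F' : Set (Finset (ZMod n))),
          [q₁, p] <:+ fan x (linkGraph F x) p₀ ∧
          F' = (F ∪ {{q₁, p₀, p₁}}) \ {{x, p₀, p}} ∧
          IsMutation F F' ∧ IsCluster F' ∧ HasValueAt v F' x c ∧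
          linkGraph F' x = (linkGraph F x).deleteEdges {s(p₀, p)} ∧
          v (plucker {q₁, p₀, p₁}) = v (plucker {q₁, p₀, p}) + v (plucker {p₀, p, p₁})) ∧
        (p ≠ x - 2 → ∃ (q₂ : ZMod n) (F' : Set (Finset (ZMod n))),
          [p, q₂] <+: fan x (linkGraph F x) p₁ ∧
          F' = (F ∪ {{p₀, p₁, q₂}}) \ {{x, p, p₁}} ∧
          IsMutation F F' ∧ IsCluster F' ∧ HasValueAt v F' x c ∧
          linkGraph F' x = (linkGraph F x).deleteEdges {s(p, p₁)} ∧
          v (plucker {p₀, p₁, q₂}) = v (plucker {p, p₁, q₂}) + v (plucker {p₀, p, p₁}))) ∧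
    -- correctness of the algorithm
    (∀ (F : Set (Finset (ZMod n))) (v : GrassmannRing n →ₐ[ℂ] ℂ) (x : ZMod n),
      IsCluster F → HasValueAt v F x 1 →
      ∀ val : Finset (ZMod n) → ℂ,
      (∀ t ∈ borderTriangles x (linkGraph F x), val t = v (plucker t)) →
        -- the initialization is realized by mutations removing leaves
        (∃ F₁, Relation.ReflTransGen (LeafMutation v x) F F₁ ∧
          Realizes v x F₁ (initState x (linkGraph F x) val)) ∧
        -- every step of the loop is realized by mutations
        (∀ F₁ s s', Realizes v x F₁ s → Step x s s' →
          ∃ F₂, Relation.ReflTransGen (EdgeMutation v x) F₁ F₂ ∧ Realizes v x F₂ s') ∧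
        -- the loop terminates, whatever the choices
        Acc (fun s' s => Step x s s') (initState x (linkGraph F x) val) ∧
        (∀ s, Reachable x (linkGraph F x) val s →
          -- the loop never gets stuck
          (Running s → ∃ s', Step x s s') ∧
          -- when it stops, only three edges remain and the output is correct
          (¬ Running s →
            s.graph.edgeSet = {s(x - 2, x - 1), s(x - 1, x + 1), s(x + 1, x + 2)} ∧
            (∀ F₁, Realizes v x F₁ s →
              {x - 1, x + 1, x + 2} ∈ F₁ ∧ {x - 2, x - 1, x + 1} ∈ F₁) ∧
            s.label (x + 1) = some (v (plucker {x - 1, x + 1, x + 2})) ∧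
            s.label (x - 1) = some (v (plucker {x - 2, x - 1, x + 1}))))) ∧
    -- the recursion for almost continuous Plücker coordinates
    (∀ v : GrassmannRing n →ₐ[ℂ] ℂ, (∀ i : ZMod n, v (plucker {i, i + 1, i + 2}) = 1) →
      ∀ i : ZMod n,
        (∀ k : ℕ, 3 ≤ k → k < n - 3 →
          lowerDelta v k i = lowerDelta v 1 i * lowerDelta v (k - 1) (i + 1)
            - upperDelta v 1 (i + 1) * lowerDelta v (k - 2) (i + 2)
            + lowerDelta v (k - 3) (i + 3) ∧
          upperDelta v k i = upperDelta v 1 (i + k - 1) * upperDelta v (k - 1) i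
            - lowerDelta v 1 (i + k - 2) * upperDelta v (k - 2) i + upperDelta v (k - 3) i) ∧
        lowerDelta v 2 i = lowerDelta v 1 i * lowerDelta v 1 (i + 1) - upperDelta v 1 (i + 1) ∧
        upperDelta v 2 i = upperDelta v 1 (i + 1) * upperDelta v 1 i - lowerDelta v 1 i) ∧
    -- all entries of a unitary frieze are computed from the cluster
    (∀ (F : Set (Finset (ZMod n))) (m : ℤ → ℤ → ℂ), IsUnitaryFriezeOf F m →
      IsTameSL3Frieze (n - 4) m ∧
      (∃ a b : ZMod n → ℂ,
        ∀ x, Outputs x (linkGraph F x) (fun _ => 1) (b (x - 1)) (a (x - 2))) ∧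
      (∀ a b : ZMod n → ℂ,
        (∀ x, Outputs x (linkGraph F x) (fun _ => 1) (b (x - 1)) (a (x - 2))) →
        ∀ i : ℤ, ∀ k : ℕ, 1 ≤ k → k ≤ n - 4 →
          m i k = lowerRec a b k (i : ZMod n) ∧
          m (i + k + 1) ((n : ℤ) - 3 - k) = upperRec a b k (i : ZMod n))) := by
  have : NeZero n := ⟨by omega⟩
  refine ⟨?_, ?_, ?_, ?_, ?_⟩
  · intro F v x c hF hv p q₂ hl hq hq'
    obtain ⟨q₁, q₃, F', L, M, hfan, h⟩ := hl.exists_mutation hF hn hv hq hq'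
    exact ⟨q₁, q₃, F', ⟨L, M, by rw [hfan]; simp⟩, h⟩
  · intro F v x c hF hv p hp hp1 hp2
    obtain ⟨p₀, p₁, h0, h1, h01, hT, -⟩ := exists_neighbours_of_deg_two (e := 1) hF hn hp
      (by rwa [← add_one_eq]) (by rwa [← sub_one_eq])
    refine ⟨p₀, p₁, isNextTri_iff.2 h0, isNextTri_iff.2 h1, fun hp3 => ?_, fun hp3 => ?_⟩
    · rw [add_two_eq] at hp3
      obtain ⟨q₁, F', L, hfan, h⟩ := exists_mutation_of_deg_two hF hn hv h0 h1 h01 hT hp3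
      refine ⟨q₁, F', ?_, h⟩
      rw [(isFan_fan hF hn p₀).unique hfan]
      exact ⟨L, rfl⟩
    · -- the mirror image of the preceding case
      rw [sub_two_eq] at hp3
      have e1 (a : ZMod n) : ({p₁, p₀, a} : Finset (ZMod n)) = {p₀, p₁, a} :=
        Finset.insert_comm _ _ _
      obtain ⟨q₂, F', L, hfan, h2, h3, h4, h5, h6, h7⟩ := exists_mutation_of_deg_two (e := -1) hF hn
        hv (nextTri_neg.2 h1) (nextTri_neg.2 h0) h01.symm (by rwa [Finset.pair_comm]) hp3
      have hfan' := hfan.reverse hF hn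
      rw [neg_neg] at hfan'
      have s1 (a b c : ZMod n) : ({a, b, c} : Finset (ZMod n)) = {c, b, a} := by
        ext; simp only [Finset.mem_insert, Finset.mem_singleton]; tauto
      refine ⟨q₂, F', ?_, ?_, h3, h4, h5, ?_, ?_⟩
      · rw [(isFan_fan hF hn p₁).unique hfan', List.reverse_append]
        exact ⟨L.reverse, by simp⟩
      · rw [h2, s1 q₂, Finset.pair_comm p₁ p]
      · rw [h6, Sym2.eq_swap]
      · rw [s1 q₂ p₁ p₀, s1 q₂ p₁ p, s1 p₁ p p₀] at h7
        exact h7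
  · intro F v x hF hv val hval
    refine ⟨exists_realizes_init hn hF hv hval, fun F₁ s s' h hs => h.step hn hs, step_acc _,
      fun s hs => ?_⟩
    obtain ⟨F₁, hR⟩ := hs.exists_realizes hn hF hv hval
    refine ⟨hR.exists_step hn, fun hrun => ⟨?_, fun F₂ h => (h.mem_of_not_running hn hrun).1,
      (hR.mem_of_not_running hn hrun).2⟩⟩
    rw [hR.edgeSet_eq hn hrun 1, finalEdges_eq]
  · intro v hv i
    refine ⟨fun k hk _ => ?_, lowerDelta_two hn hv i, upperDelta_two hn hv i⟩
    obtain ⟨k, rfl⟩ := Nat.exists_eq_add_of_le' hk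
    refine ⟨lowerDelta_add_three hn hv k i, ?_⟩
    rw [show i + ((k + 3 : ℕ) : ZMod n) - 1 = i + k + 2 by push_cast; ring,
      show i + ((k + 3 : ℕ) : ZMod n) - 2 = i + k + 1 by push_cast; ring]
    exact upperDelta_add_three hn hv k i
  · rintro F m ⟨hF, v, hv, rfl⟩
    have hI (i : ZMod n) : v (plucker {i, i + 1, i + 2}) = 1 :=
      hv _ (hF.mem_interval (by omega) i)
    have hout (x : ZMod n) (a b : ℂ) : Outputs x (linkGraph F x) (fun _ => 1) b a ↔
        b = upperDelta v 1 (x - 1) ∧ a = lowerDelta v 1 (x - 2) :=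
      outputs_iff hn hF ⟨one_ne_zero, fun t ht _ => hv t ht⟩ (border_val_eq_one hn hF hv x)
    refine ⟨isTameSL3Frieze_pluckerFrieze hn hI,
      ⟨lowerDelta v 1, upperDelta v 1, fun x => (hout _ _ _).2 ⟨rfl, rfl⟩⟩,
      fun a b hab i k _ _ => ?_⟩
    have ha : a = lowerDelta v 1 := funext fun i => by
      have := ((hout _ _ _).1 (hab (i + 2))).2
      rwa [add_sub_cancel_right] at this
    have hb : b = upperDelta v 1 := funext fun i => by
      have := ((hout _ _ _).1 (hab (i + 1))).1
      rwa [add_sub_cancel_right] at this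
    rw [ha, hb, lowerRec_eq hn hI, upperRec_eq hn hI]
    exact ⟨pluckerFrieze_natCast v i k, pluckerFrieze_reflect hn v i k⟩
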